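/- **Setting.** There are $n$ arms. Arm $i$ has a finite state set $S_i$, a root $\rho_i\in S_i$, transition probabilities $p_{u,v}\ge 0$ with an arbitrary transition graph ($\sum_v p_{u,v}=1$, or $u$ is terminal: it has no outgoing arc and the arm is exhausted after a play at $u$), and rewards $r_u\ge 0$ earned for each play at $u$. At most $B$ plays may be made in total. Write $S=\bigcup_i S_i$ (disjoint union). The instance is *layered* if each state $u$ is reachable from its root and has a depth, with $\mathrm{depth}(\rho_i)=0$ and $\mathrm{depth}(v)=\mathrm{depth}(u)+1$ whenever $p_{u,v}>0$. **The linear program** $\mathsf{LP}_{\mathsf{mabdag}}$, for variables $z_{u,t},w_{u,t}\in[0,1]$ ($u\in S$, $1\le t\le B$): maximize $\sum_{u,t} r_u z_{u,t}$ subject to $w_{u,t}=\sum_v z_{v,t-1}p_{v,u}$ for $2\le t\le B$ and $u$ not a root; $\sum_{t'\le t}w_{u,t'}\ge\sum_{t'\le t}z_{u,t'}$ for all $u,t$; $\sum_{u}z_{u,t}\le 1$ for all $t$; $w_{\rho_i,1}=1$; and $w_{\rho_i,t}=0$ for $t\ge2$, $w_{u,1}=0$ for $u$ not a root. **Strategy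 dags.** A strategy dag $D$ for arm $i$ has a root time $t_0\in[1,B]$, for each node $(u,t)$ and each $v$ a time $t'\in[t+1,B]\cup\{\infty\}$, written $(u,t)\to(v,t')$ (only the arcs with $p_{u,v}>0$ matter), and numbers $\mathrm{prob}(u,t)\ge 0$ with $\mathrm{prob}(\rho_i,t)=0$ for $t\ne t_0$ and $\mathrm{prob}(v,t)=\sum_{(u,t')\to(v,t)}\mathrm{prob}(u,t')\,p_{u,v}$ for $v\neq\rho_i$, $1\le t\le B$. **Peeling decomposition** of a feasible $z$, for arm $i$ of a layered instance: while $\sum_t z_{u,t}>0$ for some $u\in S_i$, peel off one dag. To do so, mark $(\rho_i,t_0)$, with $t_0$ the earliest time with $z_{\rho_i,t_0}>0$, and give it the value $\mathrm{peel}=1$ (all others $0$); visit marked nodes $(u,t)$ by increasing depth, then increasing time; for each $v$ with $p_{u,v}>0$ let $t'>t$ be the earliest later time with $z_{v,t'}>0$, mark $(v,t')$, set $(u,t)\to(v,t')$ and add $\mathrm{peel}(u,t)\,p_{u,v}$ to $\mathrm{peel}(v,t')$; if there is no such $t'$, set $(u,t)\to(v,\infty)$. Put $\varepsilon=\min z_{u,t}/\mathrm{peel}(u,t)$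 over $\mathrm{peel}(u,t)\ne0$, $\mathrm{prob}=\varepsilon\cdot\mathrm{peel}$, and subtract $\mathrm{prob}$ from $z$. Call the resulting dags $D(i,j)$. **Blown-up trees and GapFill.** The tree $DT(i,j)$ has the paths of $D(i,j)$ from its root as vertices (extended along $\to$ from nodes of finite time and arcs with $p_{u,v}>0$); $\mathrm{time}(P)$ and $\mathrm{depth}(P)$ are the time and the depth of the state of the last node of $P$. $\mathrm{Head}(P)$ is the ancestor of least depth from which times increase by exactly one down to $P$. *GapFill*: for $\tau=B,\dots,1$, as long as some head $v$ has $\tau=\mathrm{time}(v)<2\,\mathrm{depth}(v)$, shift all vertices with head $v$ so that $\mathrm{time}(v)$ becomes $\mathrm{time}(\mathrm{parent}(v))+1$ (in any order). **AlgDAG** (on trees with given times): independently for each arm choose $DT(i,j)$ with probability $\mathrm{prob}(\mathrm{root}(D(i,j)))/24$, and otherwise ignore the arm. Each chosen arm is active and starts at its root. While some arm is active, take the active arm whose current vertex has the earliest time $\tau$ (ties to the smallest index), and keep playing it, moving to the child vertex given by the observed transition and increasing $\tau$ by one after each play, as long as its current time is finite and equals $\tau$; drop it when its current time is $\infty$ or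 it is exhausted. *ImplicitFill* is the same on the trees before GapFill, where the inner loop also continues if the time is finite and $2\,\mathrm{depth}>\mathrm{time}$ at the current vertex. *ImplicitPlay* is ImplicitFill run on the nodes of $D(i,j)$ instead of $DT(i,j)$. Only the first $B$ plays earn reward. **Theorem.** There are an absolute constant $c>0$ and a polynomial $q$ such that the following holds for every layered instance and every $B\ge 0$. The LP has an optimal solution. For every feasible solution $(z,w)$ (in particular for an optimal one): 1. the peeling decomposition ends with strategy dags $D(i,j)$ with $\sum_j\mathrm{prob}(i,j,u,t)=z_{u,t}$ for $u\in S_i$, $1\le t\le B$, and the probabilities of the choices are non-negative; 2. GapFill can be run to completion on every $DT(i,j)$, and for every possible outcome the expected reward of AlgDAG on the gap-filled trees is at least $c\sum_{u,t}r_uz_{u,t}$; for optimal $(z,w)$ this is $c$ times the optimum of $\mathsf{LP}_{\mathsf{mabdag}}$; 3. for every choice of the dags and every $k$, the first $k$ plays of ImplicitFill and of ImplicitPlay have the same law as those of AlgDAG on the gap-filled trees; in particular the expected rewards are the same; 4. given $z$, the decomposition of all arms together with ImplicitPlay takes at most $q(B+|S|)$ elementary steps (unit-cost arithmetic on reals,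 comparisons, table accesses, plays; choosing one of $m$ dags takes $m+1$ steps), for every choice of the dags, every outcome of the plays and any number of plays. Moreover, let an arbitrary instance and $B\ge1$ be given. Replace each arm by its layered copy, with states $(u,t)$, $1\le t\le B$, arcs $(u,t)\to(v,t+1)$ of probability $p_{u,v}$, rewards $r_u$, and states not reachable from $(\rho_i,1)$ deleted. This is a layered instance with at most $B|S_i|$ states in arm $i$. Every strategy for the copy, fed with a count of the plays of each arm, is a strategy for the original instance, with the same law of the first $B$ plays. Every adaptive strategy for the original instance has expected reward in $B$ plays at most the optimum of $\mathsf{LP}_{\mathsf{mabdag}}$ of the copy. -/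

import Mathlib

open Finset

noncomputable section

/-! ### Multi-armed bandits with Markovian arms -/

/-- A finite collection of arms. Arm `i` has a finite set `S i` of states, a starting state
`root i`, transition probabilities `p i u v` and a reward `r i u` for each play made at the
state `u`. The transition graph (the pairs with `0 < p i u v`) is arbitrary. The probabilities
out of a state sum to one, unless the state is terminal: it has no outgoing arc, and once it has
been played the arm is exhausted. -/
structure MAB where
  n : ℕ
  S : Fin n → Type
  [fin : ∀ i, Fintype (S i)]
  root : ∀ i, S i
  p : ∀ i, S i → S i → ℝ
  r : ∀ i, S i → ℝ
  p_nonneg : ∀ i u v, 0 ≤ p i u v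
  p_sum : ∀ i u, ∑ v, p i u v = 1 ∨ ∀ v, p i u v = 0
  r_nonneg : ∀ i u, 0 ≤ r i u

attribute [instance] MAB.fin

/-- The total number of states. -/
def MAB.size (M : MAB) : ℕ := ∑ i, Fintype.card (M.S i)

/-- The transition graphs are layered directed acyclic graphs: every state is reachable from the
root, and every arc goes from one layer to the next. Then `depth i u` is the number of hops from
the root to `u`. -/
structure MAB.IsLayered (M : MAB) (depth : ∀ i, M.S i → ℕ) : Prop where
  depth_root : ∀ i, depth i (M.root i) = 0
  depth_succ : ∀ i u v, 0 < M.p i u v → depth i v = depth i u + 1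
  reachable : ∀ i u, Relation.ReflTransGen (fun a b => 0 < M.p i a b) (M.root i) u

/-- The probability that a play of arm `i` at the state `u` leads to the outcome `o`: a new state,
or `none` when the arm becomes exhausted. -/
def MAB.outcome (M : MAB) (i : Fin M.n) (u : M.S i) : Option (M.S i) → ℝ
  | some v => M.p i u v
  | none => 1 - ∑ v, M.p i u v

/-! ### The reduction to layered graphs -/

/-- Arcs `(u, t) → (v, t + 1)` between the copies of the states of arm `i`. Layers are numbered
from `0` to `B - 1`. -/
def MAB.LayerArc (M : MAB) (B : ℕ) (i : Fin M.n) (x y : M.S i × Fin B) : Prop :=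
  0 < M.p i x.1 y.1 ∧ (y.2 : ℕ) = x.2 + 1

/-- The copies of the states of arm `i` that are reachable from the first copy of the root. -/
abbrev MAB.LayerState (M : MAB) (B : ℕ) (hB : 0 < B) (i : Fin M.n) : Type :=
  {x : M.S i × Fin B // Relation.ReflTransGen (M.LayerArc B i) (M.root i, ⟨0, hB⟩) x}

open Classical in
/-- Replace every arm by its layered copy. -/
def MAB.layered (M : MAB) (B : ℕ) (hB : 0 < B) : MAB where
  n := M.n
  S := M.LayerState B hB
  root i := ⟨(M.root i, ⟨0, hB⟩), .refl⟩
  p i x y := if (y.1.2 : ℕ) = x.1.2 + 1 then M.p i x.1.1 y.1.1 else 0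
  r i x := M.r i x.1.1
  p_nonneg i x y := by
    split
    · exact M.p_nonneg i _ _
    · exact le_rfl
  p_sum i x := by
    by_cases hx : (x.1.2 : ℕ) + 1 < B
    · rcases M.p_sum i x.1.1 with h | h
      · left
        rw [← h, ← Finset.sum_filter]
        refine Finset.sum_bij_ne_zero (fun y _ _ => y.1.1) (fun _ _ _ => Finset.mem_univ _)
          ?_ ?_ ?_
        · intro y hy _ y' hy' _ he
          have h1 := (Finset.mem_filter.1 hy).2
          have h2 := (Finset.mem_filter.1 hy').2
          exact Subtype.ext (Prod.ext he (Fin.ext (h1.trans h2.symm)))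
        · intro v _ hv
          exact ⟨⟨(v, ⟨x.1.2 + 1, hx⟩), x.2.tail
            ⟨lt_of_le_of_ne (M.p_nonneg i _ _) (Ne.symm hv), rfl⟩⟩,
            Finset.mem_filter.2 ⟨Finset.mem_univ _, rfl⟩, hv, rfl⟩
        · intro _ _ _
          rfl
      · right
        intro y
        simp [h]
    · right
      intro y
      have := y.1.2.2
      rw [if_neg (by omega)]
  r_nonneg i _ := M.r_nonneg i _

/-! ### Computations with a step count -/

/-- A value together with the number of elementary steps spent on computing it. -/
structure Timed (α : Type) where
  val : α
  cost : ℕ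

instance : Monad Timed where
  pure a := ⟨a, 0⟩
  bind x f := ⟨(f x.val).val, x.cost + (f x.val).cost⟩

/-- Spend `k` steps. -/
def tick (k : ℕ) : Timed Unit := ⟨(), k⟩

/-- One elementary operation with result `a`: an arithmetic operation or a comparison on numbers,
or reading or writing one entry of a table. -/
def op {α : Type} (a : α) : Timed α := ⟨a, 1⟩

open Classical in
/-- Write one entry of a table. -/
def write {S α : Type} (f : S → ℕ → α) (u : S) (t : ℕ) (a : α) : S → ℕ → α :=
  fun u' t' => if u' = u ∧ t' = t then a else f u' t'

/-! ### Strategies playing the arms -/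

/-- An adaptive strategy. Its internal state may remember everything that it has seen. It names
the next arm to be played (or stops), and it is then told the outcome of the play. -/
structure Agent (M : MAB) where
  State : Type
  choose : State → Option (Fin M.n)
  update : State → (i : Fin M.n) → Option (M.S i) → Timed State

open Classical in
/-- The expected value of `F (list of the states that were played, latest first)` when the
agent makes at most `k` further plays from its internal state `c`, where `s i` is the current
state of arm `i` (`none` if it is exhausted) and `h` lists the earlier plays. -/
def Agent.expect {M : MAB} (A : Agent M) (F : List (Σ i, M.S i) → ℝ) :
    ℕ → A.State → (∀ i, Option (M.S i)) → List (Σ i, M.S i) → ℝ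
  | 0, _, _, h => F h
  | k + 1, c, s, h =>
    match A.choose c with
    | none => F h
    | some i =>
      match s i with
      | none => F h
      | some u => ∑ o, M.outcome i u o *
          A.expect F k (A.update c i o).val (Function.update s i o) (⟨i, u⟩ :: h)

open Classical in
/-- The largest total number of steps that the agent spends during its first `k` plays, over all
outcomes of these plays; each play itself is one step. -/
def Agent.worstCost {M : MAB} (A : Agent M) : ℕ → A.State → (∀ i, Option (M.S i)) → ℕ
  | 0, _, _ => 0
  | k + 1, c, s =>
    match A.choose c with
    | none => 0
    | some i =>
      match s i with
      | none => 0
      | some _ => univ.sup fun o => 1 + (A.update c i o).cost +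
          A.worstCost k (A.update c i o).val (Function.update s i o)

/-- All arms are in their starting states. -/
def MAB.start (M : MAB) : ∀ i, Option (M.S i) := fun i => some (M.root i)

/-- The total reward of a list of plays. -/
def MAB.reward (M : MAB) (h : List (Σ i, M.S i)) : ℝ := (h.map fun x => M.r x.1 x.2).sum

open Classical in
/-- Use an agent for the layered copy to play the original arms: count the plays of each arm, and
present a new state `v` of an arm as its copy in the next layer. -/
def Agent.unlayer {M : MAB} {B : ℕ} {hB : 0 < B} (A : Agent (M.layered B hB)) : Agent M where
  State := A.State × (∀ i : Fin M.n, Option (M.LayerState B hB i))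
  choose c := A.choose c.1
  update c i o := do
    let cur ← op (c.2 i)
    let new : Option (M.LayerState B hB i) ← op (match cur, o with
      | some x, some v =>
        if h : ∃ y : M.LayerState B hB i, y.1.1 = v ∧ (y.1.2 : ℕ) = x.1.2 + 1 then
          some h.choose else none
      | _, _ => none)
    let a ← A.update c.1 i new
    let s ← op (Function.update c.2 i new)
    return (a, s)

/-! ### The linear program -/

/-- Feasible solutions of the time-indexed relaxation. Times run from `1` to `B`; `z i u t` stands
for the probability of playing the state `u` at time `t`, and `w i u t` for the probability of
entering `u` at time `t`. At time `1` exactly the roots are entered, and they are not entered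
later. -/
structure MAB.IsFeasible (M : MAB) (B : ℕ) (z w : ∀ i, M.S i → ℕ → ℝ) : Prop where
  z_mem : ∀ t ∈ Icc 1 B, ∀ i u, z i u t ∈ Set.Icc (0 : ℝ) 1
  w_mem : ∀ t ∈ Icc 1 B, ∀ i u, w i u t ∈ Set.Icc (0 : ℝ) 1
  flow : ∀ t ∈ Icc 2 B, ∀ i u, u ≠ M.root i → w i u t = ∑ v, z i v (t - 1) * M.p i v u
  enter : ∀ t ∈ Icc 1 B, ∀ i u, ∑ t' ∈ Icc 1 t, z i u t' ≤ ∑ t' ∈ Icc 1 t, w i u t'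
  cap : ∀ t ∈ Icc 1 B, ∑ i, ∑ u, z i u t ≤ 1
  root_first : ∀ i, w i (M.root i) 1 = 1
  root_later : ∀ t ∈ Icc 2 B, ∀ i, w i (M.root i) t = 0
  other_first : ∀ i u, u ≠ M.root i → w i u 1 = 0

/-- The objective of the linear program. -/
def MAB.value (M : MAB) (B : ℕ) (z : ∀ i, M.S i → ℕ → ℝ) : ℝ :=
  ∑ i, ∑ u, ∑ t ∈ Icc 1 B, M.r i u * z i u t

/-- Optimal solutions of the linear program. -/
def MAB.IsOptimal (M : MAB) (B : ℕ) (z w : ∀ i, M.S i → ℕ → ℝ) : Prop :=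
  M.IsFeasible B z w ∧ ∀ z' w', M.IsFeasible B z' w' → M.value B z' ≤ M.value B z

/-! ### Phase I: peeling off strategy dags -/

/-- The data of a strategy dag on the nodes `(u, t)`: the node `(u, t)` has the arcs
`(u, t) → (v, next u t v)`, where the time `⊤` means that `v` is not played. The root is
`(root, rootTime)`. -/
structure StratDag (S : Type) where
  rootTime : ℕ
  next : S → ℕ → S → ℕ∞
  prob : S → ℕ → ℝ

open Classical in
/-- The two conditions on a strategy dag for arm `i`: arcs go strictly forward in time, and the
probability of a node is what flows into it. All play happens at times in `[1, B]`, and the root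
state is played at the time `rootTime` only. -/
structure MAB.IsStratDag (M : MAB) (B : ℕ) (i : Fin M.n) (D : StratDag (M.S i)) : Prop where
  rootTime_mem : D.rootTime ∈ Icc 1 B
  next_gt : ∀ u v, 0 < M.p i u v → ∀ t : ℕ, (t : ℕ∞) + 1 ≤ D.next u t v
  next_le : ∀ u v (t : ℕ), D.next u t v = ⊤ ∨ D.next u t v ≤ B
  prob_nonneg : ∀ u, ∀ t ∈ Icc 1 B, 0 ≤ D.prob u t
  prob_root : ∀ t ∈ Icc 1 B, t ≠ D.rootTime → D.prob (M.root i) t = 0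
  prob_eq : ∀ v, v ≠ M.root i → ∀ t ∈ Icc 1 B, D.prob v t =
    ∑ u, ∑ t' ∈ Icc 1 B, if D.next u t' v = t then D.prob u t' * M.p i u v else 0

/-- The first of the `k` times `t, t + 1, …` at which the row `f` is positive. -/
def firstPos (f : ℕ → ℝ) : ℕ → ℕ → Timed (Option ℕ)
  | 0, _ => return none
  | k + 1, t => do
    let x ← op (f t)
    if (← op (decide (0 < x))) then return some t else firstPos f k (t + 1)

/-- The tables kept while a strategy dag is peeled off. -/
structure PeelState (S : Type) where
  marked : S → ℕ → Bool
  peel : S → ℕ → ℝ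
  next : S → ℕ → S → ℕ∞

section Decomposition

variable (M : MAB) (B : ℕ) (i : Fin M.n) (depth : M.S i → ℕ)

open Classical in
/-- Process the transition from the node `(u, t)` to the state `v`: look for the earliest time
`t' > t` with `z v t' > 0`. If there is none, then `(u, t) → (v, ⊤)`, which is the default. -/
def peelArc (z : M.S i → ℕ → ℝ) (u : M.S i) (t : ℕ) (s : PeelState (M.S i)) (v : M.S i) :
    Timed (PeelState (M.S i)) := do
  let q ← op (M.p i u v)
  if (← op (decide (0 < q))) then
    match (← firstPos (z v) (B - t) (t + 1)) with
    | some t' =>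
      let a ← op (s.peel v t')
      let b ← op (s.peel u t)
      let c ← op (b * q)
      let d ← op (a + c)
      let peel ← op (write s.peel v t' d)
      let marked ← op (write s.marked v t' true)
      let next ← op (fun u' t'' v' =>
        if u' = u ∧ t'' = t ∧ v' = v then (t' : ℕ∞) else s.next u' t'' v')
      return ⟨marked, peel, next⟩
    | none => return s
  else return s

/-- Visit the node `(u, t)`, if it is marked and `u` has depth `d`. -/
def peelNode (z : M.S i → ℕ → ℝ) (d t : ℕ) (s : PeelState (M.S i)) (u : M.S i) :
    Timed (PeelState (M.S i)) := do
  let e ← op (depth u)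
  if (← op (decide (e = d))) then
    if (← op (s.marked u t)) then univ.toList.foldlM (peelArc M B i z u t) s else return s
  else return s

/-- The subroutine that peels off one dag: mark the root at the earliest time at which it is
played, then visit the marked nodes by increasing depth and, within one depth, by increasing
time. Visiting a node of depth `d` marks only nodes of depth `d + 1`, and a marked node of depth
`d` has a time greater than `d`. The result is the time of the root and the tables. -/
def peelStrat (z : M.S i → ℕ → ℝ) : Timed (Option (ℕ × PeelState (M.S i))) := do
  match (← firstPos (z (M.root i)) B 1) with
  | none => return none
  | some t₀ =>
    let marked ← op (write (fun _ _ => false) (M.root i) t₀ true)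
    let peel ← op (write (fun _ _ => (0 : ℝ)) (M.root i) t₀ 1)
    let s ← (List.range B).foldlM (fun s d =>
      (List.range' 1 B).foldlM (fun s t =>
        univ.toList.foldlM (peelNode M B i depth z d t) s) s)
      (⟨marked, peel, fun _ _ _ => ⊤⟩ : PeelState (M.S i))
    return some (t₀, s)

/-- The list of all nodes `(u, t)`. -/
def dagNodes : List (M.S i × ℕ) := univ.toList ×ˢ List.range' 1 B

/-- The minimum of `z u t / peel u t` over the nodes with `peel u t ≠ 0`. -/
def minRatio (z peel : M.S i → ℕ → ℝ) : Timed (Option ℝ) :=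
  (dagNodes M B i).foldlM (fun best x => do
    let a ← op (peel x.1 x.2)
    if (← op (decide (a ≠ 0))) then
      let b ← op (z x.1 x.2)
      let c ← op (b / a)
      match best with
      | none => return some c
      | some m => if (← op (decide (c < m))) then return some c else return some m
    else return best) none

/-- Scale the probabilities of the dag by `ε` and subtract them from the solution. The result is
the table of the probabilities and the residual solution. -/
def subtractDag (ε : ℝ) (z peel : M.S i → ℕ → ℝ) :
    Timed ((M.S i → ℕ → ℝ) × (M.S i → ℕ → ℝ)) :=
  (dagNodes M B i).foldlM (fun y x => do
    let a ← op (peel x.1 x.2)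
    let b ← op (ε * a)
    let prob ← op (write y.1 x.1 x.2 b)
    let c ← op (y.2 x.1 x.2)
    let d ← op (c - b)
    let z' ← op (write y.2 x.1 x.2 d)
    return (prob, z')) ((fun _ _ => 0), z)

/-- Is there a state `u` with `∑ t, z u t > 0`? -/
def hasMass (z : M.S i → ℕ → ℝ) : Timed Bool :=
  univ.toList.foldlM (fun (b : Bool) u => do
    let s ← (List.range' 1 B).foldlM (fun (s : ℝ) t => do
      let x ← op (z u t)
      op (s + x)) 0
    let b' ← op (decide (0 < s))
    op (b || b')) false

/-- The decomposition loop for arm `i`, with at most `k` rounds: while some mass is left, peel off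
one more strategy dag. -/
def decompose : ℕ → (M.S i → ℕ → ℝ) → Timed (List (StratDag (M.S i)))
  | 0, _ => return []
  | k + 1, z => do
    if (← hasMass M B i z) then
      match (← peelStrat M B i depth z) with
      | none => return []
      | some (t₀, s) =>
        match (← minRatio M B i z s.peel) with
        | none => return []
        | some ε =>
          let y ← subtractDag M B i ε z s.peel
          let rest ← decompose k y.2
          return ⟨t₀, s.next, y.1⟩ :: rest
    else return []

/-- The decomposition of arm `i`. Every round sets a positive entry of `z` to zero, so that the
number of entries is enough rounds to exhaust `z`. -/
def stratDags (z : M.S i → ℕ → ℝ) : Timed (List (StratDag (M.S i))) :=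
  decompose M B i depth (Fintype.card (M.S i) * B) z

end Decomposition

/-! ### The blown-up trees and gap filling -/

section Tree

variable {S : Type}

/-- The time at which `v` is to be played if the arm moves to `v` after a play at `(u, t)`. -/
def StratDag.step (D : StratDag S) (u : S) (t : ℕ∞) (v : S) : ℕ∞ :=
  if t = ⊤ then ⊤ else D.next u t.toNat v

/-- A vertex of the blown-up tree is a path in the dag, written from its last node back to the
root; its parent is its tail. -/
abbrev TreeNode (S : Type) := List (S × ℕ∞)

/-- The root of the blown-up tree. -/
def StratDag.treeRoot (D : StratDag S) (root : S) : TreeNode S := [(root, D.rootTime)]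

/-- The child of a tree-node in the state `v`. -/
def StratDag.child (D : StratDag S) (P : TreeNode S) (v : S) : TreeNode S :=
  match P with
  | [] => []
  | (u, t) :: P => (v, D.step u t v) :: (u, t) :: P

/-- The tree-nodes of the blown-up tree. -/
inductive IsTreeNode (p : S → S → ℝ) (root : S) (D : StratDag S) : TreeNode S → Prop
  | root : IsTreeNode p root D (D.treeRoot root)
  | child (u : S) (t : ℕ∞) (P : TreeNode S) (v : S) : IsTreeNode p root D ((u, t) :: P) →
      t ≠ ⊤ → 0 < p u v → IsTreeNode p root D ((v, D.step u t v) :: (u, t) :: P)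

/-- The time of a tree-node before gap filling. -/
def treeTime : TreeNode S → ℕ∞
  | [] => ⊤
  | (_, t) :: _ => t

/-- The depth of a tree-node is the depth of its final state. -/
def treeDepth (depth : S → ℕ) : TreeNode S → ℕ
  | [] => 0
  | (u, _) :: _ => depth u

open Classical in
/-- The ancestor of least depth from which the plays down to the given tree-node are contiguous,
for an assignment `time` of times to the tree-nodes. -/
def treeHead (time : TreeNode S → ℕ∞) : TreeNode S → TreeNode S
  | [] => []
  | [x] => [x]
  | x :: y :: P =>
    if time (x :: y :: P) = time (y :: P) + 1 then treeHead time (y :: P) else x :: y :: P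

open Classical in
/-- Advance the component with head `v`, so that it becomes contiguous with the parent of `v`. -/
def advance (time : TreeNode S → ℕ∞) (v : TreeNode S) : TreeNode S → ℕ∞ := fun P =>
  if treeHead time P = v then (time v.tail + 1) + (time P - time v) else time P

/-- Some tree-node has the head `v`, and `τ = time v < 2 * depth v`. -/
def SmallGap (depth : S → ℕ) (N : TreeNode S → Prop) (τ : ℕ) (time : TreeNode S → ℕ∞)
    (v : TreeNode S) : Prop :=
  (∃ P, N P ∧ treeHead time P = v) ∧ time v = τ ∧ τ < 2 * treeDepth depth v

/-- The round `τ` of gap filling on the tree with root `ρ` and set of tree-nodes `N`: advance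
components, in any order, as long as there is one to be advanced. -/
inductive GapRound (depth : S → ℕ) (N : TreeNode S → Prop) (ρ : TreeNode S) (τ : ℕ) :
    (TreeNode S → ℕ∞) → (TreeNode S → ℕ∞) → Prop
  | done (time) : (∀ v, ¬ SmallGap depth N τ time v) → GapRound depth N ρ τ time time
  | step (time time' v) : SmallGap depth N τ time v → v ≠ ρ →
      GapRound depth N ρ τ (advance time v) time' → GapRound depth N ρ τ time time'

/-- The rounds `τ, τ - 1, …, 1` turn the times `time` into `time'`. -/
def GapRounds (depth : S → ℕ) (N : TreeNode S → Prop) (ρ : TreeNode S) :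
    ℕ → (TreeNode S → ℕ∞) → (TreeNode S → ℕ∞) → Prop
  | 0, time, time' => time' = time
  | τ + 1, time, time' =>
    ∃ mid, GapRound depth N ρ (τ + 1) time mid ∧ GapRounds depth N ρ τ mid time'

/-- Gap filling on the blown-up tree of `D` returns the times `time'`. -/
def MAB.GapFill (M : MAB) (B : ℕ) (i : Fin M.n) (depth : M.S i → ℕ) (D : StratDag (M.S i))
    (time' : TreeNode (M.S i) → ℕ∞) : Prop :=
  GapRounds depth (IsTreeNode (M.p i) (M.root i) D) (D.treeRoot (M.root i)) B treeTime time'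

end Tree

/-! ### Phase III: scheduling the components -/

/-- The parameters of the scheduling loop: the nodes that an arm can be at, the time of a node,
the condition of the inner loop for the current node and the counter `τ`, and the node
reached from a given one when the arm makes a transition to a given state. -/
structure Scheduler (M : MAB) where
  Node : Fin M.n → Type
  time : ∀ i, Node i → ℕ∞
  cont : ∀ i, Node i → ℕ∞ → Bool
  child : ∀ i, Node i → M.S i → Node i

namespace Scheduler

variable {M : MAB} (Q : Scheduler M)

/-- `curr i` is the current node of arm `i`, or `none` if the arm is not active; `focus` holds the
arm that is being played in the inner loop, with the counter `τ`. -/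
structure Config where
  curr : ∀ i, Option (Q.Node i)
  focus : Option (Fin M.n × ℕ∞)

/-- The active arm whose current node has the earliest time, with this time; ties go to the
smallest index. -/
def argmin (c : Q.Config) : Timed (Option (Fin M.n × ℕ∞)) :=
  (List.finRange M.n).foldlM (fun best i => do
    match (← op (c.curr i)) with
    | none => return best
    | some P =>
      let t ← op (Q.time i P)
      match best with
      | none => return some (i, t)
      | some b => if (← op (decide (t < b.2))) then return some (i, t) else return best) none

/-- The outer loop up to the next play: choose the earliest arm, and drop it if its time is `⊤`.
As arms only get dropped here, `M.n + 1` rounds suffice. -/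
def outer : ℕ → Q.Config → Timed Q.Config
  | 0, c => return { c with focus := none }
  | k + 1, c => do
    match (← Q.argmin c) with
    | none => return { c with focus := none }
    | some (i, t) =>
      if (← op (decide (t = ⊤))) then
        let curr ← op (Function.update c.curr i none)
        outer k { c with curr := curr }
      else
        let focus ← op (some (i, t))
        return { c with focus := focus }

/-- Proceed to the next play: stay in the inner loop if its condition holds; otherwise drop the arm
if its time is `⊤` (or if it is exhausted), and return to the outer loop. -/
def settle (c : Q.Config) : Timed Q.Config := do
  match (← op c.focus) with
  | none => Q.outer (M.n + 1) c
  | some (i, τ) =>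
    match (← op (c.curr i)) with
    | none => Q.outer (M.n + 1) c
    | some P =>
      tick 4
      if Q.cont i P τ then return c
      else
        let t ← op (Q.time i P)
        if (← op (decide (t = ⊤))) then
          let curr ← op (Function.update c.curr i none)
          Q.outer (M.n + 1) { c with curr := curr }
        else Q.outer (M.n + 1) c

/-- The strategy that plays according to the scheduling loop. -/
def agent : Agent M where
  State := Q.Config
  choose c := c.focus.map Prod.fst
  update c i o := do
    let P ← op (c.curr i)
    let P' ← op (match P, o with
      | some P, some v => some (Q.child i P v)
      | _, _ => none)
    let curr ← op (Function.update c.curr i P')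
    let focus ← op (c.focus.map fun f => (f.1, f.2 + 1))
    Q.settle ⟨curr, focus⟩

end Scheduler

section Algorithms

variable (M : MAB) (depth : ∀ i, M.S i → ℕ) (Ds : ∀ i, List (StratDag (M.S i)))

/-- The choice of at most one strategy dag for every arm. -/
abbrev Choice : Type := ∀ i, Option (Fin (Ds i).length)

/-- Arm `i` chooses its `j`-th dag with probability `prob (root) / 24`. -/
def pick (i : Fin M.n) : Option (Fin (Ds i).length) → ℝ
  | some j => ((Ds i).get j).prob (M.root i) ((Ds i).get j).rootTime / 24
  | none => 1 - ∑ j, ((Ds i).get j).prob (M.root i) ((Ds i).get j).rootTime / 24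

/-- The algorithm on the blown-up trees with times `time'`: the components are played
contiguously. -/
def algDAG (time' : ∀ i, Fin (Ds i).length → TreeNode (M.S i) → ℕ∞) : Scheduler M where
  Node i := Fin (Ds i).length × TreeNode (M.S i)
  time i P := time' i P.1 P.2
  cont i P τ := decide (time' i P.1 P.2 ≠ ⊤ ∧ time' i P.1 P.2 = τ)
  child i P v := (P.1, ((Ds i).get P.1).child P.2 v)

/-- The algorithm on the original blown-up trees that fills the gaps implicitly. -/
def implicitFill : Scheduler M where
  Node i := Fin (Ds i).length × TreeNode (M.S i)
  time _ P := treeTime P.2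
  cont i P τ := decide (treeTime P.2 ≠ ⊤ ∧
    (treeTime P.2 = τ ∨ ((2 * treeDepth (depth i) P.2 : ℕ) : ℕ∞) > treeTime P.2))
  child i P v := (P.1, ((Ds i).get P.1).child P.2 v)

/-- The same algorithm on the strategy dags themselves. A node is the index of a dag with a state
and a time, so that `time`, `cont` and `child` take a bounded number of table look-ups and
comparisons. -/
def implicitPlay : Scheduler M where
  Node i := Fin (Ds i).length × M.S i × ℕ∞
  time _ x := x.2.2
  cont i x τ := decide (x.2.2 ≠ ⊤ ∧
    (x.2.2 = τ ∨ ((2 * depth i x.2.1 : ℕ) : ℕ∞) > x.2.2))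
  child i x v := (x.1, v, ((Ds i).get x.1).step x.2.1 x.2.2 v)

/-- Start the scheduling loop on trees, from the roots of the chosen trees. -/
def treeStart (σ : Choice M Ds) : ∀ i, Option (Fin (Ds i).length × TreeNode (M.S i)) :=
  fun i => (σ i).map fun j => (j, ((Ds i).get j).treeRoot (M.root i))

/-- The roots of the chosen dags. -/
def dagStart (σ : Choice M Ds) : ∀ i, Option (Fin (Ds i).length × M.S i × ℕ∞) :=
  fun i => (σ i).map fun j => (j, M.root i, (((Ds i).get j).rootTime : ℕ∞))

/-- Sample a dag for every arm, which takes one scan through the list of the dags of the arm, and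
proceed to the first play, when `curr` are the roots that were chosen. -/
def launch (Q : Scheduler M) (curr : ∀ i, Option (Q.Node i)) : Timed Q.Config := do
  (List.finRange M.n).forM fun i => tick ((Ds i).length + 1)
  Q.settle ⟨curr, none⟩

/-- `E[F(plays)]` for the first `k` plays of the algorithm on the trees with the times `time'`,
when the dags `σ` were chosen. -/
def algDAGExpect (time' : ∀ i, Fin (Ds i).length → TreeNode (M.S i) → ℕ∞) (σ : Choice M Ds)
    (F : List (Σ i, M.S i) → ℝ) (k : ℕ) : ℝ :=
  (algDAG M Ds time').agent.expect F k
    (launch M Ds (algDAG M Ds time') (treeStart M Ds σ)).val M.start []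

/-- The same for implicit gap filling on the trees. -/
def implicitFillExpect (σ : Choice M Ds) (F : List (Σ i, M.S i) → ℝ) (k : ℕ) : ℝ :=
  (implicitFill M depth Ds).agent.expect F k
    (launch M Ds (implicitFill M depth Ds) (treeStart M Ds σ)).val M.start []

/-- The same for the algorithm on the dags. -/
def implicitPlayExpect (σ : Choice M Ds) (F : List (Σ i, M.S i) → ℝ) (k : ℕ) : ℝ :=
  (implicitPlay M depth Ds).agent.expect F k
    (launch M Ds (implicitPlay M depth Ds) (dagStart M Ds σ)).val M.start []

/-- The largest number of steps of the algorithm on the dags up to its `k`-th play, when the dags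
`σ` were chosen. -/
def implicitPlayCost (σ : Choice M Ds) (k : ℕ) : ℕ :=
  (launch M Ds (implicitPlay M depth Ds) (dagStart M Ds σ)).cost +
  (implicitPlay M depth Ds).agent.worstCost k
    (launch M Ds (implicitPlay M depth Ds) (dagStart M Ds σ)).val M.start

open Classical in
/-- The expected reward of the first `B` plays of the algorithm on the trees with the times
`time'`, over the random choice of the dags (independent for the arms) and the transitions. -/
def algDAGReward (time' : ∀ i, Fin (Ds i).length → TreeNode (M.S i) → ℕ∞) (B : ℕ) : ℝ :=
  ∑ σ : Choice M Ds, (∏ i, pick M Ds i (σ i)) * algDAGExpect M Ds time' σ M.reward B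

end Algorithms

end

/-! The linear program bounds every strategy because the play probabilities of a strategy are a
feasible solution: a state is played at most as often as it is entered (`Agent.sum_playProb_le`). An
instance and its layered copy can be run side by side for `B` plays
(`Agent.expect_eq_expect_layered`), so the bound for the copy carries over.

Peeling always follows the earliest positive entry of `z`. The invariant is that, for each state `v`
other than the root and each `T`, the mass of `v` up to `T` is at most the mass sent to `v` before
`T` (`FlowInv`). Subtracting a dag preserves it (`FlowInv.sub`): an arc jumping over `T` shows that
`z v` vanishes between its start and `T`, and up to the first such start the dag removes the same
amount from both sides. Each round sets an entry to zero, so the rounds exhaust `z`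
(`decompose_spec`).

Gap filling moves components earlier until each head has a time of at least twice its depth
(`Filled`); this is all that is used about its outcome. A node moved to time `t` has depth greater
than `t / 2` and original time below `2 * t`, so its path has more than `t / 2` ancestors of
original time below `2 * t`. The linear program has mass at most `2 * t` there, so mass at most `4`
is moved to `t`. With the mass already at `t`, every time carries at most `5`
(`sum_prob_mul_subtreeSum_level_le`).

For the reward, fix a tree node and let `T` be the time of the head of its component. The arm needs
at most `T / 2` plays to reach the head. While it waits, other arms are played only at times up to
`T`. If fewer than `T / 2` of these plays are at times below `T` and none is at time `T`, then the
head is played by step `T`, the rest of the component follows without interruption, and the node is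
played by its own time, which is at most `B`. Charge `2 / T` for a play below `T` and `1` for a play
at `T`: the expected charge over all trees is at most `5 + 10 = 15`, and `15 / 24` after the trees
are chosen with the reduced probabilities. A Markov bound leaves success probability `9 / 24`, so
the node earns at least `1 / 24 * (9 / 24) = 1 / 64` of its share. As the interleaving of the arms
depends on the history, the Markov bound takes the form of an induction over the plays
(`currSum_mul_le_total`): the probability of reaching the node, times one minus the charge so far
minus the expected future charge, bounds the expected earnings at the node from below.

Implicit gap filling makes the same decisions because contiguity after gap filling can be read off
the original times (`Filled.contig_iff`), and schedulers with matching decisions have the same law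
(`Scheduler.expect_eq_of_match`). The running time is bounded by a potential that falls with every
play (`Scheduler.worstCost_le`). -/

namespace Timed

/-! ### Values and costs of timed computations, and invariants of loops -/

variable {α β : Type}

@[simp] theorem val_pure (a : α) : (pure a : Timed α).val = a := rfl
@[simp] theorem cost_pure (a : α) : (pure a : Timed α).cost = 0 := rfl
theorem val_bind (x : Timed α) (f : α → Timed β) : (x >>= f).val = (f x.val).val := rfl
theorem cost_bind (x : Timed α) (f : α → Timed β) :
    (x >>= f).cost = x.cost + (f x.val).cost := rfl
@[simp] theorem val_op (a : α) : (op a).val = a := rfl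
@[simp] theorem cost_op (a : α) : (op a).cost = 1 := rfl
@[simp] theorem val_op_bind (a : α) (f : α → Timed β) : (op a >>= f).val = (f a).val := rfl
@[simp] theorem cost_op_bind (a : α) (f : α → Timed β) :
    (op a >>= f).cost = 1 + (f a).cost := rfl
@[simp] theorem cost_tick (k : ℕ) : (tick k).cost = k := rfl
@[simp] theorem val_ite (c : Prop) [Decidable c] (x y : Timed α) :
    (if c then x else y).val = if c then x.val else y.val := by split <;> rfl

theorem val_foldlM (f : β → α → Timed β) (l : List α) (b : β) :
    (l.foldlM f b).val = l.foldl (fun b a => (f b a).val) b := by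
  induction l generalizing b with
  | nil => rfl
  | cons a l ih => simp [List.foldlM_cons, val_bind, ih]

theorem cost_foldlM_le (f : β → α → Timed β) (c : ℕ) (l : List α) (b : β)
    (h : ∀ b, ∀ a ∈ l, (f b a).cost ≤ c) : (l.foldlM f b).cost ≤ l.length * c := by
  induction l generalizing b with
  | nil => simp
  | cons a l ih =>
    have h1 := h b a (by simp)
    have h2 := ih (f b a).val fun b' a' ha' => h b' a' (by simp [ha'])
    simp only [List.foldlM_cons, cost_bind, List.length_cons]
    linarith [Nat.succ_mul l.length c]

theorem cost_forM_le (f : α → Timed PUnit) (c : ℕ) (l : List α)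
    (h : ∀ a ∈ l, (f a).cost ≤ c) : (l.forM f).cost ≤ l.length * c := by
  induction l with
  | nil => simp
  | cons a l ih =>
    have h1 := h a (by simp)
    have h2 := ih fun a' ha' => h a' (by simp [ha'])
    simp only [List.length_cons]
    have : (l.forM f).cost ≤ _ := h2
    change _ + (l.forM f).cost ≤ _
    linarith [Nat.succ_mul l.length c]

end Timed

/-- A loop invariant that may mention the prefix already processed; this is how the invariants of
the peeling loops record what has been visited. -/
theorem List.prefix_induction {α β : Type*} (f : β → α → β) (P : List α → β → Prop)
    (l : List α) (b : β) (h0 : P [] b)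
    (hs : ∀ l₁ a l₂ b, l = l₁ ++ a :: l₂ → P l₁ b → P (l₁ ++ [a]) (f b a)) :
    P l (l.foldl f b) := by
  suffices h : ∀ l₂ l₁ b, l = l₁ ++ l₂ → P l₁ b → P l (l₂.foldl f b) from h l [] b rfl h0
  intro l₂
  induction l₂ with
  | nil => rintro l₁ b h hP; simpa [h] using hP
  | cons a l₂ ih =>
    rintro l₁ b h hP
    exact ih (l₁ ++ [a]) (f b a) (by simp [h]) (hs l₁ a l₂ b h hP)

theorem Finset.sum_le_mul_of_le {ι : Type*} (s : Finset ι) (f : ι → ℕ) (c : ℕ)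
    (h : ∀ i ∈ s, f i ≤ c) : ∑ i ∈ s, f i ≤ s.card * c := by
  simpa using Finset.sum_le_card_nsmul s f c h

/-! ### Expectations of strategies -/

namespace MAB

variable (M : MAB) {i : Fin M.n} (u : M.S i)

theorem outcome_nonneg (o : Option (M.S i)) : 0 ≤ M.outcome i u o := by
  cases o with
  | some v => exact M.p_nonneg i u v
  | none =>
    simp only [outcome]
    rcases M.p_sum i u with h | h
    · simp [h]
    · simp [h]

theorem sum_outcome : ∑ o, M.outcome i u o = 1 := by
  simp [Fintype.sum_option, outcome]

theorem p_le_one (v : M.S i) : M.p i u v ≤ 1 := by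
  have := M.sum_outcome u
  rw [← this]
  exact Finset.single_le_sum (f := M.outcome i u) (fun o _ => M.outcome_nonneg u o)
    (Finset.mem_univ (some v))

theorem sum_p_le_one : ∑ v, M.p i u v ≤ 1 := by
  have := M.outcome_nonneg u none
  simp only [outcome] at this
  linarith

theorem IsLayered.root_no_arc {M : MAB} {depth : ∀ i, M.S i → ℕ} (h : M.IsLayered depth)
    (i : Fin M.n) (u : M.S i) : M.p i u (M.root i) = 0 := by
  by_contra hne
  have := h.depth_succ i u _ (lt_of_le_of_ne (M.p_nonneg _ _ _) (Ne.symm hne))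
  rw [h.depth_root] at this
  omega

end MAB

namespace Agent

open Classical in
/-- The expected total weight of the next `k` plays. -/
noncomputable def total {M : MAB} (A : Agent M) (w : ∀ i, A.State → M.S i → ℝ) :
    ℕ → A.State → (∀ i, Option (M.S i)) → ℝ
  | 0, _, _ => 0
  | k + 1, c, s =>
    match A.choose c with
    | none => 0
    | some i =>
      match s i with
      | none => 0
      | some u => w i c u + ∑ o, M.outcome i u o *
          A.total w k (A.update c i o).val (Function.update s i o)

variable {M : MAB} {A : Agent M}

/-- Case analysis of the next play. -/
theorem play_cases (c : A.State) (s : ∀ i, Option (M.S i)) :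
    (A.choose c = none ∨ ∃ i, A.choose c = some i ∧ s i = none) ∨
      ∃ i u, A.choose c = some i ∧ s i = some u := by
  rcases h : A.choose c with _ | i
  · simp
  · rcases h' : s i with _ | u
    · exact Or.inl (Or.inr ⟨i, rfl, h'⟩)
    · exact Or.inr ⟨i, u, rfl, h'⟩

theorem total_stop {w : ∀ i, A.State → M.S i → ℝ} {c : A.State} {s : ∀ i, Option (M.S i)}
    (h : A.choose c = none ∨ ∃ i, A.choose c = some i ∧ s i = none) (k : ℕ) :
    A.total w k c s = 0 := by
  cases k with
  | zero => rfl
  | succ k =>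
    rcases h with h | ⟨i, h, h'⟩
    · simp [total, h]
    · simp [total, h, h']

theorem total_play {w : ∀ i, A.State → M.S i → ℝ} {c : A.State} {s : ∀ i, Option (M.S i)}
    {i : Fin M.n} {u : M.S i} (h : A.choose c = some i) (h' : s i = some u) (k : ℕ) :
    A.total w (k + 1) c s = w i c u + ∑ o, M.outcome i u o *
      A.total w k (A.update c i o).val (Function.update s i o) := by
  simp only [total, h, h']

theorem expect_stop {F : List (Σ i, M.S i) → ℝ} {c : A.State} {s : ∀ i, Option (M.S i)}
    (h : A.choose c = none ∨ ∃ i, A.choose c = some i ∧ s i = none) (k : ℕ) (l) :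
    A.expect F k c s l = F l := by
  cases k with
  | zero => rfl
  | succ k =>
    rcases h with h | ⟨i, h, h'⟩
    · simp [expect, h]
    · simp [expect, h, h']

theorem expect_play {F : List (Σ i, M.S i) → ℝ} {c : A.State} {s : ∀ i, Option (M.S i)}
    {i : Fin M.n} {u : M.S i} (h : A.choose c = some i) (h' : s i = some u) (k : ℕ) (l) :
    A.expect F (k + 1) c s l = ∑ o, M.outcome i u o *
      A.expect F k (A.update c i o).val (Function.update s i o) (⟨i, u⟩ :: l) := by
  simp only [expect, h, h']

/-- The reward is additive over plays and the outcome probabilities sum to one, so the history can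
be dropped. All reward estimates are made for `total`. -/
theorem expect_reward (k : ℕ) (c : A.State) (s : ∀ i, Option (M.S i)) (l) :
    A.expect M.reward k c s l = M.reward l + A.total (fun i _ u => M.r i u) k c s := by
  induction k generalizing c s l with
  | zero => simp [expect, total]
  | succ k ih =>
    rcases play_cases c s with h | ⟨i, u, h, h'⟩
    · rw [expect_stop h, total_stop h, add_zero]
    · rw [expect_play h h', total_play h h']
      simp only [ih, mul_add, Finset.sum_add_distrib, ← Finset.sum_mul, M.sum_outcome]
      simp [MAB.reward]
      ring

theorem total_nonneg {w : ∀ i, A.State → M.S i → ℝ} (hw : ∀ i c u, 0 ≤ w i c u) (k : ℕ)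
    (c : A.State) (s : ∀ i, Option (M.S i)) : 0 ≤ A.total w k c s := by
  induction k generalizing c s with
  | zero => simp [total]
  | succ k ih =>
    rcases play_cases c s with h | ⟨i, u, h, h'⟩
    · rw [total_stop h]
    · rw [total_play h h']
      exact add_nonneg (hw _ _ _)
        (Finset.sum_nonneg fun o _ => mul_nonneg (M.outcome_nonneg _ _) (ih _ _))

theorem total_mono {w w' : ∀ i, A.State → M.S i → ℝ} (hw : ∀ i c u, w i c u ≤ w' i c u) (k : ℕ)
    (c : A.State) (s : ∀ i, Option (M.S i)) : A.total w k c s ≤ A.total w' k c s := by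
  induction k generalizing c s with
  | zero => simp [total]
  | succ k ih =>
    rcases play_cases c s with h | ⟨i, u, h, h'⟩
    · rw [total_stop h, total_stop h]
    · rw [total_play h h', total_play h h']
      exact add_le_add (hw _ _ _) (Finset.sum_le_sum fun o _ =>
        mul_le_mul_of_nonneg_left (ih _ _) (M.outcome_nonneg _ _))

theorem total_sum {ι : Type*} (I : Finset ι) (w : ι → ∀ i, A.State → M.S i → ℝ) (k : ℕ)
    (c : A.State) (s : ∀ i, Option (M.S i)) :
    A.total (fun i c u => ∑ x ∈ I, w x i c u) k c s = ∑ x ∈ I, A.total (w x) k c s := by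
  induction k generalizing c s with
  | zero => simp [total]
  | succ k ih =>
    rcases play_cases c s with h | ⟨i, u, h, h'⟩
    · simp only [total_stop h, Finset.sum_const_zero]
    · simp only [total_play h h', ih, Finset.mul_sum, Finset.sum_add_distrib]
      rw [Finset.sum_comm]

/-- Two strategies whose decisions agree along related states have the same expectations. -/
theorem expect_eq_of_bisim {A A' : Agent M}
    (R : A.State → A'.State → (∀ i, Option (M.S i)) → Prop)
    (hchoose : ∀ c c' s, R c c' s → A.choose c = A'.choose c')
    (hupdate : ∀ c c' s i u, R c c' s → A.choose c = some i → s i = some u →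
      ∀ o, M.outcome i u o ≠ 0 →
        R (A.update c i o).val (A'.update c' i o).val (Function.update s i o))
    (F : List (Σ i, M.S i) → ℝ) (k : ℕ) (c c' s l) (h : R c c' s) :
    A.expect F k c s l = A'.expect F k c' s l := by
  induction k generalizing c c' s l with
  | zero => rfl
  | succ k ih =>
    have hc := hchoose c c' s h
    rcases play_cases c s with h' | ⟨i, u, h1, h2⟩
    · rw [expect_stop h', expect_stop (by rwa [← hc])]
    · rw [expect_play h1 h2, expect_play (hc ▸ h1) h2]
      refine Finset.sum_congr rfl fun o _ => ?_
      by_cases ho : M.outcome i u o = 0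
      · simp [ho]
      · rw [ih _ _ _ _ (hupdate c c' s i u h h1 h2 o ho)]

/-! ### The linear program bounds every strategy -/

open Classical in
/-- The probability that the state `u` of arm `i` is played after `t` further plays. -/
noncomputable def playProb {M : MAB} (A : Agent M) (i : Fin M.n) (u : M.S i) :
    ℕ → A.State → (∀ i, Option (M.S i)) → ℝ
  | 0, c, s => if A.choose c = some i ∧ s i = some u then 1 else 0
  | t + 1, c, s =>
    match A.choose c with
    | none => 0
    | some j =>
      match s j with
      | none => 0
      | some v => ∑ o, M.outcome j v o *
          A.playProb i u t (A.update c j o).val (Function.update s j o)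

theorem playProb_stop {i : Fin M.n} {u : M.S i} {c : A.State} {s : ∀ i, Option (M.S i)}
    (h : A.choose c = none ∨ ∃ i, A.choose c = some i ∧ s i = none) (t : ℕ) :
    A.playProb i u t c s = 0 := by
  rcases h with h | ⟨j, h, h'⟩
  · cases t <;> simp [playProb, h]
  · cases t with
    | succ t => simp [playProb, h, h']
    | zero =>
      simp only [playProb, h, Option.some.injEq, ite_eq_right_iff, one_ne_zero, imp_false, not_and]
      rintro rfl
      simp [h']

theorem playProb_play {j : Fin M.n} {v : M.S j} {c : A.State} {s : ∀ i, Option (M.S i)}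
    (h : A.choose c = some j) (h' : s j = some v) {i : Fin M.n} {u : M.S i} (t : ℕ) :
    A.playProb i u (t + 1) c s = ∑ o, M.outcome j v o *
      A.playProb i u t (A.update c j o).val (Function.update s j o) := by
  simp only [playProb, h, h']

theorem playProb_nonneg (i : Fin M.n) (u : M.S i) (t : ℕ) (c : A.State)
    (s : ∀ i, Option (M.S i)) : 0 ≤ A.playProb i u t c s := by
  induction t generalizing c s with
  | zero => simp only [playProb]; split <;> norm_num
  | succ t ih =>
    rcases play_cases c s with h | ⟨j, v, h, h'⟩
    · rw [playProb_stop h]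
    · rw [playProb_play h h']
      exact Finset.sum_nonneg fun o _ => mul_nonneg (M.outcome_nonneg _ _) (ih _ _)

theorem sum_playProb_zero {j : Fin M.n} {v : M.S j} {c : A.State} {s : ∀ i, Option (M.S i)}
    (h : A.choose c = some j) (h' : s j = some v) (f : ∀ i, M.S i → ℝ) :
    ∑ i, ∑ u, f i u * A.playProb i u 0 c s = f j v := by
  classical
  rw [Finset.sum_eq_single j, Finset.sum_eq_single v]
  · simp [playProb, h, h']
  · intro u _ hu
    simp [playProb, h, h', Ne.symm hu]
  · simp
  · intro i _ hi
    simp [playProb, h, Ne.symm hi]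
  · simp

theorem sum_playProb_le_one (t : ℕ) (c : A.State) (s : ∀ i, Option (M.S i)) :
    ∑ i, ∑ u, A.playProb i u t c s ≤ 1 := by
  induction t generalizing c s with
  | zero =>
    rcases play_cases c s with h | ⟨j, v, h, h'⟩
    · simp [playProb_stop h]
    · simpa using (sum_playProb_zero h h' fun _ _ => 1).le
  | succ t ih =>
    rcases play_cases c s with h | ⟨j, v, h, h'⟩
    · simp [playProb_stop h]
    · simp only [playProb_play h h']
      calc _ = ∑ o, M.outcome j v o * ∑ i, ∑ u,
            A.playProb i u t (A.update c j o).val (Function.update s j o) := by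
            simp only [Finset.mul_sum]
            rw [Finset.sum_comm]
            conv_rhs => rw [Finset.sum_comm]
            rw [Finset.sum_comm]
            refine Finset.sum_congr rfl fun i _ => ?_
            rw [Finset.sum_comm]
        _ ≤ ∑ o, M.outcome j v o * 1 := Finset.sum_le_sum fun o _ =>
            mul_le_mul_of_nonneg_left (ih _ _) (M.outcome_nonneg _ _)
        _ = 1 := by simp [M.sum_outcome]

theorem total_eq_sum_playProb (f : ∀ i, M.S i → ℝ) (k : ℕ) (c : A.State)
    (s : ∀ i, Option (M.S i)) :
    A.total (fun i _ u => f i u) k c s =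
      ∑ t ∈ range k, ∑ i, ∑ u, f i u * A.playProb i u t c s := by
  induction k generalizing c s with
  | zero => simp [total]
  | succ k ih =>
    rcases play_cases c s with h | ⟨j, v, h, h'⟩
    · simp [playProb_stop h, total_stop h]
    · rw [total_play h h', Finset.sum_range_succ', sum_playProb_zero h h', add_comm]
      congr 1
      simp only [ih, playProb_play h h', Finset.mul_sum]
      rw [Finset.sum_comm]
      refine Finset.sum_congr rfl fun t _ => ?_
      rw [Finset.sum_comm]
      refine Finset.sum_congr rfl fun i _ => ?_
      rw [Finset.sum_comm]
      refine Finset.sum_congr rfl fun u _ => Finset.sum_congr rfl fun o _ => by ring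

open Classical in
/-- A state is played at most as often as it is entered. -/
theorem sum_playProb_le (i : Fin M.n) (u : M.S i) (t : ℕ) (c : A.State)
    (s : ∀ i, Option (M.S i)) :
    ∑ t' ∈ range (t + 1), A.playProb i u t' c s ≤ (if s i = some u then 1 else 0) +
      ∑ t' ∈ range t, ∑ v, A.playProb i v t' c s * M.p i v u := by
  induction t generalizing c s with
  | zero =>
    simp only [zero_add, Finset.sum_range_one, Finset.range_zero, Finset.sum_empty, add_zero,
      playProb]
    split_ifs <;> simp_all
  | succ t ih =>
    rcases play_cases c s with h | ⟨j, v, h, h'⟩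
    · simp only [playProb_stop h, Finset.sum_const_zero, zero_mul, add_zero]
      split_ifs <;> norm_num
    · rw [Finset.sum_range_succ', Finset.sum_range_succ'
        (fun t' => ∑ v, A.playProb i v t' c s * M.p i v u) t]
      simp only [playProb_play h h']
      -- The induction hypothesis for the situation after the first play, averaged over its outcome.
      have h1 : ∑ t' ∈ range (t + 1), ∑ o, M.outcome j v o *
          A.playProb i u t' (A.update c j o).val (Function.update s j o) ≤
          ∑ o, M.outcome j v o * (if Function.update s j o i = some u then 1 else 0) +
          ∑ t' ∈ range t, ∑ x, (∑ o, M.outcome j v o *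
            A.playProb i x t' (A.update c j o).val (Function.update s j o)) * M.p i x u := by
        calc _ = ∑ o, M.outcome j v o * ∑ t' ∈ range (t + 1),
              A.playProb i u t' (A.update c j o).val (Function.update s j o) := by
              rw [Finset.sum_comm]; simp only [Finset.mul_sum]
          _ ≤ ∑ o, M.outcome j v o * ((if Function.update s j o i = some u then 1 else 0) +
              ∑ t' ∈ range t, ∑ x, A.playProb i x t' (A.update c j o).val
                (Function.update s j o) * M.p i x u) := Finset.sum_le_sum fun o _ =>
              mul_le_mul_of_nonneg_left (ih _ _) (M.outcome_nonneg _ _)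
          _ = _ := by
              simp only [mul_add, Finset.sum_add_distrib]
              congr 1
              simp only [Finset.mul_sum, Finset.sum_mul]
              rw [Finset.sum_comm]
              refine Finset.sum_congr rfl fun t _ => ?_
              rw [Finset.sum_comm]
              refine Finset.sum_congr rfl fun x _ => Finset.sum_congr rfl fun o _ => by ring
      -- The balance of the first play alone. A play of arm `i` at `v` enters `u` with probability
      -- `p v u`, and a play at `u` itself is paid for by the initial presence at `u`; a play of
      -- another arm leaves arm `i` where it is.
      have h2 : ∑ o, M.outcome j v o * (if Function.update s j o i = some u then (1 : ℝ) else 0) +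
          A.playProb i u 0 c s ≤ (if s i = some u then 1 else 0) +
          ∑ x, A.playProb i x 0 c s * M.p i x u := by
        by_cases hij : i = j
        · subst hij
          have e1 : ∑ o, M.outcome i v o *
              (if Function.update s i o i = some u then (1 : ℝ) else 0) = M.p i v u := by
            simp [Function.update_self, MAB.outcome]
          have e2 : ∑ x, A.playProb i x 0 c s * M.p i x u = M.p i v u := by
            rw [Finset.sum_eq_single v]
            · simp [playProb, h, h']
            · intro x _ hx
              simp [playProb, h, h', Ne.symm hx]
            · simp
          rw [e1, e2]
          simp only [playProb, h, true_and]
          linarith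
        · have e1 : ∀ x, A.playProb i x 0 c s = 0 := fun x => by
            simp [playProb, h, Ne.symm hij]
          simp [e1, Function.update_of_ne hij, M.sum_outcome]
      linarith

end Agent

namespace MAB

open Classical in
-- Times of the program start at `1` while `playProb` counts the preceding plays, hence the shifts
-- `t - 1` and `t - 2`. The substantial constraint is `enter`, which is `sum_playProb_le`. Layering
-- is needed at the root: as no arc returns to it, setting its later `w` to zero loses nothing.
theorem isFeasible_playProb {L : MAB} {depth : ∀ i, L.S i → ℕ} (hL : L.IsLayered depth)
    (B : ℕ) (A : Agent L) (c : A.State) :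
    L.IsFeasible B (fun i u t => A.playProb i u (t - 1) c L.start)
      (fun i u t => if u = L.root i then (if t = 1 then 1 else 0) else
        if t = 1 then 0 else ∑ v, A.playProb i v (t - 2) c L.start * L.p i v u) := by
  have hle : ∀ i (u : L.S i) t, A.playProb i u t c L.start ≤ 1 := fun i u t =>
    le_trans (le_trans (Finset.single_le_sum (f := fun u => A.playProb i u t c L.start)
      (fun u _ => Agent.playProb_nonneg i u t c _) (Finset.mem_univ u))
      (Finset.single_le_sum (f := fun i => ∑ u, A.playProb i u t c L.start)
      (fun i _ => Finset.sum_nonneg fun u _ => Agent.playProb_nonneg i u t c _)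
      (Finset.mem_univ i))) (Agent.sum_playProb_le_one t c L.start)
  have hle' : ∀ i t, ∑ u : L.S i, A.playProb i u t c L.start ≤ 1 := fun i t =>
    le_trans (Finset.single_le_sum (f := fun i => ∑ u, A.playProb i u t c L.start)
      (fun i _ => Finset.sum_nonneg fun u _ => Agent.playProb_nonneg i u t c _)
      (Finset.mem_univ i)) (Agent.sum_playProb_le_one t c L.start)
  refine ⟨fun t _ i u => ⟨Agent.playProb_nonneg _ _ _ _ _, hle _ _ _⟩, fun t _ i u => ?_,
    fun t ht i u hu => ?_, fun t ht i u => ?_, fun t _ => Agent.sum_playProb_le_one _ _ _,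
    fun i => by simp, fun t ht i => ?_, fun i u hu => by simp [hu]⟩
  · split_ifs
    · simp
    · simp
    · simp
    · refine ⟨Finset.sum_nonneg fun v _ =>
        mul_nonneg (Agent.playProb_nonneg _ _ _ _ _) (L.p_nonneg _ _ _), ?_⟩
      refine le_trans (Finset.sum_le_sum fun v _ => ?_) (hle' i (t - 2))
      exact mul_le_of_le_one_right (Agent.playProb_nonneg _ _ _ _ _) (L.p_le_one v u)
  · have ht := Finset.mem_Icc.1 ht
    simp only [hu, if_false, if_neg (show ¬ t = 1 by omega)]
    rfl
  · obtain ⟨t, rfl⟩ := Nat.exists_eq_add_of_le' (Finset.mem_Icc.1 ht).1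
    have key := Agent.sum_playProb_le i u t c L.start
    have e1 : ∑ t' ∈ Icc 1 (t + 1), A.playProb i u (t' - 1) c L.start =
        ∑ t' ∈ range (t + 1), A.playProb i u t' c L.start := by
      rw [Finset.range_eq_Ico, Finset.sum_Ico_eq_sum_range, ← Finset.Ico_succ_right_eq_Icc,
        Finset.sum_Ico_eq_sum_range]
      simp
    rw [e1]
    refine key.trans ?_
    by_cases hu : u = L.root i
    · subst hu
      simp [hL.root_no_arc, MAB.start]
    · have e2 : (L.start i = some u) = False := by
        simp [MAB.start, Ne.symm hu]
      simp only [e2, hu, if_false, zero_add]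
      rw [← Finset.Ico_succ_right_eq_Icc, Finset.sum_Ico_eq_sum_range]
      simp only [Nat.add_sub_cancel, Order.succ_eq_add_one]
      rw [Finset.sum_range_succ']
      simp only [add_zero, if_true]
      refine Finset.sum_le_sum fun x _ => ?_
      rw [if_neg (by omega), show 1 + (x + 1) - 2 = x by omega]
  · have ht := Finset.mem_Icc.1 ht
    simp [show ¬ t = 1 by omega]

/-- No strategy for a layered instance earns more than the optimum of the linear program. -/
theorem IsOptimal.expect_reward_le {L : MAB} {depth : ∀ i, L.S i → ℕ} (hL : L.IsLayered depth)
    {B : ℕ} {z w} (h : L.IsOptimal B z w) (A : Agent L) (c : A.State) :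
    A.expect L.reward B c L.start [] ≤ L.value B z := by
  refine le_trans (le_of_eq ?_) (h.2 _ _ (isFeasible_playProb hL B A c))
  rw [Agent.expect_reward, Agent.total_eq_sum_playProb, Finset.sum_comm, MAB.value]
  simp only [MAB.reward, List.map_nil, List.sum_nil, zero_add]
  refine Finset.sum_congr rfl fun i _ => ?_
  rw [Finset.sum_comm]
  refine Finset.sum_congr rfl fun u _ => ?_
  rw [← Finset.Ico_succ_right_eq_Icc, Finset.sum_Ico_eq_sum_range]
  simp

/-! ### The linear program has an optimal solution -/

/-- Feasibility says nothing about times outside `[1, B]`, so the feasible set itself is not compact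
in the space of functions on `ℕ`. Its part `K` with all values in `[0, 1]` is compact by Tychonoff's
theorem, and a maximizer on `K` is optimal among all feasible solutions. -/
theorem exists_isOptimal (L : MAB) (B : ℕ) : ∃ z w, L.IsOptimal B z w := by
  classical
  let X := ∀ i, L.S i → ℕ → ℝ
  let K : Set (X × X) := {y | (∀ i u t, y.1 i u t ∈ Set.Icc (0 : ℝ) 1) ∧
    (∀ i u t, y.2 i u t ∈ Set.Icc (0 : ℝ) 1) ∧ L.IsFeasible B y.1 y.2}
  have c1 : ∀ i (u : L.S i) t, Continuous fun y : X × X => y.1 i u t := by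
    intro i u t; fun_prop
  have c2 : ∀ i (u : L.S i) t, Continuous fun y : X × X => y.2 i u t := by
    intro i u t; fun_prop
  have hK : IsCompact K := by
    have hc : IsCompact ((Set.univ.pi fun i => Set.univ.pi fun _ : L.S i =>
        Set.univ.pi fun _ : ℕ => Set.Icc (0 : ℝ) 1) ×ˢ (Set.univ.pi fun i =>
        Set.univ.pi fun _ : L.S i => Set.univ.pi fun _ : ℕ => Set.Icc (0 : ℝ) 1) : Set (X × X)) :=
      (isCompact_univ_pi fun i => isCompact_univ_pi fun _ => isCompact_univ_pi fun _ =>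
        isCompact_Icc).prod (isCompact_univ_pi fun i => isCompact_univ_pi fun _ =>
        isCompact_univ_pi fun _ => isCompact_Icc)
    refine hc.of_isClosed_subset ?_ fun y hy => ?_
    · have : K = {y : X × X | ∀ i u t, y.1 i u t ∈ Set.Icc (0 : ℝ) 1} ∩
          {y | ∀ i u t, y.2 i u t ∈ Set.Icc (0 : ℝ) 1} ∩
          {y | ∀ t ∈ Icc 2 B, ∀ i u, u ≠ L.root i →
            y.2 i u t = ∑ v, y.1 i v (t - 1) * L.p i v u} ∩
          {y | ∀ t ∈ Icc 1 B, ∀ i u, ∑ t' ∈ Icc 1 t, y.1 i u t' ≤ ∑ t' ∈ Icc 1 t, y.2 i u t'} ∩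
          {y | ∀ t ∈ Icc 1 B, ∑ i, ∑ u, y.1 i u t ≤ 1} ∩
          {y | ∀ i, y.2 i (L.root i) 1 = 1} ∩
          {y | ∀ t ∈ Icc 2 B, ∀ i, y.2 i (L.root i) t = 0} ∩
          {y | ∀ i u, u ≠ L.root i → y.2 i u 1 = 0} := by
        ext y
        constructor
        · rintro ⟨h1, h2, h3⟩
          exact ⟨⟨⟨⟨⟨⟨⟨h1, h2⟩, h3.flow⟩, h3.enter⟩, h3.cap⟩, h3.root_first⟩, h3.root_later⟩,
            h3.other_first⟩
        · rintro ⟨⟨⟨⟨⟨⟨⟨h1, h2⟩, h3⟩, h4⟩, h5⟩, h6⟩, h7⟩, h8⟩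
          exact ⟨h1, h2, fun t _ i u => h1 i u t, fun t _ i u => h2 i u t, h3, h4, h5, h6, h7, h8⟩
      rw [this]
      simp only [Set.ofPred_forall]
      refine (((((((IsClosed.inter ?_ ?_).inter ?_).inter ?_).inter ?_).inter ?_).inter ?_).inter ?_)
      · exact isClosed_iInter fun i => isClosed_iInter fun u => isClosed_iInter fun t =>
          isClosed_Icc.preimage (c1 i u t)
      · exact isClosed_iInter fun i => isClosed_iInter fun u => isClosed_iInter fun t =>
          isClosed_Icc.preimage (c2 i u t)
      · exact isClosed_iInter fun t => isClosed_iInter fun _ => isClosed_iInter fun i =>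
          isClosed_iInter fun u => isClosed_iInter fun _ => isClosed_eq (c2 i u t)
            (continuous_finsetSum _ fun v _ => (c1 i v _).mul continuous_const)
      · exact isClosed_iInter fun t => isClosed_iInter fun _ => isClosed_iInter fun i =>
          isClosed_iInter fun u => isClosed_le (continuous_finsetSum _ fun v _ => c1 i u v)
            (continuous_finsetSum _ fun v _ => c2 i u v)
      · exact isClosed_iInter fun t => isClosed_iInter fun _ => isClosed_le
          (continuous_finsetSum _ fun i _ => continuous_finsetSum _ fun u _ => c1 i u t)
          continuous_const
      · exact isClosed_iInter fun i => isClosed_eq (c2 i _ _) continuous_const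
      · exact isClosed_iInter fun t => isClosed_iInter fun _ => isClosed_iInter fun i =>
          isClosed_eq (c2 i _ _) continuous_const
      · exact isClosed_iInter fun i => isClosed_iInter fun u => isClosed_iInter fun _ =>
          isClosed_eq (c2 i _ _) continuous_const
    · simp only [Set.mem_prod, Set.mem_univ_pi]
      exact ⟨hy.1, hy.2.1⟩
  have hne : K.Nonempty := by
    refine ⟨(fun _ _ _ => 0, fun i u t => if u = L.root i ∧ t = 1 then 1 else 0), ?_, ?_, ?_⟩
    · simp
    · intro i u t
      dsimp only
      split_ifs <;> simp
    · refine ⟨by simp, ?_, ?_, ?_, by simp, by simp, ?_, ?_⟩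
      · intro t _ i u
        dsimp only
        split_ifs <;> simp
      · intro t _ i u hu
        simp [hu]
      · intro t _ i u
        simp only [Finset.sum_const_zero]
        exact Finset.sum_nonneg fun t _ => by split_ifs <;> norm_num
      · intro t ht i
        have := (Finset.mem_Icc.1 ht).1
        simp [show t ≠ 1 by omega]
      · intro i u hu
        simp [hu]
  have hcont : Continuous fun y : X × X => L.value B y.1 := by
    unfold MAB.value
    exact continuous_finsetSum _ fun i _ => continuous_finsetSum _ fun u _ =>
      continuous_finsetSum _ fun t _ => continuous_const.mul (c1 i u t)
  obtain ⟨y, hy, hmax⟩ := hK.exists_isMaxOn hne hcont.continuousOn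
  refine ⟨y.1, y.2, hy.2.2, fun z w hzw => ?_⟩
  -- Clipping to `[0, 1]` brings any feasible solution into `K`; it changes nothing at the times in
  -- `[1, B]`, hence neither the constraints nor the value.
  let cl : ℝ → ℝ := fun x => max 0 (min 1 x)
  have cl_mem : ∀ x, cl x ∈ Set.Icc (0 : ℝ) 1 := fun x =>
    ⟨le_max_left _ _, max_le zero_le_one (min_le_left _ _)⟩
  have cl_eq : ∀ x ∈ Set.Icc (0 : ℝ) 1, cl x = x := fun x hx => by
    simp only [cl, min_eq_right hx.2, max_eq_right hx.1]
  have ez : ∀ t ∈ Icc 1 B, ∀ i u, cl (z i u t) = z i u t := fun t ht i u =>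
    cl_eq _ (hzw.z_mem t ht i u)
  have ew : ∀ t ∈ Icc 1 B, ∀ i u, cl (w i u t) = w i u t := fun t ht i u =>
    cl_eq _ (hzw.w_mem t ht i u)
  have hmem : ((fun i u t => cl (z i u t), fun i u t => cl (w i u t)) : X × X) ∈ K := by
    refine ⟨fun i u t => cl_mem _, fun i u t => cl_mem _, fun t _ i u => cl_mem _,
      fun t _ i u => cl_mem _, fun t ht i u hu => ?_, fun t ht i u => ?_, fun t ht => ?_,
      fun i => ?_, fun t ht i => ?_, fun i u hu => ?_⟩
    · have := Finset.mem_Icc.1 ht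
      dsimp only
      rw [ew t (Finset.mem_Icc.2 ⟨by omega, this.2⟩), hzw.flow t ht i u hu]
      exact Finset.sum_congr rfl fun v _ => by
        rw [ez (t - 1) (Finset.mem_Icc.2 ⟨by omega, by omega⟩)]
    · have hsub : ∀ t' ∈ Icc 1 t, t' ∈ Icc 1 B := fun t' ht' =>
        Finset.mem_Icc.2 ⟨(Finset.mem_Icc.1 ht').1,
          (Finset.mem_Icc.1 ht').2.trans (Finset.mem_Icc.1 ht).2⟩
      dsimp only
      rw [Finset.sum_congr rfl fun t' ht' => ez t' (hsub t' ht') i u,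
        Finset.sum_congr rfl fun t' ht' => ew t' (hsub t' ht') i u]
      exact hzw.enter t ht i u
    · dsimp only
      simp only [ez t ht]
      exact hzw.cap t ht
    · simp [hzw.root_first, cl]
    · have := Finset.mem_Icc.1 ht
      dsimp only
      rw [ew t (Finset.mem_Icc.2 ⟨by omega, this.2⟩), hzw.root_later t ht]
    · simp [hzw.other_first i u hu, cl]
  have := hmax hmem
  refine le_trans (le_of_eq ?_) this
  simp only [MAB.value]
  exact Finset.sum_congr rfl fun i _ => Finset.sum_congr rfl fun u _ =>
    Finset.sum_congr rfl fun t ht => by rw [ez t ht]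

end MAB

/-! ### The layered copy -/

namespace MAB

variable {M : MAB} {B : ℕ} {hB : 0 < B}

noncomputable instance (i : Fin M.n) : Fintype ((M.layered B hB).S i) := (M.layered B hB).fin i

theorem layered_p_pos {i : Fin M.n} {x y : M.LayerState B hB i}
    (h : 0 < (M.layered B hB).p i x y) : M.LayerArc B i x.1 y.1 := by
  simp only [layered] at h
  split_ifs at h with h1
  · exact ⟨h, h1⟩
  · exact absurd h (lt_irrefl _)

theorem isLayered_layered (M : MAB) (B : ℕ) (hB : 0 < B) :
    (M.layered B hB).IsLayered fun _ x => (x.1.2 : ℕ) where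
  depth_root _ := rfl
  depth_succ _ _ _ h := (layered_p_pos h).2
  reachable i x := by
    obtain ⟨x, hx⟩ := x
    have main : ∀ y, ∀ h : Relation.ReflTransGen (M.LayerArc B i) (M.root i, ⟨0, hB⟩) y,
        Relation.ReflTransGen (fun a b => 0 < (M.layered B hB).p i a b)
          ((M.layered B hB).root i) ⟨y, h⟩ := by
      intro y h
      induction h with
      | refl => exact .refl
      | tail h1 h2 ih =>
        refine ih.tail ?_
        simp only [layered]
        rw [if_pos h2.2]
        exact h2.1
    exact main x hx

theorem card_layerState_le (i : Fin M.n) :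
    Nat.card ((M.layered B hB).S i) ≤ B * Fintype.card (M.S i) := by
  refine (Finite.card_subtype_le _).trans ?_
  rw [Nat.card_prod, Nat.card_eq_fintype_card, Nat.card_eq_fintype_card, Fintype.card_fin,
    mul_comm]

theorem layered_p_eq {i : Fin M.n} {x y : M.LayerState B hB i}
    (h : (y.1.2 : ℕ) = x.1.2 + 1) : (M.layered B hB).p i x y = M.p i x.1.1 y.1.1 := by
  simp only [layered]
  rw [if_pos h]

/-- Outside the last layer, the plays of the copy have the same law as those of the original. -/
theorem sum_outcome_layered {i : Fin M.n} (x : M.LayerState B hB i) (hx : (x.1.2 : ℕ) + 1 < B)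
    (f : Option (M.S i) → ℝ) (f' : Option (M.LayerState B hB i) → ℝ)
    (hf : ∀ y, 0 < (M.layered B hB).p i x y → f (some y.1.1) = f' (some y))
    (hn : f none = f' none) :
    ∑ o, M.outcome i x.1.1 o * f o = ∑ o, (M.layered B hB).outcome i x o * f' o := by
  have key : ∀ g : M.S i → ℝ, ∀ g' : M.LayerState B hB i → ℝ,
      (∀ y, 0 < (M.layered B hB).p i x y → g y.1.1 = g' y) →
      ∑ v, M.p i x.1.1 v * g v = ∑ y, (M.layered B hB).p i x y * g' y := by
    intro g g' hg
    symm
    have hpos : ∀ y, (M.layered B hB).p i x y * g' y ≠ 0 → 0 < (M.layered B hB).p i x y :=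
      fun y hy => lt_of_le_of_ne ((M.layered B hB).p_nonneg _ _ _)
        fun h => hy (by rw [← h, zero_mul])
    refine Finset.sum_bij_ne_zero (fun y _ _ => y.1.1) (fun _ _ _ => Finset.mem_univ _)
      ?_ ?_ ?_
    · intro y _ hy y' _ hy' he
      have h1 := (layered_p_pos (hpos y hy)).2
      have h2 := (layered_p_pos (hpos y' hy')).2
      exact Subtype.ext (Prod.ext he (Fin.ext (h1.trans h2.symm)))
    · intro v _ hv
      have hp : 0 < M.p i x.1.1 v := lt_of_le_of_ne (M.p_nonneg i _ _)
        fun h => hv (by rw [← h, zero_mul])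
      let y : M.LayerState B hB i := ⟨(v, ⟨x.1.2 + 1, hx⟩), x.2.tail ⟨hp, rfl⟩⟩
      have hy : (M.layered B hB).p i x y = M.p i x.1.1 v := layered_p_eq rfl
      refine ⟨y, Finset.mem_univ _, ?_, rfl⟩
      rw [hy, ← hg y (hy ▸ hp)]
      exact hv
    · intro y _ hy
      have hp := hpos y hy
      rw [layered_p_eq (layered_p_pos hp).2, hg y hp]
  have h1 := key (fun v => f (some v)) (fun y => f' (some y)) hf
  -- For the constant function this equates the total transition probabilities, and with them the
  -- probabilities of exhaustion.
  have h2 := key (fun _ => 1) (fun _ => 1) fun _ _ => rfl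
  simp only [mul_one] at h2
  rw [Fintype.sum_option]
  refine Eq.trans ?_ (Fintype.sum_option
    fun o : Option ((M.layered B hB).S i) => (M.layered B hB).outcome i x o * f' o).symm
  simp only [outcome, hn, h2, h1]
  rfl

end MAB

namespace Agent

variable {M : MAB} {B : ℕ} {hB : 0 < B}

/-- Strategies for an instance and for its layered copy that make the same decisions have the same
law of the first `B` plays. -/
theorem expect_eq_expect_layered {A : Agent M} {A' : Agent (M.layered B hB)}
    (R : A.State → A'.State → (∀ i : Fin M.n, Option (M.LayerState B hB i)) → Prop)
    (hchoose : ∀ c c' s, R c c' s → A.choose c = A'.choose c')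
    (hsome : ∀ c c' s i (x y : M.LayerState B hB i), R c c' s → s i = some x →
      0 < (M.layered B hB).p i x y →
        R (A.update c i (some y.1.1)).val (A'.update c' i (some y)).val
          (Function.update s i (some y)))
    (hnone : ∀ c c' s i (x : M.LayerState B hB i), R c c' s → s i = some x →
        R (A.update c i none).val (A'.update c' i none).val (Function.update s i none))
    (F : List (Σ i, M.S i) → ℝ) (k : ℕ) (c c' s) (l : List (Σ i, (M.layered B hB).S i))
    (h : R c c' s) (hk : ∀ i x, s i = some x → (x.1.2 : ℕ) + k ≤ B) :
    A.expect F k c (fun i => (s i).map fun x => x.1.1) (l.map fun x => ⟨x.1, x.2.1.1⟩) =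
      A'.expect (fun h => F (h.map fun x => ⟨x.1, x.2.1.1⟩)) k c' s l := by
  induction k generalizing c c' s l with
  | zero => rfl
  | succ k ih =>
    have hc := hchoose c c' s h
    rcases play_cases c' s with h' | ⟨i, x, h1, h2⟩
    · rw [expect_stop h', expect_stop]
      rcases h' with h' | ⟨i, h1, h2⟩
      · exact Or.inl (hc.trans h')
      · exact Or.inr ⟨i, hc.trans h1, by rw [h2]; rfl⟩
    · have h2' : (fun i => (s i).map fun x => x.1.1) i = some x.1.1 := by
        dsimp only
        rw [h2]
        rfl
      rw [expect_play (hc.trans h1) h2', expect_play h1 h2]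
      -- The last play may take place in the last layer, where the copy is terminal and the outcome
      -- laws differ. Nothing depends on that outcome any more. With further plays to come, `hk`
      -- keeps `x` off the last layer.
      cases k with
      | zero =>
        simp only [expect, ← Finset.sum_mul, MAB.sum_outcome, List.map_cons, one_mul]
        exact (congrArg (· * _) (MAB.sum_outcome M (i := i) x.1.1)).trans (one_mul _)
      | succ k =>
        have hx := hk i x h2
        have hupd : ∀ o : Option (M.LayerState B hB i),
            (Function.update (fun i => (s i).map fun x => x.1.1) i (o.map fun x => x.1.1)) =
              fun j => ((Function.update s i o : ∀ i, Option (M.LayerState B hB i)) j).map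
                fun x => x.1.1 := by
          intro o
          funext j
          by_cases hj : j = i
          · subst hj; simp
          · simp [Function.update_of_ne hj]
        refine MAB.sum_outcome_layered x (by omega) _ _ (fun y hy => ?_) ?_
        · refine Eq.trans ?_ (ih _ _ (Function.update s i (some y)) (⟨i, x⟩ :: l)
            (hsome c c' s i x y h h2 hy) ?_)
          · exact congrArg (fun s => A.expect F (k + 1) _ s _) (hupd (some y))
          · intro j x' hx'
            by_cases hj : j = i
            · subst hj
              rw [Function.update_self] at hx'
              cases hx'
              have := (MAB.layered_p_pos hy).2
              omega
            · rw [Function.update_of_ne hj] at hx'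
              have := hk j x' hx'
              omega
        · refine Eq.trans ?_ (ih _ _ (Function.update s i none) (⟨i, x⟩ :: l)
            (hnone c c' s i x h h2) ?_)
          · exact congrArg (fun s => A.expect F (k + 1) _ s _) (hupd none)
          · intro j x' hx'
            by_cases hj : j = i
            · subst hj
              rw [Function.update_self] at hx'
              cases hx'
            · rw [Function.update_of_ne hj] at hx'
              have := hk j x' hx'
              omega

theorem unlayer_expect (A : Agent (M.layered B hB)) (c₀ : A.State)
    (F : List (Σ i, M.S i) → ℝ) :
    A.unlayer.expect F B (c₀, fun i => some ((M.layered B hB).root i)) M.start [] =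
      A.expect (fun h => F (h.map fun x => ⟨x.1, x.2.1.1⟩)) B c₀ (M.layered B hB).start [] := by
  refine expect_eq_expect_layered (A := A.unlayer) (A' := A) (fun c c' s => c = (c', s))
    ?_ ?_ ?_ F B _ c₀ (M.layered B hB).start [] rfl ?_
  · rintro _ c s rfl
    rfl
  · rintro _ c s i x y rfl hx hy
    have hex : ∃ y' : M.LayerState B hB i, y'.1.1 = y.1.1 ∧ (y'.1.2 : ℕ) = x.1.2 + 1 :=
      ⟨y, rfl, (MAB.layered_p_pos hy).2⟩
    -- A copy is determined by its state and its layer, so the choice made by `unlayer` is the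
    -- actual new state of the copy.
    have hch : hex.choose = y := Subtype.ext (Prod.ext hex.choose_spec.1
      (Fin.ext (hex.choose_spec.2.trans (MAB.layered_p_pos hy).2.symm)))
    simp only [unlayer, Timed.val_bind, Timed.val_op, Timed.val_pure, hx, dif_pos hex, hch]
    congr!
  · rintro _ c s i x rfl hx
    simp only [unlayer, Timed.val_bind, Timed.val_op, Timed.val_pure, hx]
    congr!
  · intro i x hx
    cases hx
    simp [MAB.layered]

/-- A strategy, used on the layered copy. -/
noncomputable def onLayered (A : Agent M) (B : ℕ) (hB : 0 < B) : Agent (M.layered B hB) where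
  State := A.State
  choose := A.choose
  update c i o := A.update c i (o.map fun x : M.LayerState B hB i => x.1.1)

/-- A strategy can be run on the copy by forgetting the layers. It earns the same there, and the
bound for layered instances applies. -/
theorem expect_reward_le_layered (A : Agent M) (c₀ : A.State) {z w}
    (h : (M.layered B hB).IsOptimal B z w) :
    A.expect M.reward B c₀ M.start [] ≤ (M.layered B hB).value B z := by
  refine le_trans (le_of_eq ?_)
    (h.expect_reward_le (M.isLayered_layered B hB) (A.onLayered B hB) c₀)
  have := expect_eq_expect_layered (A := A) (A' := A.onLayered B hB) (fun c c' _ => c = c')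
    (fun c c' s h => by rw [h]; rfl) (fun c c' s i x y h _ _ => by rw [h]; rfl)
    (fun c c' s i x h _ => by rw [h]; rfl) M.reward B c₀ c₀ (M.layered B hB).start [] rfl ?_
  · refine this.trans ?_
    congr 1
    funext h
    simp only [MAB.reward, List.map_map]
    rfl
  · intro i x hx
    cases hx
    simp [MAB.layered]

end Agent

/-! ### Peeling off one dag -/

theorem firstPos_eq_some {f : ℕ → ℝ} {k t t' : ℕ} (h : (firstPos f k t).val = some t') :
    t ≤ t' ∧ t' < t + k ∧ 0 < f t' ∧ ∀ s, t ≤ s → s < t' → ¬ 0 < f s := by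
  induction k generalizing t with
  | zero => simp [firstPos] at h
  | succ k ih =>
    simp only [firstPos, Timed.val_op_bind, Timed.val_ite, Timed.val_pure,
      decide_eq_true_eq] at h
    split_ifs at h with h0
    · cases h
      exact ⟨le_rfl, by omega, h0, fun s h1 h2 => absurd h2 (by omega)⟩
    · obtain ⟨h1, h2, h3, h4⟩ := ih h
      refine ⟨by omega, by omega, h3, fun s hs hs' => ?_⟩
      rcases Nat.eq_or_lt_of_le hs with rfl | hs
      · exact h0
      · exact h4 s hs hs'

theorem firstPos_eq_none {f : ℕ → ℝ} {k t : ℕ} (h : (firstPos f k t).val = none) :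
    ∀ s, t ≤ s → s < t + k → ¬ 0 < f s := by
  induction k generalizing t with
  | zero => intro s h1 h2; omega
  | succ k ih =>
    simp only [firstPos, Timed.val_op_bind, Timed.val_ite, Timed.val_pure,
      decide_eq_true_eq] at h
    split_ifs at h with h0
    intro s hs hs'
    rcases Nat.eq_or_lt_of_le hs with rfl | hs
    · exact h0
    · exact ih h s hs (by omega)

section Peel

variable (M : MAB) (B : ℕ) (i : Fin M.n) (depth : M.S i → ℕ) (z : M.S i → ℕ → ℝ)

open Classical in
/-- The time at which `v` is played after a play at `(u, t)`, if there is one. -/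
noncomputable def arcTime (u : M.S i) (t : ℕ) (v : M.S i) : Option ℕ :=
  if 0 < M.p i u v then (firstPos (z v) (B - t) (t + 1)).val else none

/-- The time at which `v` is played after a play at `(u, t)`. -/
noncomputable def arcTop (u : M.S i) (t : ℕ) (v : M.S i) : ℕ∞ :=
  (arcTime M B i z u t v).elim ⊤ fun t' => (t' : ℕ∞)

open Classical in
/-- What is preserved while a dag is peeled off. -/
structure PeelInv (t₀ : ℕ) (s : PeelState (M.S i)) : Prop where
  next_eq : ∀ u t v, s.next u t v = ⊤ ∨ ∃ t', arcTime M B i z u t v = some t' ∧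
    s.next u t v = t' ∧ s.marked u t = true ∧ s.marked v t' = true
  of_marked : ∀ u t, s.marked u t = true → 0 < s.peel u t ∧ 0 < z u t ∧ depth u + 1 ≤ t ∧ t ≤ B
  of_unmarked : ∀ u t, s.marked u t = false → s.peel u t = 0
  root_marked : s.marked (M.root i) t₀ = true
  peel_eq : ∀ v (t' : ℕ), s.peel v t' = (if v = M.root i ∧ t' = t₀ then 1 else 0) +
    ∑ u, ∑ t ∈ Icc 1 B, if s.next u t v = t' then s.peel u t * M.p i u v else 0

variable {M B i depth z}

open Classical in
theorem val_peelArc (u : M.S i) (t : ℕ) (s : PeelState (M.S i)) (v : M.S i) :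
    (peelArc M B i z u t s v).val = match arcTime M B i z u t v with
      | some t' => ⟨write s.marked v t' true,
          write s.peel v t' (s.peel v t' + s.peel u t * M.p i u v),
          fun u' t'' v' => if u' = u ∧ t'' = t ∧ v' = v then (t' : ℕ∞) else s.next u' t'' v'⟩
      | none => s := by
  simp only [peelArc, arcTime, Timed.val_op_bind, Timed.val_ite, Timed.val_pure,
      decide_eq_true_eq]
  split_ifs with h
  · rw [Timed.val_bind]
    generalize (firstPos (z v) (B - t) (t + 1)).val = o
    cases o <;> rfl
  · rfl

open Classical in
-- A new arc raises `peel` at its end. Flow conservation survives because, by `hchild`, the end has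
-- no outgoing arcs yet, so that nothing computed from its old value has to be corrected. This is
-- the purpose of visiting the nodes by increasing depth.
theorem PeelInv.arc {t₀ : ℕ} {s : PeelState (M.S i)} (h : PeelInv M B i depth z t₀ s)
    (hdepth : ∀ u v, 0 < M.p i u v → depth v = depth u + 1)
    {u : M.S i} {t : ℕ} {v : M.S i} (hm : s.marked u t = true) (hpend : s.next u t v = ⊤)
    (hchild : ∀ v' t' v'', depth v' = depth u + 1 → s.next v' t' v'' = ⊤) :
    PeelInv M B i depth z t₀ (peelArc M B i z u t s v).val ∧
    (∀ u' t' v', (peelArc M B i z u t s v).val.next u' t' v' =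
      if u' = u ∧ t' = t ∧ v' = v then arcTop M B i z u t v else s.next u' t' v') ∧
    ∀ u' t', depth u' ≠ depth u + 1 →
      (peelArc M B i z u t s v).val.marked u' t' = s.marked u' t' := by
  rw [val_peelArc]
  unfold arcTop
  rcases ha : arcTime M B i z u t v with _ | t'
  · refine ⟨h, fun u' t' v' => ?_, fun _ _ _ => rfl⟩
    split_ifs with hc
    · obtain ⟨rfl, rfl, rfl⟩ := hc
      exact hpend
    · rfl
  · have ha' := ha
    unfold arcTime at ha'
    split_ifs at ha' with hp
    obtain ⟨f1, f2, f3, -⟩ := firstPos_eq_some ha'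
    have hv := hdepth u v hp
    obtain ⟨hm1, hm2, hm3, hm4⟩ := h.of_marked u t hm
    have huv : u ≠ v := by rintro rfl; omega
    have hpv : 0 ≤ s.peel v t' := by
      rcases hb : s.marked v t'
      · exact (h.of_unmarked v t' hb).ge
      · exact (h.of_marked v t' hb).1.le
    refine ⟨⟨?_, ?_, ?_, ?_, ?_⟩, fun _ _ _ => rfl, ?_⟩
    · intro u' t'' v'
      dsimp only
      split_ifs with hc
      · obtain ⟨rfl, rfl, rfl⟩ := hc
        refine Or.inr ⟨t', ha, rfl, ?_, by simp [write]⟩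
        simp [write, huv, hm]
      · rcases h.next_eq u' t'' v' with h1 | ⟨t1, h1, h2, h3, h4⟩
        · exact Or.inl h1
        · refine Or.inr ⟨t1, h1, h2, ?_, ?_⟩ <;> (simp only [write]; split_ifs <;> simp [*])
    · intro u' t''
      simp only [write]
      split_ifs with hc
      · obtain ⟨rfl, rfl⟩ := hc
        exact fun _ => ⟨add_pos_of_nonneg_of_pos hpv (mul_pos hm1 hp), f3, by omega, by omega⟩
      · exact h.of_marked u' t''
    · intro u' t''
      simp only [write]
      split_ifs with hc
      · simp
      · exact h.of_unmarked u' t''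
    · simp only [write]
      split_ifs
      · rfl
      · exact h.root_marked
    · intro v' t''
      -- The inflow changes only by the new arc: the raised entry at `(v, t')` appears in no other
      -- term, as all arcs out of that node are still at `⊤`.
      have hterm : ∀ u' t1, (if (if u' = u ∧ t1 = t ∧ v' = v then (t' : ℕ∞)
            else s.next u' t1 v') = t'' then
          write s.peel v t' (s.peel v t' + s.peel u t * M.p i u v) u' t1 * M.p i u' v' else 0) =
          (if s.next u' t1 v' = t'' then s.peel u' t1 * M.p i u' v' else 0) +
          if u' = u then (if t1 = t then (if v' = v ∧ t'' = t' then
            s.peel u t * M.p i u v else 0) else 0) else 0 := by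
        intro u' t1
        by_cases hc : u' = u ∧ t1 = t ∧ v' = v
        · obtain ⟨rfl, rfl, rfl⟩ := hc
          simp only [and_self, if_true, true_and, hpend, write, huv, false_and, if_false]
          by_cases e : t'' = t'
          · simp [e]
          · have : ¬ (t' : ℕ∞) = t'' := by exact_mod_cast Ne.symm e
            simp [e, this]
        · rw [if_neg hc]
          have h0 : (if u' = u then (if t1 = t then (if v' = v ∧ t'' = t' then
              s.peel u t * M.p i u v else 0) else 0) else 0) = 0 := by
            split_ifs <;> simp_all
          rw [h0, add_zero]
          by_cases hw : u' = v ∧ t1 = t'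
          · obtain ⟨rfl, rfl⟩ := hw
            rw [hchild u' t1 v' hv]
            simp
          · simp only [write, if_neg hw]
      have htm : t ∈ Icc 1 B := Finset.mem_Icc.2 ⟨by omega, hm4⟩
      simp only [hterm, Finset.sum_add_distrib]
      rw [Finset.sum_eq_single u (f := fun u' => ∑ t1 ∈ Icc 1 B, if u' = u then _ else _)
        (fun _ _ h => by simp [h]) (by simp)]
      simp only [if_true, Finset.sum_ite_eq', htm]
      rw [← add_assoc, ← h.peel_eq v' t'']
      simp only [write]
      by_cases hc : v' = v ∧ t'' = t'
      · obtain ⟨rfl, rfl⟩ := hc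
        simp
      · simp [hc]
    · intro u' t'' hd
      simp only [write]
      rw [if_neg]
      rintro ⟨rfl, -⟩
      exact hd hv

open Classical in
theorem PeelInv.visit {t₀ : ℕ} {s : PeelState (M.S i)} (h : PeelInv M B i depth z t₀ s)
    (hdepth : ∀ u v, 0 < M.p i u v → depth v = depth u + 1)
    {u : M.S i} {t : ℕ} (hm : s.marked u t = true) (hpend : ∀ v, s.next u t v = ⊤)
    (hchild : ∀ v' t' v'', depth v' = depth u + 1 → s.next v' t' v'' = ⊤) :
    PeelInv M B i depth z t₀ (univ.toList.foldlM (peelArc M B i z u t) s).val ∧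
    (∀ u' t' v', (univ.toList.foldlM (peelArc M B i z u t) s).val.next u' t' v' =
      if u' = u ∧ t' = t then arcTop M B i z u t v' else s.next u' t' v') ∧
    ∀ u' t', depth u' ≠ depth u + 1 →
      (univ.toList.foldlM (peelArc M B i z u t) s).val.marked u' t' = s.marked u' t' := by
  rw [Timed.val_foldlM]
  have := List.prefix_induction (fun s v => (peelArc M B i z u t s v).val)
    (fun l s' => PeelInv M B i depth z t₀ s' ∧
      (∀ u' t' v', s'.next u' t' v' =
        if u' = u ∧ t' = t ∧ v' ∈ l then arcTop M B i z u t v' else s.next u' t' v') ∧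
      ∀ u' t', depth u' ≠ depth u + 1 → s'.marked u' t' = s.marked u' t')
    (univ : Finset (M.S i)).toList s ⟨h, by simp, fun _ _ _ => rfl⟩ ?_
  · obtain ⟨h1, h2, h3⟩ := this
    exact ⟨h1, fun u' t' v' => by simpa using h2 u' t' v', h3⟩
  · rintro l₁ v l₂ s' hl ⟨h1, h2, h3⟩
    have hv : v ∉ l₁ := by
      have := (univ : Finset (M.S i)).nodup_toList
      rw [hl, List.nodup_append] at this
      exact fun hv => this.2.2 v hv v (by simp) rfl
    obtain ⟨k1, k2, k3⟩ := h1.arc hdepth (u := u) (t := t) (v := v)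
      (by rw [h3 u t (by omega)]; exact hm)
      (by rw [h2]; simp [hv, hpend])
      (by
        intro v' t' v'' hd
        rw [h2, if_neg, hchild v' t' v'' hd]
        rintro ⟨rfl, -⟩
        omega)
    refine ⟨k1, fun u' t' v' => ?_, fun u' t' hd => (k3 u' t' hd).trans (h3 u' t' hd)⟩
    rw [k2, h2]
    by_cases e : v' = v
    · subst e
      simp [hv]
    · simp [e]

/-- The order in which the nodes are visited. -/
noncomputable def visitOrder (B : ℕ) (S : Type) [Fintype S] : List (ℕ × ℕ × S) :=
  (List.range B).flatMap fun d => (List.range' 1 B).flatMap fun t =>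
    univ.toList.map fun u => (d, t, u)

theorem mem_visitOrder {S : Type} [Fintype S] {B : ℕ} {x : ℕ × ℕ × S} :
    x ∈ visitOrder B S ↔ x.1 < B ∧ x.2.1 ∈ Icc 1 B := by
  obtain ⟨d, t, u⟩ := x
  simp only [visitOrder, List.mem_flatMap, List.mem_range, List.mem_range'_1, List.mem_map,
    Finset.mem_toList, Finset.mem_univ, true_and, Prod.mk.injEq, Finset.mem_Icc]
  constructor
  · rintro ⟨d', hd, t', ht, u', rfl, rfl, rfl⟩
    exact ⟨hd, by omega, by omega⟩
  · rintro ⟨hd, ht⟩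
    exact ⟨d, hd, t, by omega, u, rfl, rfl, rfl⟩

/-- The two properties of the order that the visits rely on: depths never decrease, and no node is
visited twice. -/
theorem pairwise_visitOrder (B : ℕ) (S : Type) [Fintype S] :
    (visitOrder B S).Pairwise fun x y => x.1 ≤ y.1 ∧ x ≠ y := by
  unfold visitOrder
  rw [List.pairwise_flatMap]
  refine ⟨fun d _ => ?_, ?_⟩
  · rw [List.pairwise_flatMap]
    refine ⟨fun t _ => ?_, ?_⟩
    · rw [List.pairwise_map]
      refine (univ : Finset S).nodup_toList.imp fun h => ⟨le_rfl, ?_⟩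
      simpa using h
    · refine (List.nodup_range' (s := 1) (n := B) (step := 1)).imp fun {t t'} h => ?_
      simp only [List.mem_map]
      rintro _ ⟨u, -, rfl⟩ _ ⟨u', -, rfl⟩
      exact ⟨le_rfl, by simp [h]⟩
  · refine (List.pairwise_lt_range (n := B)).imp fun {d d'} h => ?_
    simp only [List.mem_flatMap, List.mem_map]
    rintro _ ⟨t, -, u, -, rfl⟩ _ ⟨t', -, u', -, rfl⟩
    exact ⟨h.le, by simp [h.ne]⟩

open Classical in
-- Throughout the loop, exactly the arcs of the marked nodes visited so far are set. In the end this
-- covers all marked nodes, because a marked node satisfies `depth u + 1 ≤ t ≤ B` and so occurs in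
-- the visiting order; no node is marked after its turn, since a visit marks only the next depth.
theorem PeelInv.complete {t₀ : ℕ} {s : PeelState (M.S i)} (h : PeelInv M B i depth z t₀ s)
    (hdepth : ∀ u v, 0 < M.p i u v → depth v = depth u + 1)
    (hs : ∀ u t v, s.next u t v = ⊤) :
    let s' := ((List.range B).foldlM (fun s d =>
      (List.range' 1 B).foldlM (fun s t =>
        univ.toList.foldlM (peelNode M B i depth z d t) s) s) s).val
    PeelInv M B i depth z t₀ s' ∧
    ∀ u t v, s'.next u t v = if s'.marked u t = true then arcTop M B i z u t v else ⊤ := by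
  intro s'
  have e : s' = (visitOrder B (M.S i)).foldl
      (fun s x => (peelNode M B i depth z x.1 x.2.1 s x.2.2).val) s := by
    simp only [s', visitOrder, Timed.val_foldlM, List.foldl_flatMap, List.foldl_map]
  have := List.prefix_induction
    (fun s (x : ℕ × ℕ × M.S i) => (peelNode M B i depth z x.1 x.2.1 s x.2.2).val)
    (fun l s' => PeelInv M B i depth z t₀ s' ∧
      ∀ u t v, s'.next u t v = if (depth u, t, u) ∈ l ∧ s'.marked u t = true then
        arcTop M B i z u t v else ⊤)
    (visitOrder B (M.S i)) s ⟨h, by simpa using hs⟩ ?_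
  · rw [← e] at this
    refine ⟨this.1, fun u t v => ?_⟩
    rw [this.2]
    by_cases hm : s'.marked u t = true
    · obtain ⟨-, -, h1, h2⟩ := this.1.of_marked u t hm
      have : (depth u, t, u) ∈ visitOrder B (M.S i) :=
        mem_visitOrder.2 ⟨by dsimp only; omega, Finset.mem_Icc.2 ⟨by dsimp only; omega, h2⟩⟩
      simp [hm, this]
    · simp [hm]
  · rintro l₁ ⟨d, t, u⟩ l₂ s' hl ⟨h1, h2⟩
    have hpw := pairwise_visitOrder B (M.S i)
    rw [hl, List.pairwise_append] at hpw
    have hlt : ∀ x ∈ l₁, x.1 ≤ d ∧ x ≠ (d, t, u) := fun x hx =>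
      hpw.2.2 x hx (d, t, u) (by simp)
    simp only [peelNode, Timed.val_op_bind, Timed.val_ite, Timed.val_pure,
      decide_eq_true_eq]
    by_cases hd : depth u = d
    · rw [if_pos hd]
      by_cases hm : s'.marked u t = true
      · rw [if_pos hm]
        obtain ⟨k1, k2, k3⟩ := h1.visit hdepth hm
          (fun v => by
            rw [h2, if_neg]
            rintro ⟨h3, -⟩
            rw [hd] at h3
            exact (hlt _ h3).2 rfl)
          (by
            intro v' t' v'' hd'
            rw [h2, if_neg]
            rintro ⟨h3, -⟩
            have := (hlt _ h3).1
            dsimp only at this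
            omega)
        refine ⟨k1, fun u' t' v' => ?_⟩
        rw [k2, h2]
        by_cases hc : u' = u ∧ t' = t
        · obtain ⟨rfl, rfl⟩ := hc
          rw [if_pos ⟨rfl, rfl⟩, if_pos]
          rw [k3 u' t' (by omega)]
          exact ⟨by simp [hd], hm⟩
        · rw [if_neg hc]
          have hiff : (depth u', t', u') ∈ l₁ ++ [(d, t, u)] ↔ (depth u', t', u') ∈ l₁ := by
            simp only [List.mem_append, List.mem_singleton, Prod.mk.injEq, or_iff_left_iff_imp]
            rintro ⟨-, h3, h4⟩
            exact absurd ⟨h4, h3⟩ hc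
          simp only [hiff]
          -- Only nodes of the next depth can have become marked, and none of these has had its
          -- turn.
          by_cases hd' : depth u' = depth u + 1
          · have : (depth u', t', u') ∉ l₁ := fun h3 => by
              have := (hlt _ h3).1
              dsimp only at this
              omega
            simp [this]
          · rw [k3 u' t' hd']
      · rw [if_neg hm]
        refine ⟨h1, fun u' t' v' => ?_⟩
        rw [h2]
        by_cases hc : u' = u ∧ t' = t
        · obtain ⟨rfl, rfl⟩ := hc
          simp [hm]
        · have : ¬ (depth u' = d ∧ t' = t ∧ u' = u) := fun h => hc ⟨h.2.2, h.2.1⟩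
          simp [this]
    · rw [if_neg hd]
      refine ⟨h1, fun u' t' v' => ?_⟩
      rw [h2]
      have : ¬ (depth u' = d ∧ t' = t ∧ u' = u) := by rintro ⟨h3, -, rfl⟩; exact hd h3
      simp [this]

theorem val_peelStrat_none (h : (peelStrat M B i depth z).val = none) :
    ∀ t ∈ Icc 1 B, ¬ 0 < z (M.root i) t := by
  simp only [peelStrat, Timed.val_bind] at h
  rcases hf : (firstPos (z (M.root i)) B 1).val with _ | t₀
  · intro t ht
    have := Finset.mem_Icc.1 ht
    exact firstPos_eq_none hf t this.1 (by omega)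
  · rw [hf] at h
    simp at h

open Classical in
theorem val_peelStrat_some (hdepth : ∀ u v, 0 < M.p i u v → depth v = depth u + 1)
    (hroot : depth (M.root i) = 0) {t₀ : ℕ} {s : PeelState (M.S i)}
    (h : (peelStrat M B i depth z).val = some (t₀, s)) :
    PeelInv M B i depth z t₀ s ∧
    (∀ u t v, s.next u t v = if s.marked u t = true then arcTop M B i z u t v else ⊤) ∧
    ∀ t ∈ Icc 1 B, t < t₀ → ¬ 0 < z (M.root i) t := by
  simp only [peelStrat, Timed.val_bind] at h
  rcases hf : (firstPos (z (M.root i)) B 1).val with _ | t₁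
  · rw [hf] at h
    simp at h
  · rw [hf] at h
    simp only [Timed.val_op_bind] at h
    simp only [Timed.val_bind, Timed.val_pure, Option.some.injEq, Prod.mk.injEq] at h
    obtain ⟨rfl, h⟩ := h
    obtain ⟨f1, f2, f3, f4⟩ := firstPos_eq_some hf
    have h0 : PeelInv M B i depth z t₁ ⟨write (fun _ _ => false) (M.root i) t₁ true,
        write (fun _ _ => (0 : ℝ)) (M.root i) t₁ 1, fun _ _ _ => ⊤⟩ := by
      refine ⟨fun _ _ _ => Or.inl rfl, ?_, ?_, by simp [write], ?_⟩
      · intro u t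
        simp only [write]
        split_ifs with hc
        · obtain ⟨rfl, rfl⟩ := hc
          exact fun _ => ⟨one_pos, f3, by omega, by omega⟩
        · simp
      · intro u t
        simp only [write]
        split_ifs <;> simp
      · intro v t'
        have : ∀ n : ℕ, (⊤ : ℕ∞) ≠ n := fun n => (ENat.natCast_ne_top n).symm
        simp [write, this]
    have := h0.complete hdepth fun _ _ _ => rfl
    dsimp only at this
    rw [h] at this
    exact ⟨this.1, this.2, fun t ht ht' => f4 t (Finset.mem_Icc.1 ht).1 ht'⟩

end Peel

/-! ### The decomposition -/

section Decompose

variable {M : MAB} {B : ℕ} {i : Fin M.n} {depth : M.S i → ℕ} {z : M.S i → ℕ → ℝ}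

/-- The part of feasibility that is preserved when a dag is subtracted. -/
structure FlowInv (M : MAB) (B : ℕ) (i : Fin M.n) (z : M.S i → ℕ → ℝ) : Prop where
  nonneg : ∀ u, ∀ t ∈ Icc 1 B, 0 ≤ z u t
  enter : ∀ v, v ≠ M.root i → ∀ T ≤ B,
    ∑ t ∈ Icc 1 T, z v t ≤ ∑ t ∈ Icc 1 (T - 1), ∑ u, z u t * M.p i u v

/-- This eliminates `w`: away from the root, `w` vanishes at time `1`, and `w` at time `t + 1` is
what is sent at time `t`. Hence the upper limit `T - 1`. -/
theorem MAB.IsFeasible.flowInv {L : MAB} {B : ℕ} {z w} (h : L.IsFeasible B z w) (i : Fin L.n) :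
    FlowInv L B i (z i) := by
  refine ⟨fun u t ht => (h.z_mem t ht i u).1, fun v hv T hT => ?_⟩
  rcases T with _ | T
  · simp
  refine (h.enter (T + 1) (Finset.mem_Icc.2 ⟨by omega, hT⟩) i v).trans (le_of_eq ?_)
  have e1 : ∀ f : ℕ → ℝ, ∑ t ∈ Icc 1 (T + 1), f t = f 1 + ∑ t ∈ Icc 1 T, f (t + 1) := by
    intro f
    rw [← Finset.sum_Ioc_add_eq_sum_Icc (by omega), add_comm, Finset.sum_bij (fun t _ => t - 1)]
    · intro t ht; have := Finset.mem_Ioc.1 ht; exact Finset.mem_Icc.2 ⟨by omega, by omega⟩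
    · intro t ht t' ht' e
      have := Finset.mem_Ioc.1 ht
      have := Finset.mem_Ioc.1 ht'
      omega
    · intro t ht
      have := Finset.mem_Icc.1 ht
      exact ⟨t + 1, Finset.mem_Ioc.2 ⟨by omega, by omega⟩, by omega⟩
    · intro t ht
      have := Finset.mem_Ioc.1 ht
      rw [show t - 1 + 1 = t by omega]
  rw [e1, h.other_first i v hv, zero_add]
  refine Finset.sum_congr rfl fun t ht => ?_
  have := Finset.mem_Icc.1 ht
  rw [h.flow (t + 1) (Finset.mem_Icc.2 ⟨by omega, by omega⟩) i v hv]
  rfl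

/-- Mass at a state other than the root must have been sent by a predecessor at a strictly earlier
time; going back in time ends at the root. Thus peeling finds a starting point as long as any mass
is left. -/
theorem FlowInv.root_pos (h : FlowInv M B i z) {u : M.S i} {t : ℕ} (ht : t ∈ Icc 1 B)
    (hu : 0 < z u t) : ∃ t' ∈ Icc 1 B, 0 < z (M.root i) t' := by
  induction t using Nat.strong_induction_on generalizing u with
  | _ t ih =>
    by_cases hr : u = M.root i
    · exact ⟨t, ht, hr ▸ hu⟩
    have htB := Finset.mem_Icc.1 ht
    have h1 := h.enter u hr t htB.2
    have h2 : 0 < ∑ t ∈ Icc 1 t, z u t := lt_of_lt_of_le hu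
      (Finset.single_le_sum (f := fun t => z u t)
        (fun t' ht' => h.nonneg u t' (Finset.mem_Icc.2
          ⟨(Finset.mem_Icc.1 ht').1, (Finset.mem_Icc.1 ht').2.trans htB.2⟩))
        (Finset.mem_Icc.2 ⟨htB.1, le_rfl⟩))
    obtain ⟨t', ht', h3⟩ := Finset.exists_lt_of_sum_lt
      (show ∑ t ∈ Icc 1 (t - 1), (0 : ℝ) < _ by simpa using h2.trans_le h1)
    obtain ⟨v, -, h4⟩ := Finset.exists_lt_of_sum_lt
      (show ∑ v : M.S i, (0 : ℝ) < _ by simpa using h3)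
    have ht'' := Finset.mem_Icc.1 ht'
    have hp : 0 < z v t' := by
      by_contra hc
      exact absurd (mul_nonpos_of_nonpos_of_nonneg (not_lt.1 hc) (M.p_nonneg i v u)) (not_le.2 h4)
    exact ih t' (by omega) (Finset.mem_Icc.2 ⟨ht''.1, by omega⟩) hp

theorem PeelInv.peel_nonneg {t₀ : ℕ} {s : PeelState (M.S i)} (h : PeelInv M B i depth z t₀ s)
    (u : M.S i) (t : ℕ) : 0 ≤ s.peel u t := by
  rcases hb : s.marked u t
  · exact (h.of_unmarked u t hb).ge
  · exact (h.of_marked u t hb).1.le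

theorem PeelInv.marked_of_peel {t₀ : ℕ} {s : PeelState (M.S i)}
    (h : PeelInv M B i depth z t₀ s) {u : M.S i} {t : ℕ} (hp : s.peel u t ≠ 0) :
    s.marked u t = true := by
  by_contra hc
  exact hp (h.of_unmarked u t (by simpa using hc))

open Classical in
/-- Up to a time `T'` before which no arc leads past `T'`, as much peeled mass leaves the
predecessors of `v` as arrives at `v`. -/
theorem PeelInv.sum_peel {t₀ : ℕ} {s : PeelState (M.S i)} (h : PeelInv M B i depth z t₀ s)
    {v : M.S i} (hv : v ≠ M.root i) {T' : ℕ} (hT' : T' ≤ B)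
    (hlate : ∀ u, ∀ t ∈ Icc 1 (T' - 1), s.marked u t = true → 0 < M.p i u v →
      s.next u t v ≤ T') :
    ∑ t ∈ Icc 1 T', s.peel v t = ∑ t ∈ Icc 1 (T' - 1), ∑ u, s.peel u t * M.p i u v := by
  have e1 : ∀ t' ∈ Icc 1 T', s.peel v t' = ∑ u, ∑ t ∈ Icc 1 B,
      if s.next u t v = t' then s.peel u t * M.p i u v else 0 := by
    intro t' _
    rw [h.peel_eq]
    simp [hv]
  rw [Finset.sum_congr rfl e1, Finset.sum_comm]
  rw [Finset.sum_comm (s := Icc 1 (T' - 1))]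
  refine Finset.sum_congr rfl fun u _ => ?_
  rw [Finset.sum_comm]
  rw [← Finset.sum_subset (show Icc 1 (T' - 1) ⊆ Icc 1 B from
    Finset.Icc_subset_Icc le_rfl (by omega))]
  · refine Finset.sum_congr rfl fun t ht => ?_
    by_cases h0 : s.peel u t * M.p i u v = 0
    · simp [h0]
    · have hm := h.marked_of_peel (left_ne_zero_of_mul h0)
      have hp : 0 < M.p i u v := lt_of_le_of_ne (M.p_nonneg i u v)
        (Ne.symm (right_ne_zero_of_mul h0))
      have hle := hlate u t ht hm hp
      rcases h.next_eq u t v with h1 | ⟨t1, h1, h2, -, h4⟩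
      · rw [h1] at hle
        exact absurd hle (by simp)
      · rw [h2] at hle ⊢
        have h5 := h.of_marked v t1 h4
        have : t1 ∈ Icc 1 T' := Finset.mem_Icc.2 ⟨by omega, by exact_mod_cast hle⟩
        simp [this]
  -- Arcs leaving at time `T'` or later end after `T'` and contribute nothing.
  · intro t htB htT
    have h1 := Finset.mem_Icc.1 htB
    have h2 : T' ≤ t := by
      by_contra hc
      exact htT (Finset.mem_Icc.2 ⟨h1.1, by omega⟩)
    refine Finset.sum_eq_zero fun t' ht' => ?_
    rw [if_neg]
    intro hn
    rcases h.next_eq u t v with h3 | ⟨t1, h3, h4, -, -⟩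
    · rw [h3] at hn
      exact absurd hn (by simp)
    · unfold arcTime at h3
      split_ifs at h3
      have := (firstPos_eq_some h3).1
      rw [h4] at hn
      have : t1 = t' := by exact_mod_cast hn
      have := Finset.mem_Icc.1 ht'
      omega

open Classical in
-- The constraint at `T` is traced back to the one at a time `T' ≤ T` such that `z v` vanishes on
-- `(T', T]` and every arc into `v` that leaves before `T'` ends by `T'`. Up to `T'` the dag removes
-- the same amount from both sides (`PeelInv.sum_peel`).
theorem FlowInv.sub {t₀ : ℕ} {s : PeelState (M.S i)} (h : PeelInv M B i depth z t₀ s)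
    (hnext : ∀ u t v, s.next u t v = if s.marked u t = true then arcTop M B i z u t v else ⊤)
    (hz : FlowInv M B i z) {ε : ℝ} {z' : M.S i → ℕ → ℝ}
    (hz' : ∀ u, ∀ t ∈ Icc 1 B, z' u t = z u t - ε * s.peel u t)
    (hpos : ∀ u, ∀ t ∈ Icc 1 B, 0 ≤ z' u t) : FlowInv M B i z' := by
  refine ⟨hpos, fun v hv T hT => ?_⟩
  -- The times at which an arc into `v` leaves before `T` and jumps over `T`.
  let Late := (Icc 1 (T - 1)).filter fun t =>
    ∃ u, s.marked u t = true ∧ 0 < M.p i u v ∧ (T : ℕ∞) < s.next u t v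
  -- `T'` is the first late time, or `T` if there is none. An arc goes to the earliest later
  -- positive entry, so a late arc shows that `z v` has no positive entry between its start and `T`.
  -- Earlier arcs end by `T`, at positive entries, and hence by `T'`.
  have key : ∃ T' ≤ T, (∀ t, T' < t → t ≤ T → ¬ 0 < z v t) ∧
      ∀ u, ∀ t ∈ Icc 1 (T' - 1), s.marked u t = true → 0 < M.p i u v → s.next u t v ≤ T' := by
    by_cases hL : Late.Nonempty
    · have hmin := Late.min'_mem hL
      obtain ⟨h1, u₁, h2, h3, h4⟩ := Finset.mem_filter.1 hmin
      have h1' := Finset.mem_Icc.1 h1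
      have hzero : ∀ t, Late.min' hL < t → t ≤ T → ¬ 0 < z v t := by
        intro t ht htT hpos
        rw [hnext, if_pos h2, arcTop] at h4
        rcases ha : arcTime M B i z u₁ (Late.min' hL) v with _ | t1
        · unfold arcTime at ha
          rw [if_pos h3] at ha
          exact firstPos_eq_none ha t (by omega) (by omega) hpos
        · rw [ha] at h4
          have h5 : T < t1 := by simpa using h4
          unfold arcTime at ha
          rw [if_pos h3] at ha
          exact (firstPos_eq_some ha).2.2.2 t (by omega) (by omega) hpos
      refine ⟨Late.min' hL, by omega, hzero, fun u t ht hm hp => ?_⟩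
      have ht' := Finset.mem_Icc.1 ht
      have hnl : t ∉ Late := fun hc => by
        have := Late.min'_le t hc
        omega
      have hle : s.next u t v ≤ T := by
        by_contra hc
        exact hnl (Finset.mem_filter.2 ⟨Finset.mem_Icc.2 ⟨ht'.1, by omega⟩, u, hm, hp,
          not_le.1 hc⟩)
      rcases h.next_eq u t v with h5 | ⟨t1, h5, h6, -, h7⟩
      · rw [h5] at hle
        exact absurd hle (by simp)
      · rw [h6] at hle ⊢
        have hle' : t1 ≤ T := by exact_mod_cast hle
        have h8 := (h.of_marked v t1 h7).2.1
        by_contra hc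
        have hc' : Late.min' hL < t1 := by
          rw [not_le] at hc
          exact_mod_cast hc
        exact hzero t1 hc' hle' h8
    · refine ⟨T, le_rfl, fun t h1 h2 => absurd h1 (by omega), fun u t ht hm hp => ?_⟩
      by_contra hc
      exact hL ⟨t, Finset.mem_filter.2 ⟨ht, u, hm, hp, not_le.1 hc⟩⟩
  obtain ⟨T', hT', hzero, hlate⟩ := key
  have hmem : ∀ {T t}, T ≤ B → t ∈ Icc 1 T → t ∈ Icc 1 B := fun hT ht =>
    Finset.Icc_subset_Icc le_rfl hT ht
  calc ∑ t ∈ Icc 1 T, z' v t = ∑ t ∈ Icc 1 T', z' v t := by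
        symm
        refine Finset.sum_subset (Finset.Icc_subset_Icc le_rfl hT') fun t ht ht' => ?_
        have h1 := Finset.mem_Icc.1 ht
        have h2 : T' < t := by
          by_contra hc
          exact ht' (Finset.mem_Icc.2 ⟨h1.1, by omega⟩)
        have h3 := hzero t h2 h1.2
        have h4 : s.peel v t = 0 := by
          by_contra hc
          exact h3 (h.of_marked v t (h.marked_of_peel hc)).2.1
        have h5 := hz' v t (hmem hT ht)
        rw [h4, mul_zero, sub_zero] at h5
        exact le_antisymm (h5 ▸ not_lt.1 h3) (hpos v t (hmem hT ht))
    _ = ∑ t ∈ Icc 1 T', z v t - ε * ∑ t ∈ Icc 1 T', s.peel v t := by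
        rw [Finset.mul_sum, ← Finset.sum_sub_distrib]
        exact Finset.sum_congr rfl fun t ht => hz' v t (hmem (hT'.trans hT) ht)
    _ ≤ ∑ t ∈ Icc 1 (T' - 1), ∑ u, z u t * M.p i u v -
          ε * ∑ t ∈ Icc 1 (T' - 1), ∑ u, s.peel u t * M.p i u v := by
        rw [h.sum_peel hv (hT'.trans hT) hlate]
        exact sub_le_sub_right (hz.enter v hv T' (hT'.trans hT)) _
    _ = ∑ t ∈ Icc 1 (T' - 1), ∑ u, z' u t * M.p i u v := by
        rw [Finset.mul_sum, ← Finset.sum_sub_distrib]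
        refine Finset.sum_congr rfl fun t ht => ?_
        rw [Finset.mul_sum, ← Finset.sum_sub_distrib]
        refine Finset.sum_congr rfl fun u _ => ?_
        rw [hz' u t (hmem (by omega) ht)]
        ring
    -- The times from `T'` to `T - 1` only add non-negative terms.
    _ ≤ ∑ t ∈ Icc 1 (T - 1), ∑ u, z' u t * M.p i u v := by
        refine Finset.sum_le_sum_of_subset_of_nonneg (Finset.Icc_subset_Icc le_rfl (by omega))
          fun t ht _ => Finset.sum_nonneg fun u _ => mul_nonneg
            (hpos u t (hmem (by omega) ht)) (M.p_nonneg i u v)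

theorem mem_dagNodes {x : M.S i × ℕ} : x ∈ dagNodes M B i ↔ x.2 ∈ Icc 1 B := by
  obtain ⟨u, t⟩ := x
  simp only [dagNodes, List.mem_product, Finset.mem_toList, Finset.mem_univ, true_and,
    List.mem_range'_1, Finset.mem_Icc]
  omega

theorem nodup_dagNodes : (dagNodes M B i).Nodup :=
  (Finset.nodup_toList _).product List.nodup_range'

/-- The result of the search for the minimal ratio. -/
theorem val_minRatio (z peel : M.S i → ℕ → ℝ) :
    match (minRatio M B i z peel).val with
    | none => ∀ x ∈ dagNodes M B i, peel x.1 x.2 = 0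
    | some ε => (∃ x ∈ dagNodes M B i, peel x.1 x.2 ≠ 0 ∧ ε = z x.1 x.2 / peel x.1 x.2) ∧
      ∀ x ∈ dagNodes M B i, peel x.1 x.2 ≠ 0 → ε ≤ z x.1 x.2 / peel x.1 x.2 := by
  unfold minRatio
  rw [Timed.val_foldlM]
  refine List.prefix_induction _ (fun (l : List (M.S i × ℕ)) (b : Option ℝ) => match b with
    | none => ∀ x ∈ l, peel x.1 x.2 = 0
    | some ε => (∃ x ∈ l, peel x.1 x.2 ≠ 0 ∧ ε = z x.1 x.2 / peel x.1 x.2) ∧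
      ∀ x ∈ l, peel x.1 x.2 ≠ 0 → ε ≤ z x.1 x.2 / peel x.1 x.2) _ _ (by simp) ?_
  rintro l₁ x l₂ b - hb
  simp only [Timed.val_op_bind, Timed.val_ite, decide_eq_true_eq]
  by_cases hx : peel x.1 x.2 = 0
  · rw [if_neg (by simpa using hx)]
    cases b with
    | none =>
      intro y hy
      rcases List.mem_append.1 hy with h | h
      · exact hb y h
      · rw [List.mem_singleton.1 h]; exact hx
    | some m =>
      refine ⟨?_, fun y hy hne => ?_⟩
      · obtain ⟨y, hy, h⟩ := hb.1
        exact ⟨y, by simp [hy], h⟩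
      · rcases List.mem_append.1 hy with h | h
        · exact hb.2 y h hne
        · rw [List.mem_singleton.1 h] at hne; exact absurd hx hne
  · rw [if_pos hx]
    cases b with
    | none =>
      refine ⟨⟨x, by simp, hx, rfl⟩, fun y hy hne => ?_⟩
      rcases List.mem_append.1 hy with h | h
      · exact absurd (hb y h) hne
      · rw [List.mem_singleton.1 h]
    | some m =>
      simp only [Timed.val_op_bind, Timed.val_ite, decide_eq_true_eq, Timed.val_pure]
      obtain ⟨⟨y, hy, h1, h2⟩, h3⟩ := hb
      split_ifs with hlt
      · refine ⟨⟨x, by simp, hx, rfl⟩, fun y hy hne => ?_⟩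
        rcases List.mem_append.1 hy with h | h
        · exact hlt.le.trans (h3 y h hne)
        · rw [List.mem_singleton.1 h]
      · refine ⟨⟨y, by simp [hy], h1, h2⟩, fun y hy hne => ?_⟩
        rcases List.mem_append.1 hy with h | h
        · exact h3 y h hne
        · rw [List.mem_singleton.1 h]; exact not_lt.1 hlt

open Classical in
theorem val_subtractDag (ε : ℝ) (z peel : M.S i → ℕ → ℝ) (u : M.S i) (t : ℕ)
    (ht : t ∈ Icc 1 B) :
    (subtractDag M B i ε z peel).val.1 u t = ε * peel u t ∧
    (subtractDag M B i ε z peel).val.2 u t = z u t - ε * peel u t := by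
  unfold subtractDag
  rw [Timed.val_foldlM]
  have := List.prefix_induction
    (fun (y : (M.S i → ℕ → ℝ) × (M.S i → ℕ → ℝ)) (x : M.S i × ℕ) =>
      (write y.1 x.1 x.2 (ε * peel x.1 x.2),
        write y.2 x.1 x.2 (y.2 x.1 x.2 - ε * peel x.1 x.2)))
    (fun l y => ∀ u t, y.1 u t = (if (u, t) ∈ l then ε * peel u t else 0) ∧
      y.2 u t = z u t - if (u, t) ∈ l then ε * peel u t else 0)
    (dagNodes M B i) (fun _ _ => 0, z) (by simp) ?_
  · have h1 := this u t
    rw [if_pos (mem_dagNodes.2 ht)] at h1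
    exact h1
  · rintro l₁ ⟨u', t'⟩ l₂ y hl hy u t
    have hx : (u', t') ∉ l₁ := by
      have := nodup_dagNodes (M := M) (B := B) (i := i)
      rw [hl, List.nodup_append] at this
      exact fun hv => this.2.2 _ hv (u', t') (by simp) rfl
    by_cases e : u = u' ∧ t = t'
    · obtain ⟨rfl, rfl⟩ := e
      simp [write, hy u t, hx]
    · have e' : ¬ (u, t) = (u', t') := by simpa using e
      simp [write, e, hy u t]

theorem val_hasMass : (hasMass M B i z).val = true ↔ ∃ u, 0 < ∑ t ∈ Icc 1 B, z u t := by
  have hsum : ∀ u, ((List.range' 1 B).foldlM (fun (s : ℝ) t => do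
      let x ← op (z u t)
      op (s + x)) 0).val = ∑ t ∈ Icc 1 B, z u t := by
    intro u
    rw [Timed.val_foldlM]
    have : ∀ (l : List ℕ) (a : ℝ), l.foldl (fun s t => s + z u t) a = a + (l.map (z u)).sum := by
      intro l
      induction l with
      | nil => simp
      | cons b l ih => intro a; simp [ih, add_assoc]
    refine (this _ _).trans ?_
    rw [zero_add, ← List.sum_toFinset _ List.nodup_range']
    refine Finset.sum_congr ?_ fun _ _ => rfl
    ext t
    simp only [List.mem_toFinset, List.mem_range'_1, Finset.mem_Icc]
    omega
  unfold hasMass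
  rw [Timed.val_foldlM]
  have : ∀ (l : List (M.S i)) (b : Bool), (l.foldl (fun b u =>
      (((List.range' 1 B).foldlM (fun (s : ℝ) t => do
        let x ← op (z u t)
        op (s + x)) 0) >>= fun s => (op (decide (0 < s)) >>= fun b' => op (b || b')) :
          Timed Bool).val) b) = true ↔ b = true ∨ ∃ u ∈ l, 0 < ∑ t ∈ Icc 1 B, z u t := by
    intro l
    induction l with
    | nil => simp
    | cons u l ih =>
      intro b
      rw [List.foldl_cons, ih, Timed.val_bind, hsum]
      simp [or_assoc]
  refine (this _ _).trans ?_
  simp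

/-- The number of positive entries. -/
noncomputable def posCount (B : ℕ) (z : M.S i → ℕ → ℝ) : ℕ := by
  classical
  exact (((univ : Finset (M.S i)) ×ˢ Icc 1 B).filter fun x => 0 < z x.1 x.2).card

/-- A strategy dag all of whose arcs go strictly forward. -/
structure MAB.IsForwardDag (M : MAB) (B : ℕ) (i : Fin M.n) (D : StratDag (M.S i)) : Prop
    extends M.IsStratDag B i D where
  next_gt' : ∀ u v (t : ℕ), (t : ℕ∞) + 1 ≤ D.next u t v

/-- This includes arcs of probability zero, whose time keeps the default `⊤`. It matters because the
cost of a strategy is a maximum over all outcomes, impossible ones included, and because sums over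
the children run over all states. -/
theorem PeelInv.next_lt {t₀ : ℕ} {s : PeelState (M.S i)} (h : PeelInv M B i depth z t₀ s)
    (u : M.S i) (t : ℕ) (v : M.S i) : (t : ℕ∞) + 1 ≤ s.next u t v := by
  rcases h.next_eq u t v with h1 | ⟨t1, h1, h2, -, -⟩
  · simp [h1]
  · unfold arcTime at h1
    split_ifs at h1
    have := (firstPos_eq_some h1).1
    rw [h2]
    exact_mod_cast this

open Classical in
theorem PeelInv.isForwardDag {t₀ : ℕ} {s : PeelState (M.S i)}
    (h : PeelInv M B i depth z t₀ s) (hroot : ∀ u, M.p i u (M.root i) = 0) {ε : ℝ} (hε : 0 ≤ ε)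
    {prob : M.S i → ℕ → ℝ} (hprob : ∀ u, ∀ t ∈ Icc 1 B, prob u t = ε * s.peel u t) :
    M.IsForwardDag B i ⟨t₀, s.next, prob⟩ := by
  have h0 := h.of_marked _ _ h.root_marked
  refine ⟨⟨Finset.mem_Icc.2 ⟨by dsimp only; omega, h0.2.2.2⟩, fun u v _ t => h.next_lt u t v,
    fun u v t => ?_, fun u t ht => ?_, fun t ht hne => ?_, fun v hv t ht => ?_⟩,
    fun u v t => h.next_lt u t v⟩
  · rcases h.next_eq u t v with h1 | ⟨t1, h1, h2, -, h4⟩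
    · exact Or.inl h1
    · right
      dsimp only
      rw [h2]
      exact_mod_cast (h.of_marked v t1 h4).2.2.2
  · dsimp only
    rw [hprob u t ht]
    exact mul_nonneg hε (h.peel_nonneg u t)
  · dsimp only at hne ⊢
    rw [hprob _ t ht, h.peel_eq]
    simp [hroot, hne]
  · dsimp only
    rw [hprob v t ht, h.peel_eq, if_neg (fun hc => hv hc.1), zero_add, Finset.mul_sum]
    refine Finset.sum_congr rfl fun u _ => ?_
    rw [Finset.mul_sum]
    refine Finset.sum_congr rfl fun t' ht' => ?_
    rw [hprob u t' ht', mul_ite, mul_zero, mul_assoc]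

open Classical in
-- A round cannot fail while mass is left, since the root then has mass and `peel` is positive
-- there. It sets the entry of minimal ratio to zero and makes no entry positive, so the number of
-- positive entries bounds the number of rounds.
theorem decompose_spec (hdepth : ∀ u v, 0 < M.p i u v → depth v = depth u + 1)
    (hroot : depth (M.root i) = 0) (k : ℕ) (z : M.S i → ℕ → ℝ) (hz : FlowInv M B i z)
    (hk : posCount B z ≤ k) :
    (∀ D ∈ (decompose M B i depth k z).val, M.IsForwardDag B i D) ∧
    ∀ u, ∀ t ∈ Icc 1 B,
      (((decompose M B i depth k z).val).map fun D => D.prob u t).sum = z u t := by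
  have hr : ∀ u, M.p i u (M.root i) = 0 := by
    intro u
    by_contra hne
    have := hdepth u _ (lt_of_le_of_ne (M.p_nonneg _ _ _) (Ne.symm hne))
    omega
  induction k generalizing z with
  | zero =>
    simp only [decompose, Timed.val_pure]
    refine ⟨by simp, fun u t ht => ?_⟩
    have h0 : ¬ 0 < z u t := fun hpos => by
      have h1 : 0 < posCount B z := Finset.card_pos.2
        ⟨(u, t), Finset.mem_filter.2 ⟨Finset.mem_product.2 ⟨Finset.mem_univ _, ht⟩, hpos⟩⟩
      omega
    simpa using (le_antisymm (not_lt.1 h0) (hz.nonneg u t ht)).symm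
  | succ k ih =>
    simp only [decompose]
    rw [Timed.val_bind]
    by_cases hm : (hasMass M B i z).val = true
    · rw [if_pos hm, Timed.val_bind]
      obtain ⟨u₁, hu₁⟩ := val_hasMass.1 hm
      obtain ⟨t₁, ht₁, hz₁⟩ := Finset.exists_lt_of_sum_lt
        (show ∑ t ∈ Icc 1 B, (0 : ℝ) < _ by simpa using hu₁)
      -- This rules out that `peelStrat` finds no root time.
      obtain ⟨t₂, ht₂, hz₂⟩ := hz.root_pos ht₁ hz₁
      rcases hp : (peelStrat M B i depth z).val with _ | ⟨t₀, s⟩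
      · exact absurd hz₂ (val_peelStrat_none hp t₂ ht₂)
      · obtain ⟨hI, hnext, -⟩ := val_peelStrat_some hdepth hroot hp
        dsimp only
        rw [Timed.val_bind]
        have hmin := val_minRatio (M := M) (B := B) (i := i) z s.peel
        have h0 := hI.of_marked _ _ hI.root_marked
        rcases hmr : (minRatio M B i z s.peel).val with _ | ε
        · rw [hmr] at hmin
          exact absurd (hmin (M.root i, t₀) (mem_dagNodes.2 (Finset.mem_Icc.2
            ⟨by dsimp only; omega, h0.2.2.2⟩))) h0.1.ne'
        · rw [hmr] at hmin
          dsimp only at hmin ⊢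
          rw [Timed.val_bind, Timed.val_bind, Timed.val_pure]
          obtain ⟨⟨x, hx, hx1, hx2⟩, hle⟩ := hmin
          have hxm := hI.of_marked _ _ (hI.marked_of_peel hx1)
          have hε : 0 ≤ ε := by
            rw [hx2]
            exact div_nonneg hxm.2.1.le hxm.1.le
          have hsub := val_subtractDag (M := M) (B := B) (i := i) ε z s.peel
          have hz'pos : ∀ u, ∀ t ∈ Icc 1 B, 0 ≤ (subtractDag M B i ε z s.peel).val.2 u t := by
            intro u t ht
            rw [(hsub u t ht).2]
            by_cases hpe : s.peel u t = 0
            · rw [hpe, mul_zero, sub_zero]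
              exact hz.nonneg u t ht
            · have h1 := hle (u, t) (mem_dagNodes.2 ht) hpe
              have h2 : 0 < s.peel u t := lt_of_le_of_ne (hI.peel_nonneg u t) (Ne.symm hpe)
              rw [le_div_iff₀ h2] at h1
              linarith
          have hz' : FlowInv M B i (subtractDag M B i ε z s.peel).val.2 :=
            FlowInv.sub hI hnext hz (fun u t ht => (hsub u t ht).2) hz'pos
          -- The entry `x` attaining the minimal ratio was positive and becomes zero.
          have hcount : posCount B (subtractDag M B i ε z s.peel).val.2 < posCount B z := by
            refine Finset.card_lt_card (Finset.ssubset_iff_of_subset ?_ |>.2 ⟨x, ?_, ?_⟩)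
            · intro y hy
              obtain ⟨hy1, hy2⟩ := Finset.mem_filter.1 hy
              refine Finset.mem_filter.2 ⟨hy1, ?_⟩
              rw [(hsub y.1 y.2 (Finset.mem_product.1 hy1).2).2] at hy2
              have := mul_nonneg hε (hI.peel_nonneg y.1 y.2)
              linarith
            · exact Finset.mem_filter.2 ⟨Finset.mem_product.2 ⟨Finset.mem_univ _,
                mem_dagNodes.1 hx⟩, hxm.2.1⟩
            · intro hc
              have := (Finset.mem_filter.1 hc).2
              rw [(hsub x.1 x.2 (mem_dagNodes.1 hx)).2, hx2, div_mul_cancel₀ _ hx1,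
                sub_self] at this
              exact lt_irrefl _ this
          obtain ⟨ih1, ih2⟩ := ih _ hz' (by omega)
          refine ⟨fun D hD => ?_, fun u t ht => ?_⟩
          · rcases List.mem_cons.1 hD with rfl | hD
            · exact hI.isForwardDag hr hε fun u t ht => (hsub u t ht).1
            · exact ih1 D hD
          · rw [List.map_cons, List.sum_cons, ih2 u t ht, (hsub u t ht).2]
            dsimp only
            rw [(hsub u t ht).1]
            ring
    · rw [if_neg hm, Timed.val_pure]
      refine ⟨by simp, fun u t ht => ?_⟩
      have h0 : ¬ 0 < z u t := fun hpos => hm (val_hasMass.2 ⟨u, lt_of_lt_of_le hpos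
        (Finset.single_le_sum (f := fun t => z u t) (fun t' ht' => hz.nonneg u t' ht') ht)⟩)
      simpa using (le_antisymm (not_lt.1 h0) (hz.nonneg u t ht)).symm

theorem stratDags_spec {L : MAB} {depth : ∀ i, L.S i → ℕ} (hL : L.IsLayered depth) {z w}
    (h : L.IsFeasible B z w) (i : Fin L.n) :
    (∀ D ∈ (stratDags L B i (depth i) (z i)).val, L.IsForwardDag B i D) ∧
    ∀ u, ∀ t ∈ Icc 1 B,
      (((stratDags L B i (depth i) (z i)).val).map fun D => D.prob u t).sum = z i u t := by
  refine decompose_spec (hL.depth_succ i) (hL.depth_root i) _ _ (h.flowInv i) ?_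
  refine (Finset.card_filter_le _ _).trans ?_
  rw [Finset.card_product, Nat.card_Icc, Finset.card_univ]
  simp

end Decompose

/-! ### The cost of the decomposition -/

section DecomposeCost

variable {M : MAB} {B : ℕ} {i : Fin M.n} {depth : M.S i → ℕ} {N : ℕ}

theorem cost_firstPos_le (f : ℕ → ℝ) (k t : ℕ) : (firstPos f k t).cost ≤ 2 * k := by
  induction k generalizing t with
  | zero => simp [firstPos]
  | succ k ih =>
    simp only [firstPos, Timed.cost_op_bind]
    have := ih (t + 1)
    split
    · simp only [Timed.cost_pure]; omega
    · omega

theorem cost_peelArc_le (z : M.S i → ℕ → ℝ) (u : M.S i) (t : ℕ) (s : PeelState (M.S i))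
    (v : M.S i) : (peelArc M B i z u t s v).cost ≤ 2 * B + 9 := by
  simp only [peelArc, Timed.cost_op_bind]
  split
  · rw [Timed.cost_bind]
    have := cost_firstPos_le (z v) (B - t) (t + 1)
    split
    · simp only [Timed.cost_op_bind, Timed.cost_pure]; omega
    · simp only [Timed.cost_pure]; omega
  · simp only [Timed.cost_pure]; omega

/-- Here and below, `N` bounds both `B` and the number of states, and lower powers of `N` are
absorbed into the highest one: `3 + N * (11 * N)` is at most `14 * N ^ 2`. -/
theorem cost_peelNode_le (hB : B ≤ N) (hS : Fintype.card (M.S i) ≤ N) (hN : 1 ≤ N)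
    (z : M.S i → ℕ → ℝ) (d t : ℕ) (s : PeelState (M.S i)) (u : M.S i) :
    (peelNode M B i depth z d t s u).cost ≤ 14 * N ^ 2 := by
  have h1 : N ≤ N ^ 2 := Nat.le_self_pow (by norm_num) N
  simp only [peelNode, Timed.cost_op_bind]
  split
  · simp only [Timed.cost_op_bind]
    split
    · have := Timed.cost_foldlM_le (peelArc M B i z u t) (11 * N) univ.toList s
        fun s v _ => (cost_peelArc_le z u t s v).trans (by omega)
      rw [Finset.length_toList, Finset.card_univ] at this
      have h2 : Fintype.card (M.S i) * (11 * N) ≤ 11 * N ^ 2 := by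
        calc _ ≤ N * (11 * N) := Nat.mul_le_mul_right _ hS
          _ = _ := by ring
      omega
    · simp only [Timed.cost_pure]; omega
  · simp only [Timed.cost_pure]; omega

theorem cost_peelStrat_le (hB : B ≤ N) (hS : Fintype.card (M.S i) ≤ N) (hN : 1 ≤ N)
    (z : M.S i → ℕ → ℝ) : (peelStrat M B i depth z).cost ≤ 18 * N ^ 5 := by
  have h1 : N ≤ N ^ 5 := Nat.le_self_pow (by norm_num) N
  simp only [peelStrat, Timed.cost_bind]
  have h2 := cost_firstPos_le (z (M.root i)) B 1
  split
  · simp only [Timed.cost_pure]; omega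
  · simp only [Timed.cost_bind, Timed.cost_op, Timed.cost_pure]
    have h3 : ∀ d t (s : PeelState (M.S i)),
        (univ.toList.foldlM (peelNode M B i depth z d t) s).cost ≤ 14 * N ^ 3 := by
      intro d t s
      refine (Timed.cost_foldlM_le _ (14 * N ^ 2) _ s fun s u _ =>
        cost_peelNode_le hB hS hN z d t s u).trans ?_
      rw [Finset.length_toList, Finset.card_univ]
      calc _ ≤ N * (14 * N ^ 2) := Nat.mul_le_mul_right _ hS
        _ = _ := by ring
    have h4 : ∀ d (s : PeelState (M.S i)), ((List.range' 1 B).foldlM (fun s t =>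
        univ.toList.foldlM (peelNode M B i depth z d t) s) s).cost ≤ 14 * N ^ 4 := by
      intro d s
      refine (Timed.cost_foldlM_le _ (14 * N ^ 3) _ s fun s t _ => h3 d t s).trans ?_
      rw [List.length_range']
      calc _ ≤ N * (14 * N ^ 3) := Nat.mul_le_mul_right _ hB
        _ = _ := by ring
    have h5 : ∀ s : PeelState (M.S i), ((List.range B).foldlM (fun s d =>
        (List.range' 1 B).foldlM (fun s t =>
          univ.toList.foldlM (peelNode M B i depth z d t) s) s) s).cost ≤ 14 * N ^ 5 := by
      intro s
      refine (Timed.cost_foldlM_le _ (14 * N ^ 4) _ s fun s d _ => h4 d s).trans ?_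
      rw [List.length_range]
      calc _ ≤ N * (14 * N ^ 4) := Nat.mul_le_mul_right _ hB
        _ = _ := by ring
    refine le_trans (add_le_add h2 (add_le_add_right (add_le_add_right
      (add_le_add_left (h5 _) 0) 1) 1)) ?_
    omega

theorem length_dagNodes : (dagNodes M B i).length = Fintype.card (M.S i) * B := by
  simp [dagNodes, List.length_product]

theorem cost_minRatio_le (z peel : M.S i → ℕ → ℝ) :
    (minRatio M B i z peel).cost ≤ Fintype.card (M.S i) * B * 5 := by
  rw [← length_dagNodes]
  refine Timed.cost_foldlM_le _ _ _ _ fun b x _ => ?_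
  simp only [Timed.cost_op_bind]
  split
  · simp only [Timed.cost_op_bind]
    split
    · simp only [Timed.cost_pure]; omega
    · simp only [Timed.cost_op_bind]
      split <;> simp only [Timed.cost_pure] <;> omega
  · simp only [Timed.cost_pure]; omega

theorem cost_subtractDag_le (ε : ℝ) (z peel : M.S i → ℕ → ℝ) :
    (subtractDag M B i ε z peel).cost ≤ Fintype.card (M.S i) * B * 6 := by
  rw [← length_dagNodes]
  refine Timed.cost_foldlM_le _ _ _ _ fun b x _ => ?_
  simp only [Timed.cost_op_bind, Timed.cost_pure]
  omega

theorem cost_hasMass_le (z : M.S i → ℕ → ℝ) :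
    (hasMass M B i z).cost ≤ Fintype.card (M.S i) * (B * 2 + 2) := by
  rw [← Finset.card_univ, ← Finset.length_toList]
  refine Timed.cost_foldlM_le _ _ _ _ fun b u _ => ?_
  simp only [Timed.cost_bind, Timed.cost_op]
  have := Timed.cost_foldlM_le (fun (s : ℝ) t => do
      let x ← op (z u t)
      op (s + x)) 2 (List.range' 1 B) 0 fun b t _ => by simp
  rw [List.length_range'] at this
  exact Nat.add_le_add_right this 2

/-- A round costs at most `4` (test for mass) `+ 18` (peeling) `+ 5` (minimal ratio) `+ 6`
(subtraction) `= 33` times `N ^ 5`. -/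
theorem cost_decompose_le (hB : B ≤ N) (hS : Fintype.card (M.S i) ≤ N) (hN : 1 ≤ N) (k : ℕ)
    (z : M.S i → ℕ → ℝ) : (decompose M B i depth k z).cost ≤ k * (33 * N ^ 5) ∧
      ((decompose M B i depth k z).val).length ≤ k := by
  have h1 : N ^ 2 ≤ N ^ 5 := Nat.pow_le_pow_right hN (by norm_num)
  have hSB : Fintype.card (M.S i) * B ≤ N ^ 2 := by
    rw [sq]; exact Nat.mul_le_mul hS hB
  have hS2 : Fintype.card (M.S i) ≤ N ^ 2 := hS.trans (Nat.le_self_pow (by norm_num) N)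
  induction k generalizing z with
  | zero => simp [decompose]
  | succ k ih =>
    have c1 := cost_hasMass_le (B := B) z
    have c2 := cost_peelStrat_le (depth := depth) hB hS hN z
    rw [mul_add, ← mul_assoc] at c1
    simp only [decompose, Timed.cost_bind, Timed.val_bind]
    rw [Nat.succ_mul]
    split
    · rw [Timed.cost_bind, Timed.val_bind]
      split
      · simp only [Timed.cost_pure, Timed.val_pure, List.length_nil]
        omega
      · rw [Timed.cost_bind, Timed.val_bind]
        split
        · have c3 := cost_minRatio_le (B := B) z ‹PeelState (M.S i)›.peel
          simp only [Timed.cost_pure, Timed.val_pure, List.length_nil]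
          omega
        · rename_i s _ _ ε _
          have c3 := cost_minRatio_le (B := B) z s.peel
          have c4 := cost_subtractDag_le (B := B) ε z s.peel
          simp only [Timed.cost_bind, Timed.val_bind, Timed.cost_pure, Timed.val_pure,
            List.length_cons]
          obtain ⟨ih1, ih2⟩ := ih (subtractDag M B i ε z s.peel).val.2
          exact ⟨by omega, by omega⟩
    · simp only [Timed.cost_pure, Timed.val_pure, List.length_nil]
      omega

theorem cost_stratDags_le (hB : B ≤ N) (hS : Fintype.card (M.S i) ≤ N) (hN : 1 ≤ N)
    (z : M.S i → ℕ → ℝ) : (stratDags M B i depth z).cost ≤ 33 * N ^ 7 ∧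
      ((stratDags M B i depth z).val).length ≤ N ^ 2 := by
  have hSB : Fintype.card (M.S i) * B ≤ N ^ 2 := by
    rw [sq]; exact Nat.mul_le_mul hS hB
  obtain ⟨h1, h2⟩ := cost_decompose_le (depth := depth) hB hS hN (Fintype.card (M.S i) * B) z
  refine ⟨h1.trans ?_, h2.trans hSB⟩
  calc _ ≤ N ^ 2 * (33 * N ^ 5) := Nat.mul_le_mul_right _ hSB
    _ = _ := by ring

end DecomposeCost

/-! ### The cost of the scheduling loop -/

namespace Scheduler

variable {M : MAB} (Q : Scheduler M)

theorem cost_argmin_le (c : Q.Config) : (Q.argmin c).cost ≤ M.n * 3 := by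
  have := Timed.cost_foldlM_le (fun (best : Option (Fin M.n × ℕ∞)) i => do
    match (← op (c.curr i)) with
    | none => return best
    | some P =>
      let t ← op (Q.time i P)
      match best with
      | none => return some (i, t)
      | some b => if (← op (decide (t < b.2))) then return some (i, t) else return best) 3
    (List.finRange M.n) none fun b i _ => by
      rw [Timed.cost_op_bind]
      split
      · simp
      · rw [Timed.cost_op_bind]
        split
        · simp
        · rw [Timed.cost_op_bind]
          split <;> simp
  rwa [List.length_finRange] at this

theorem cost_outer_le (k : ℕ) (c : Q.Config) : (Q.outer k c).cost ≤ k * (M.n * 3 + 2) := by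
  induction k generalizing c with
  | zero => simp [outer]
  | succ k ih =>
    have h1 := Q.cost_argmin_le c
    rw [outer, Timed.cost_bind, Nat.succ_mul]
    split
    · simp only [Timed.cost_pure]; omega
    · rw [Timed.cost_op_bind]
      split
      · rw [Timed.cost_op_bind]
        have := ih { c with curr := Function.update c.curr ‹Fin M.n› none }
        omega
      · simp only [Timed.cost_op_bind, Timed.cost_pure]; omega

theorem cost_settle_le (c : Q.Config) :
    (Q.settle c).cost ≤ 9 + (M.n + 1) * (M.n * 3 + 2) := by
  have ho := Q.cost_outer_le (M.n + 1)
  rw [settle, Timed.cost_op_bind]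
  split
  · have := ho c; omega
  · rw [Timed.cost_op_bind]
    split
    · have := ho c; omega
    · rw [Timed.cost_bind, Timed.cost_tick]
      split
      · simp only [Timed.cost_pure]; omega
      · rw [Timed.cost_op_bind, Timed.cost_op_bind]
        split
        · rw [Timed.cost_op_bind]
          have := ho { c with curr := Function.update c.curr ‹Fin M.n› none }
          omega
        · have := ho c; omega

theorem cost_update_le (c : Q.Config) (i : Fin M.n) (o : Option (M.S i)) :
    (Q.agent.update c i o).cost ≤ 13 + (M.n + 1) * (M.n * 3 + 2) := by
  simp only [agent, Timed.cost_bind, Timed.cost_op]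
  refine le_trans (add_le_add_right (add_le_add_right (add_le_add_right
    (add_le_add_right (Q.cost_settle_le _) 1) 1) 1) 1) ?_
  omega

end Scheduler

/-! ### The scheduling loop -/

namespace Scheduler

variable {M : MAB} {Q : Scheduler M}

/-- The selection sees the nodes only through their times; schedulers with different kinds of nodes
but equal times select the same arm. -/
theorem val_argmin (c : Q.Config) : (Q.argmin c).val =
    (List.finRange M.n).foldl (fun (best : Option (Fin M.n × ℕ∞)) i =>
      match (c.curr i).map (Q.time i) with
      | none => best
      | some t => match best with
        | none => some (i, t)
        | some b => if t < b.2 then some (i, t) else best) none := by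
  unfold argmin
  rw [Timed.val_foldlM]
  congr 1
  funext best i
  rw [Timed.val_op_bind]
  cases c.curr i with
  | none => rfl
  | some P =>
    simp only [Option.map_some, Timed.val_op_bind]
    cases best with
    | none => rfl
    | some b => simp

theorem argmin_spec (c : Q.Config) : match (Q.argmin c).val with
    | none => ∀ i, c.curr i = none
    | some b => (∃ P, c.curr b.1 = some P ∧ Q.time b.1 P = b.2) ∧
      ∀ i P, c.curr i = some P → b.2 ≤ Q.time i P := by
  rw [val_argmin]
  have := List.prefix_induction (fun (best : Option (Fin M.n × ℕ∞)) i =>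
      match (c.curr i).map (Q.time i) with
      | none => best
      | some t => match best with
        | none => some (i, t)
        | some b => if t < b.2 then some (i, t) else best)
    (fun (l : List (Fin M.n)) (b : Option (Fin M.n × ℕ∞)) => match b with
      | none => ∀ i ∈ l, c.curr i = none
      | some b => (∃ P, c.curr b.1 = some P ∧ Q.time b.1 P = b.2) ∧
        ∀ i ∈ l, ∀ P, c.curr i = some P → b.2 ≤ Q.time i P) (List.finRange M.n) none (by simp) ?_
  · revert this
    generalize (List.finRange M.n).foldl (fun (best : Option (Fin M.n × ℕ∞)) i =>
      match (c.curr i).map (Q.time i) with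
      | none => best
      | some t => match best with
        | none => some (i, t)
        | some b => if t < b.2 then some (i, t) else best) none = b
    intro this
    cases b with
    | none => exact fun i => this i (List.mem_finRange i)
    | some b => exact ⟨this.1, fun i => this.2 i (List.mem_finRange i)⟩
  · rintro l₁ i l₂ b - hb
    rcases hc : c.curr i with _ | P
    · cases b with
      | none =>
        intro j hj
        rcases List.mem_append.1 hj with h | h
        · exact hb j h
        · rw [List.mem_singleton.1 h, hc]
      | some b =>
        refine ⟨hb.1, fun j hj P hP => ?_⟩
        rcases List.mem_append.1 hj with h | h
        · exact hb.2 j h P hP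
        · cases List.mem_singleton.1 h
          rw [hc] at hP
          cases hP
    · simp only [Option.map_some]
      cases b with
      | none =>
        refine ⟨⟨P, hc, rfl⟩, fun j hj P' hP' => ?_⟩
        rcases List.mem_append.1 hj with h | h
        · rw [hb j h] at hP'
          cases hP'
        · cases List.mem_singleton.1 h
          rw [hc] at hP'
          cases hP'
          exact le_rfl
      | some b =>
        dsimp only
        split_ifs with hlt
        · refine ⟨⟨P, hc, rfl⟩, fun j hj P' hP' => ?_⟩
          rcases List.mem_append.1 hj with h | h
          · exact hlt.le.trans (hb.2 j h P' hP')
          · cases List.mem_singleton.1 h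
            rw [hc] at hP'
            cases hP'
            exact le_rfl
        · refine ⟨hb.1, fun j hj P' hP' => ?_⟩
          rcases List.mem_append.1 hj with h | h
          · exact hb.2 j h P' hP'
          · cases List.mem_singleton.1 h
            rw [hc] at hP'
            cases hP'
            exact not_lt.1 hlt

theorem val_outer_succ (k : ℕ) (c : Q.Config) : (Q.outer (k + 1) c).val =
    match (Q.argmin c).val with
    | none => { c with focus := none }
    | some b => if b.2 = ⊤ then (Q.outer k { c with curr := Function.update c.curr b.1 none }).val
      else { c with focus := some b } := by
  rw [outer, Timed.val_bind]
  rcases (Q.argmin c).val with _ | ⟨i, t⟩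
  · rfl
  · simp only [Timed.val_op_bind, decide_eq_true_eq]
    split_ifs <;> rfl

/-- The arms that are dropped on the way to the next play have the time `⊤`. -/
def DropTop (curr curr' : ∀ i, Option (Q.Node i)) : Prop :=
  ∀ i, curr' i = curr i ∨ (curr' i = none ∧ ∃ P, curr i = some P ∧ Q.time i P = ⊤)

/-- The arm in the focus is an earliest one, and if there is none, then no arm is active. -/
def Selected (c : Q.Config) : Prop :=
  match c.focus with
  | none => ∀ i, c.curr i = none
  | some b => b.2 ≠ ⊤ ∧ (∃ P, c.curr b.1 = some P ∧ Q.time b.1 P = b.2) ∧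
    ∀ i P, c.curr i = some P → b.2 ≤ Q.time i P

theorem DropTop.update {curr curr' : ∀ i, Option (Q.Node i)} {i : Fin M.n} {P : Q.Node i}
    (hP : curr i = some P) (ht : Q.time i P = ⊤)
    (h : DropTop (Function.update curr i none) curr') : DropTop curr curr' := by
  intro j
  rcases h j with h1 | ⟨h1, P', h2, h3⟩
  · by_cases hj : j = i
    · subst hj
      rw [Function.update_self] at h1
      exact Or.inr ⟨h1, P, hP, ht⟩
    · rw [Function.update_of_ne hj] at h1
      exact Or.inl h1
  · by_cases hj : j = i
    · subst hj
      rw [Function.update_self] at h2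
      cases h2
    · rw [Function.update_of_ne hj] at h2
      exact Or.inr ⟨h1, P', h2, h3⟩

/-- Each round that does not select an arm drops an active one, so with more rounds than active arms
the default at `0` rounds is never reached. -/
theorem outer_spec (k : ℕ) (c : Q.Config)
    (hk : (univ.filter fun i => (c.curr i).isSome = true).card < k) :
    DropTop c.curr (Q.outer k c).val.curr ∧ Selected (Q.outer k c).val := by
  induction k generalizing c with
  | zero => omega
  | succ k ih =>
    rw [val_outer_succ]
    have hs := argmin_spec c
    rcases ha : (Q.argmin c).val with _ | ⟨i, t⟩ <;> rw [ha] at hs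
    · exact ⟨fun _ => Or.inl rfl, hs⟩
    · dsimp only at hs ⊢
      obtain ⟨⟨P, hP, ht⟩, hmin⟩ := hs
      split_ifs with h
      · have hlt : (univ.filter fun j =>
            ((Function.update c.curr i none : ∀ i, Option (Q.Node i)) j).isSome = true).card <
            (univ.filter fun i => (c.curr i).isSome = true).card := by
          refine Finset.card_lt_card (Finset.ssubset_iff_of_subset ?_ |>.2 ⟨i, ?_, ?_⟩)
          · intro j hj
            have := (Finset.mem_filter.1 hj).2
            by_cases hji : j = i
            · subst hji
              simp at this
            · rw [Function.update_of_ne hji] at this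
              simpa using this
          · simp [hP]
          · simp
        obtain ⟨h1, h2⟩ := ih { c with curr := Function.update c.curr i none }
          (by dsimp only; omega)
        exact ⟨DropTop.update hP (ht.trans h) h1, h2⟩
      · exact ⟨fun _ => Or.inl rfl, h, ⟨P, hP, ht⟩, hmin⟩

theorem outer_spec' (c : Q.Config) :
    DropTop c.curr (Q.outer (M.n + 1) c).val.curr ∧ Selected (Q.outer (M.n + 1) c).val :=
  outer_spec _ c (Nat.lt_succ_of_le ((Finset.card_filter_le _ _).trans (by simp)))

theorem val_settle (c : Q.Config) : (Q.settle c).val = match c.focus with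
    | none => (Q.outer (M.n + 1) c).val
    | some b => match c.curr b.1 with
      | none => (Q.outer (M.n + 1) c).val
      | some P => if Q.cont b.1 P b.2 = true then c
        else if Q.time b.1 P = ⊤ then
          (Q.outer (M.n + 1) { c with curr := Function.update c.curr b.1 none }).val
        else (Q.outer (M.n + 1) c).val := by
  rw [settle, Timed.val_op_bind]
  rcases c.focus with _ | ⟨i, τ⟩
  · rfl
  · simp only [Timed.val_op_bind]
    rcases c.curr i with _ | P
    · rfl
    · simp only [Timed.val_bind]
      split_ifs with h1 h2
      · rfl
      · rw [Timed.val_op_bind, Timed.val_op_bind]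
        simp only [h2, decide_true, if_true]
        rfl
      · rw [Timed.val_op_bind, Timed.val_op_bind]
        simp [h2]

/-- Either the inner loop goes on, or the outer loop has selected an arm. -/
theorem settle_spec (c : Q.Config) :
    (∃ b P, c.focus = some b ∧ c.curr b.1 = some P ∧ Q.cont b.1 P b.2 = true ∧
      (Q.settle c).val = c) ∨
    ((∀ b P, c.focus = some b → c.curr b.1 = some P → Q.cont b.1 P b.2 = false) ∧
      DropTop c.curr (Q.settle c).val.curr ∧ Selected (Q.settle c).val) := by
  rw [val_settle]
  rcases hf : c.focus with _ | b
  · exact Or.inr ⟨by simp, outer_spec' c⟩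
  · dsimp only
    rcases hc : c.curr b.1 with _ | P
    · exact Or.inr ⟨(by rintro b' P h hP; cases h; rw [hc] at hP; cases hP), outer_spec' c⟩
    · dsimp only
      split_ifs with h1 h2
      · exact Or.inl ⟨b, P, rfl, hc, h1, rfl⟩
      · right
        refine ⟨(by rintro b' P' h hP; cases h; rw [hc] at hP; cases hP; simpa using h1), ?_⟩
        obtain ⟨h3, h4⟩ := outer_spec' (Q := Q) ⟨Function.update c.curr b.1 none, some b⟩
        exact ⟨DropTop.update hc h2 h3, h4⟩
      · exact Or.inr ⟨(by rintro b' P' h hP; cases h; rw [hc] at hP; cases hP; simpa using h1),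
          outer_spec' c⟩

/-- The node that an arm reaches from the current one by the outcome `o`. -/
def move (Q : Scheduler M) (i : Fin M.n) (P : Q.Node i) : Option (M.S i) → Option (Q.Node i)
  | some v => some (Q.child i P v)
  | none => none

theorem val_update {c : Q.Config} {i : Fin M.n} {τ : ℕ∞} {P : Q.Node i}
    (hf : c.focus = some (i, τ)) (hP : c.curr i = some P) (o : Option (M.S i)) :
    (Q.agent.update c i o).val =
      (Q.settle ⟨Function.update c.curr i (Q.move i P o), some (i, τ + 1)⟩).val := by
  simp only [agent, Timed.val_op_bind, hP, hf]
  cases o <;> rfl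

theorem choose_eq {c : Q.Config} {i : Fin M.n} (h : Q.agent.choose c = some i) :
    ∃ τ, c.focus = some (i, τ) := by
  simp only [agent, Option.map_eq_some_iff] at h
  obtain ⟨⟨j, τ⟩, h1, rfl⟩ := h
  exact ⟨τ, h1⟩

/-! ### Equivalent schedulers -/

/-- A configuration matches another one, for a relation `Ru` on the waiting nodes and a relation
`Rf` on the nodes in the focus. -/
def Match {Q₁ Q₂ : Scheduler M} (Ru : ∀ i, M.S i → Q₁.Node i → Q₂.Node i → Prop)
    (Rf : ∀ i, M.S i → ℕ∞ → Q₁.Node i → Q₂.Node i → Prop) (c₁ : Q₁.Config) (c₂ : Q₂.Config)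
    (s : ∀ i, Option (M.S i)) : Prop :=
  c₁.focus = c₂.focus ∧ (∀ b, c₁.focus = some b → c₁.curr b.1 ≠ none) ∧
  ∀ i, (c₁.curr i = none ∧ c₂.curr i = none) ∨ ∃ u P₁ P₂, c₁.curr i = some P₁ ∧
    c₂.curr i = some P₂ ∧ s i = some u ∧ (∀ τ, c₁.focus = some (i, τ) → Rf i u τ P₁ P₂) ∧
    ((∀ τ, c₁.focus ≠ some (i, τ)) → Ru i u P₁ P₂)

variable {Q₁ Q₂ : Scheduler M} {Ru : ∀ i, M.S i → Q₁.Node i → Q₂.Node i → Prop}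
  {Rf : ∀ i, M.S i → ℕ∞ → Q₁.Node i → Q₂.Node i → Prop}

/-- All active arms match as waiting ones. -/
def MatchWaiting (Ru : ∀ i, M.S i → Q₁.Node i → Q₂.Node i → Prop)
    (curr₁ : ∀ i, Option (Q₁.Node i)) (curr₂ : ∀ i, Option (Q₂.Node i))
    (s : ∀ i, Option (M.S i)) : Prop :=
  ∀ i, (curr₁ i = none ∧ curr₂ i = none) ∨ ∃ u P₁ P₂, curr₁ i = some P₁ ∧
    curr₂ i = some P₂ ∧ s i = some u ∧ Ru i u P₁ P₂

theorem MatchWaiting.drop {curr₁ : ∀ i, Option (Q₁.Node i)} {curr₂ : ∀ i, Option (Q₂.Node i)}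
    {s : ∀ i, Option (M.S i)} (h : MatchWaiting Ru curr₁ curr₂ s) (i : Fin M.n) :
    MatchWaiting Ru (Function.update curr₁ i none) (Function.update curr₂ i none) s := by
  intro j
  by_cases hj : j = i
  · subst hj
    exact Or.inl ⟨Function.update_self .., Function.update_self ..⟩
  · rw [Function.update_of_ne hj, Function.update_of_ne hj]
    exact h j

/-- Equal times give equal selections and equal drops. An arm selected by both changes from the
waiting relation to the focus relation through `hstart`. -/
theorem Match.outer (htime : ∀ i u P₁ P₂, Ru i u P₁ P₂ → Q₁.time i P₁ = Q₂.time i P₂)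
    (hstart : ∀ i u P₁ P₂, Ru i u P₁ P₂ → Q₁.time i P₁ ≠ ⊤ → Rf i u (Q₁.time i P₁) P₁ P₂)
    (k : ℕ) (c₁ : Q₁.Config) (c₂ : Q₂.Config) (s : ∀ i, Option (M.S i))
    (h : MatchWaiting Ru c₁.curr c₂.curr s) :
    Match Ru Rf (Q₁.outer k c₁).val (Q₂.outer k c₂).val s := by
  have hnone : ∀ (c₁ : Q₁.Config) (c₂ : Q₂.Config), MatchWaiting Ru c₁.curr c₂.curr s →
      Match Ru Rf { c₁ with focus := none } { c₂ with focus := none } s := by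
    intro c₁ c₂ h
    refine ⟨rfl, by simp, fun i => ?_⟩
    rcases h i with h1 | ⟨u, P₁, P₂, h1, h2, h3, h4⟩
    · exact Or.inl h1
    · exact Or.inr ⟨u, P₁, P₂, h1, h2, h3, by simp, fun _ => h4⟩
  induction k generalizing c₁ c₂ with
  | zero => exact hnone c₁ c₂ h
  | succ k ih =>
    have he : (Q₁.argmin c₁).val = (Q₂.argmin c₂).val := by
      have : ∀ i, (c₁.curr i).map (Q₁.time i) = (c₂.curr i).map (Q₂.time i) := by
        intro i
        rcases h i with ⟨h1, h2⟩ | ⟨u, P₁, P₂, h1, h2, h3, h4⟩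
        · simp [h1, h2]
        · simp [h1, h2, htime i u P₁ P₂ h4]
      simp only [val_argmin, this]
    rw [val_outer_succ, val_outer_succ, ← he]
    have hs := argmin_spec c₁
    rcases ha : (Q₁.argmin c₁).val with _ | ⟨i, t⟩ <;> rw [ha] at hs
    · exact hnone c₁ c₂ h
    · dsimp only at hs ⊢
      split_ifs with ht
      · exact ih _ _ (h.drop i)
      · obtain ⟨⟨P, hP, rfl⟩, -⟩ := hs
        refine ⟨rfl, by rintro b hb; cases hb; simp [hP], fun j => ?_⟩
        rcases h j with h1 | ⟨u, P₁, P₂, h1, h2, h3, h4⟩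
        · exact Or.inl h1
        · refine Or.inr ⟨u, P₁, P₂, h1, h2, h3, fun τ hτ => ?_, fun _ => h4⟩
          cases hτ
          rw [hP] at h1
          cases h1
          exact hstart _ _ _ _ h4 ht

/-- Schedulers whose decisions agree along related nodes have the same expectations. -/
theorem expect_eq_of_match
    (htime : ∀ i u P₁ P₂, Ru i u P₁ P₂ → Q₁.time i P₁ = Q₂.time i P₂)
    (hstart : ∀ i u P₁ P₂, Ru i u P₁ P₂ → Q₁.time i P₁ ≠ ⊤ → Rf i u (Q₁.time i P₁) P₁ P₂)
    (hcont : ∀ i u τ P₁ P₂ v, Rf i u τ P₁ P₂ → 0 < M.p i u v →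
      Q₁.cont i (Q₁.child i P₁ v) (τ + 1) = Q₂.cont i (Q₂.child i P₂ v) (τ + 1) ∧
      (Q₁.cont i (Q₁.child i P₁ v) (τ + 1) = true →
        Rf i v (τ + 1) (Q₁.child i P₁ v) (Q₂.child i P₂ v)) ∧
      (Q₁.cont i (Q₁.child i P₁ v) (τ + 1) = false →
        Ru i v (Q₁.child i P₁ v) (Q₂.child i P₂ v)))
    (F : List (Σ i, M.S i) → ℝ) (k : ℕ) {curr₁ : ∀ i, Option (Q₁.Node i)}
    {curr₂ : ∀ i, Option (Q₂.Node i)} {s : ∀ i, Option (M.S i)}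
    (h : MatchWaiting Ru curr₁ curr₂ s) (l : List (Σ i, M.S i)) :
    Q₁.agent.expect F k (Q₁.settle ⟨curr₁, none⟩).val s l =
      Q₂.agent.expect F k (Q₂.settle ⟨curr₂, none⟩).val s l := by
  refine Agent.expect_eq_of_bisim (A := Q₁.agent) (A' := Q₂.agent) (Match Ru Rf) ?_ ?_ F k _ _ s l ?_
  · intro c₁ c₂ s h
    simp only [agent, h.1]
  · intro c₁ c₂ s i u h hc hs o ho
    obtain ⟨τ, hf⟩ := choose_eq hc
    rcases h.2.2 i with ⟨h1, -⟩ | ⟨u', P₁, P₂, h1, h2, h3, h4, -⟩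
    · exact absurd h1 (h.2.1 _ hf)
    rw [hs] at h3
    cases h3
    have hRf := h4 τ hf
    rw [val_update hf h1, val_update (h.1 ▸ hf) h2, val_settle, val_settle]
    simp only [Function.update_self]
    have hother : ∀ j, j ≠ i → (c₁.curr j = none ∧ c₂.curr j = none) ∨ ∃ u P₁ P₂,
        c₁.curr j = some P₁ ∧ c₂.curr j = some P₂ ∧
        (Function.update s i o : ∀ i, Option (M.S i)) j = some u ∧ Ru j u P₁ P₂ := by
      intro j hj
      rcases h.2.2 j with h5 | ⟨u', P₁, P₂, h5, h6, h7, -, h8⟩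
      · exact Or.inl h5
      · refine Or.inr ⟨u', P₁, P₂, h5, h6, by rw [Function.update_of_ne hj]; exact h7,
          h8 fun τ' h9 => ?_⟩
        rw [hf] at h9
        cases h9
        exact hj rfl
    cases o with
    | none =>
      refine Match.outer htime hstart _ _ _ _ fun j => ?_
      dsimp only
      by_cases hj : j = i
      · subst hj
        exact Or.inl ⟨Function.update_self .., Function.update_self ..⟩
      · rw [Function.update_of_ne hj, Function.update_of_ne hj]
        exact hother j hj
    | some v =>
      have hp : 0 < M.p i u v := lt_of_le_of_ne (M.p_nonneg i u v) (Ne.symm ho)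
      obtain ⟨k1, k2, k3⟩ := hcont i u τ P₁ P₂ v hRf hp
      simp only [move, ← k1]
      split_ifs with e1 e2 e3 e3
      · refine ⟨rfl, by rintro b hb; cases hb; simp, fun j => ?_⟩
        by_cases hj : j = i
        · subst hj
          refine Or.inr ⟨v, _, _, Function.update_self .., Function.update_self ..,
            Function.update_self .., fun τ' hτ => ?_, fun hc => absurd rfl (hc (τ + 1))⟩
          cases hτ
          exact k2 e1
        · dsimp only
          rw [Function.update_of_ne hj, Function.update_of_ne hj]
          rcases hother j hj with h5 | ⟨u', P₁, P₂, h5, h6, h7, h8⟩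
          · exact Or.inl h5
          · refine Or.inr ⟨u', P₁, P₂, h5, h6, h7, fun τ' hτ => ?_, fun _ => h8⟩
            cases hτ
            exact absurd rfl hj
      -- Both inner loops stop. The nodes now match as waiting ones, so they have equal times, and
      -- the mixed cases in which only one scheduler drops the arm are contradictory.
      all_goals
        have hRu := k3 (by simpa using e1)
        have hw : MatchWaiting Ru (Function.update c₁.curr i (some (Q₁.child i P₁ v)))
            (Function.update c₂.curr i (some (Q₂.child i P₂ v))) (Function.update s i (some v)) := by
          intro j
          by_cases hj : j = i
          · subst hj
            exact Or.inr ⟨v, _, _, Function.update_self .., Function.update_self ..,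
              Function.update_self .., hRu⟩
          · rw [Function.update_of_ne hj, Function.update_of_ne hj]
            exact hother j hj
        have ht := htime _ _ _ _ hRu
      · exact Match.outer htime hstart _ _ _ _ (hw.drop i)
      · exact absurd (ht ▸ e2) e3
      · exact absurd (ht.trans e3) e2
      · exact Match.outer htime hstart _ _ _ _ hw
  · rw [val_settle, val_settle]
    exact Match.outer htime hstart _ _ _ _ h

/-! ### The number of plays -/

/-- The sum of the potentials of the active arms. -/
def totalPot (pot : ∀ i, Q.Node i → ℕ) (curr : ∀ i, Option (Q.Node i)) : ℕ :=
  ∑ i, (curr i).elim 0 (pot i)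

theorem totalPot_le_of_dropTop {pot : ∀ i, Q.Node i → ℕ} {curr curr' : ∀ i, Option (Q.Node i)}
    (h : DropTop curr curr') : totalPot pot curr' ≤ totalPot pot curr := by
  refine Finset.sum_le_sum fun i _ => ?_
  rcases h i with h | ⟨h, -⟩ <;> simp [h]

/-- A play lowers the potential of its arm by at least one, and settling never raises the total. So
the total bounds the number of plays, whatever `k` is, and each play together with its bookkeeping
costs at most `K`. -/
theorem worstCost_le (good : ∀ i, Q.Node i → Prop) (pot : ∀ i, Q.Node i → ℕ)
    (hgood : ∀ i P v, good i P → Q.time i P ≠ ⊤ → good i (Q.child i P v) ∧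
      pot i (Q.child i P v) < pot i P)
    (hcont : ∀ i P τ, Q.cont i P τ = true → Q.time i P ≠ ⊤)
    (K : ℕ) (hK : ∀ c i o, (Q.agent.update c i o).cost + 1 ≤ K) (k : ℕ) (c : Q.Config)
    (s : ∀ i, Option (M.S i)) (hc : ∀ i P, c.curr i = some P → good i P)
    (hf : ∀ b, c.focus = some b → ∃ P, c.curr b.1 = some P ∧ Q.time b.1 P ≠ ⊤) :
    Q.agent.worstCost k c s ≤ totalPot pot c.curr * K := by
  induction k generalizing c s with
  | zero => simp [Agent.worstCost]
  | succ k ih =>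
    simp only [Agent.worstCost]
    rcases hch : Q.agent.choose c with _ | i
    · exact Nat.zero_le _
    rcases hs : s i with _ | u
    · simp [hs]
    obtain ⟨τ, hfoc⟩ := choose_eq hch
    obtain ⟨P, hP, hfin⟩ := hf _ hfoc
    dsimp only at hP hfin ⊢
    simp only [hs]
    refine Finset.sup_le fun o _ => ?_
    have hKo := hK c i o
    -- The root serves as an arbitrary child: it shows that `pot` is positive here, so exhausting
    -- the arm also lowers the total.
    have hPpot : 0 < pot i P := lt_of_le_of_lt (Nat.zero_le _)
      (hgood i P (M.root i) (hc i P hP) hfin).2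
    have hmove : (Q.move i P o).elim 0 (pot i) + 1 ≤ pot i P := by
      cases o with
      | none => exact hPpot
      | some v => exact (hgood i P v (hc i P hP) hfin).2
    have hdec : totalPot pot (Function.update c.curr i (Q.move i P o)) + 1 ≤
        totalPot pot c.curr := by
      unfold totalPot
      rw [← Finset.add_sum_erase _ _ (Finset.mem_univ i),
        ← Finset.add_sum_erase _ (fun i => (c.curr i).elim 0 (pot i)) (Finset.mem_univ i)]
      have : ∑ j ∈ univ.erase i, ((Function.update c.curr i (Q.move i P o) :
          ∀ i, Option (Q.Node i)) j).elim 0 (pot j) =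
          ∑ j ∈ univ.erase i, (c.curr j).elim 0 (pot j) :=
        Finset.sum_congr rfl fun j hj => by rw [Function.update_of_ne (Finset.ne_of_mem_erase hj)]
      rw [this, Function.update_self, hP]
      simp only [Option.elim_some]
      omega
    have hgood' : ∀ j P', (Function.update c.curr i (Q.move i P o) :
        ∀ i, Option (Q.Node i)) j = some P' → good j P' := by
      intro j P' hP'
      by_cases hj : j = i
      · subst hj
        rw [Function.update_self] at hP'
        cases o with
        | none => cases hP'
        | some v =>
          cases hP'
          exact (hgood _ P v (hc _ P hP) hfin).1
      · rw [Function.update_of_ne hj] at hP'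
        exact hc j P' hP'
    have hih : Q.agent.worstCost k (Q.agent.update c i o).val (Function.update s i o) ≤
        totalPot pot (Function.update c.curr i (Q.move i P o)) * K := by
      rw [val_update hfoc hP]
      rcases settle_spec (Q := Q) ⟨Function.update c.curr i (Q.move i P o), some (i, τ + 1)⟩ with
        ⟨b, P', h1, h2, h3, h4⟩ | ⟨-, h2, h3⟩
      · rw [h4]
        refine ih _ _ hgood' fun b' hb' => ?_
        rw [h1] at hb'
        cases hb'
        exact ⟨P', h2, hcont _ _ _ h3⟩
      · refine (ih _ _ (fun j P' hP' => ?_) fun b hb => ?_).trans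
          (Nat.mul_le_mul_right _ (totalPot_le_of_dropTop h2))
        · rcases h2 j with h | ⟨h, -⟩
          · rw [h] at hP'
            exact hgood' j P' hP'
          · rw [h] at hP'
            cases hP'
        · simp only [Selected, hb] at h3
          obtain ⟨P', h5, h6⟩ := h3.2.1
          exact ⟨P', h5, h6 ▸ h3.1⟩
    calc _ ≤ K + totalPot pot (Function.update c.curr i (Q.move i P o)) * K := by
          have e : Q.agent.worstCost k (Q.agent.update c i o).val (Function.update s i o) ≤ _ := hih
          have e2 : ∀ x, x ≤ totalPot pot (Function.update c.curr i (Q.move i P o)) * K →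
            1 + (Q.agent.update c i o).cost + x ≤
              K + totalPot pot (Function.update c.curr i (Q.move i P o)) * K := by
            intro x hx; omega
          exact e2 _ (by convert e)
      _ = (totalPot pot (Function.update c.curr i (Q.move i P o)) + 1) * K := by ring
      _ ≤ _ := Nat.mul_le_mul_right _ hdec

end Scheduler

/-! ### Tree nodes -/

section TreeNodes

variable {M : MAB} {B : ℕ} {i : Fin M.n} {depth : M.S i → ℕ} {D : StratDag (M.S i)}

/-- The tree nodes of the blown-up tree of a dag. -/
abbrev MAB.IsNode (M : MAB) (i : Fin M.n) (D : StratDag (M.S i)) : TreeNode (M.S i) → Prop :=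
  IsTreeNode (M.p i) (M.root i) D

theorem StratDag.step_natCast (D : StratDag (M.S i)) (u : M.S i) (t : ℕ) (v : M.S i) :
    D.step u t v = D.next u t v := by
  simp [StratDag.step]

theorem MAB.IsStratDag.add_one_le_step (hD : M.IsStratDag B i D) {u v : M.S i} {t : ℕ∞}
    (hp : 0 < M.p i u v) : t + 1 ≤ D.step u t v := by
  induction t using ENat.recTopCoe with
  | top => simp [StratDag.step]
  | coe t => rw [D.step_natCast]; exact hD.next_gt u v hp t

theorem MAB.IsStratDag.step_le (hD : M.IsStratDag B i D) (u v : M.S i) (t : ℕ∞) :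
    D.step u t v = ⊤ ∨ D.step u t v ≤ B := by
  induction t using ENat.recTopCoe with
  | top => simp [StratDag.step]
  | coe t => rw [D.step_natCast]; exact hD.next_le u v t

theorem IsTreeNode.ne_nil {P : TreeNode (M.S i)} (h : M.IsNode i D P) : P ≠ [] := by
  cases h <;> simp [StratDag.treeRoot]

theorem IsTreeNode.of_cons {x y : M.S i × ℕ∞} {R : TreeNode (M.S i)}
    (h : M.IsNode i D (x :: y :: R)) : M.IsNode i D (y :: R) ∧ y.2 ≠ ⊤ ∧ 0 < M.p i y.1 x.1 ∧
      x.2 = D.step y.1 y.2 x.1 := by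
  cases h with
  | child u t P v h1 h2 h3 => exact ⟨h1, h2, h3, rfl⟩

theorem IsTreeNode.depth_add_one (hdepth : ∀ u v, 0 < M.p i u v → depth v = depth u + 1)
    (hroot : depth (M.root i) = 0) {P : TreeNode (M.S i)} (h : M.IsNode i D P) :
    treeDepth depth P + 1 = P.length := by
  induction h with
  | root => simp [StratDag.treeRoot, treeDepth, hroot]
  | child u t P v h1 h2 h3 ih =>
    simp only [treeDepth, List.length_cons] at ih ⊢
    rw [hdepth u v h3]
    omega

theorem IsTreeNode.length_le_time (hD : M.IsStratDag B i D) {P : TreeNode (M.S i)}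
    (h : M.IsNode i D P) : (P.length : ℕ∞) ≤ treeTime P := by
  induction h with
  | root =>
    have := (Finset.mem_Icc.1 hD.rootTime_mem).1
    simpa [StratDag.treeRoot, treeTime] using this
  | child u t P v h1 h2 h3 ih =>
    refine le_trans ?_ (hD.add_one_le_step h3)
    simp only [treeTime, List.length_cons] at ih ⊢
    push_cast at ih ⊢
    gcongr

theorem IsTreeNode.time_le (hD : M.IsStratDag B i D) {P : TreeNode (M.S i)}
    (h : M.IsNode i D P) : treeTime P = ⊤ ∨ treeTime P ≤ B := by
  cases h with
  | root =>
    right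
    have := (Finset.mem_Icc.1 hD.rootTime_mem).2
    simpa [StratDag.treeRoot, treeTime] using this
  | child u t P v h1 h2 h3 => exact hD.step_le u v t

theorem IsTreeNode.time_tail (hD : M.IsStratDag B i D) {x y : M.S i × ℕ∞}
    {R : TreeNode (M.S i)} (h : M.IsNode i D (x :: y :: R)) :
    treeTime (y :: R) + 1 ≤ treeTime (x :: y :: R) := by
  obtain ⟨-, -, h2, h3⟩ := h.of_cons
  simp only [treeTime, h3]
  exact hD.add_one_le_step h2

/-- A path of finite time is no longer than its time, which is at most `B`; one further node of time
`⊤` may follow. -/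
theorem IsTreeNode.length_le (hD : M.IsStratDag B i D) {P : TreeNode (M.S i)}
    (h : M.IsNode i D P) : P.length ≤ B + 1 := by
  cases h with
  | root => simp [StratDag.treeRoot]
  | child u t P v h1 h2 h3 =>
    have h4 := h1.length_le_time hD
    have h5 := (h1.time_le hD).resolve_left h2
    have : (((u, t) :: P).length : ℕ∞) ≤ B := h4.trans h5
    have : ((u, t) :: P).length ≤ B := by exact_mod_cast this
    simp only [List.length_cons] at this ⊢
    omega

/-- Paths have bounded length and finitely many one-step extensions. Finiteness makes the number of
heads a termination measure for gap filling, and lets the reward be split over the tree nodes. -/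
theorem finite_isNode (hD : M.IsStratDag B i D) : {P | M.IsNode i D P}.Finite := by
  have h : ∀ l, {P | M.IsNode i D P ∧ P.length = l}.Finite := by
    intro l
    induction l with
    | zero =>
      refine Set.Finite.subset Set.finite_empty ?_
      rintro P ⟨h1, h2⟩
      exact (h1.ne_nil (List.length_eq_zero_iff.1 h2)).elim
    | succ l ih =>
      refine Set.Finite.subset ((Set.finite_singleton (D.treeRoot (M.root i))).union
        (((Set.finite_univ (α := M.S i)).prod ih).image fun y => D.child y.2 y.1)) ?_
      rintro P ⟨h1, h2⟩
      cases h1 with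
      | root => exact Or.inl rfl
      | child u t P v h1 h3 h4 =>
        refine Or.inr ⟨(v, (u, t) :: P), ⟨Set.mem_univ _, h1, ?_⟩, rfl⟩
        simp only [List.length_cons] at h2 ⊢
        omega
  refine Set.Finite.subset ((Finset.range (B + 2)).finite_toSet.biUnion fun l _ => h l) ?_
  intro P hP
  have := IsTreeNode.length_le hD hP
  refine Set.mem_biUnion (x := P.length) (Finset.mem_coe.2 (Finset.mem_range.2 (by omega)))
    ⟨hP, rfl⟩

end TreeNodes

/-! ### Gap filling -/

section Gap

theorem treeHead_eq_self_iff {S : Type} {time : TreeNode S → ℕ∞} {x y : S × ℕ∞}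
    {R : TreeNode S} :
    treeHead time (x :: y :: R) = x :: y :: R ↔ time (x :: y :: R) ≠ time (y :: R) + 1 := by
  have hlen : ∀ P : TreeNode S, (treeHead time P).length ≤ P.length := by
    intro P
    induction P with
    | nil => simp [treeHead]
    | cons x P ih =>
      cases P with
      | nil => simp [treeHead]
      | cons y R =>
        rw [treeHead]
        split_ifs
        · exact ih.trans (by simp)
        · exact le_rfl
  rw [treeHead]
  split_ifs with h
  · simp only [h, ne_eq, not_true_eq_false, iff_false]
    intro hc
    have := hlen (y :: R)
    rw [hc] at this
    simp at this
  · simp [h]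

variable {M : MAB} {B : ℕ} {i : Fin M.n} {depth : M.S i → ℕ} {D : StratDag (M.S i)}

/-- What is preserved while gaps are filled. -/
structure GapInv (M : MAB) (i : Fin M.n) (depth : M.S i → ℕ) (D : StratDag (M.S i))
    (time : TreeNode (M.S i) → ℕ∞) : Prop where
  le : ∀ P, M.IsNode i D P → time P ≤ treeTime P
  top : ∀ P, M.IsNode i D P → time P = ⊤ → treeTime P = ⊤
  incr : ∀ x y R, M.IsNode i D (x :: y :: R) → time (y :: R) + 1 ≤ time (x :: y :: R)
  moved : ∀ P, M.IsNode i D P →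
    time P = treeTime P ∨ treeTime P < ((2 * treeDepth depth P : ℕ) : ℕ∞)
  head : ∀ P, M.IsNode i D P → treeHead time P = P → time P = treeTime P

theorem GapInv.init (hD : M.IsStratDag B i D) : GapInv M i depth D treeTime :=
  ⟨fun _ _ => le_rfl, fun _ _ h => h, fun _ _ _ h => h.time_tail hD, fun _ _ => Or.inl rfl,
    fun _ _ _ => rfl⟩

/-- The last conjunct says that time grows by one per step within a component; it is stated with
sums because subtraction on `ℕ∞` is truncated. -/
theorem treeHead_spec {time : TreeNode (M.S i) → ℕ∞} {P : TreeNode (M.S i)}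
    (h : M.IsNode i D P) : M.IsNode i D (treeHead time P) ∧
      treeHead time (treeHead time P) = treeHead time P ∧ treeHead time P <:+ P ∧
      time P + ((treeHead time P).length : ℕ∞) = time (treeHead time P) + (P.length : ℕ∞) := by
  induction h with
  | root => exact ⟨.root, rfl, List.suffix_rfl, rfl⟩
  | child u t P v h1 h2 h3 ih =>
    by_cases hc : time ((v, D.step u t v) :: (u, t) :: P) = time ((u, t) :: P) + 1
    · have e : treeHead time ((v, D.step u t v) :: (u, t) :: P) = treeHead time ((u, t) :: P) := by
        rw [treeHead, if_pos hc]
      rw [e, hc]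
      refine ⟨ih.1, ih.2.1, ih.2.2.1.trans (List.suffix_cons _ _), ?_⟩
      rw [add_right_comm, ih.2.2.2, add_assoc]
      simp [add_assoc, one_add_one_eq_two]
    · have e := treeHead_eq_self_iff.2 hc
      rw [e]
      exact ⟨.child u t P v h1 h2 h3, e, List.suffix_rfl, rfl⟩

/-! ### Advancing one component -/

section Advance

variable {time : TreeNode (M.S i) → ℕ∞} {x y : M.S i × ℕ∞} {R : TreeNode (M.S i)} {τ a : ℕ}

theorem advance_of_ne {v P : TreeNode (M.S i)} (h : treeHead time P ≠ v) :
    advance time v P = time P := by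
  rw [advance, if_neg h]

/-- Coordinates inside the component: `n` steps below its head the time is `τ + n`, and it becomes
`a + 1 + n`. Being natural numbers, they avoid truncated subtraction afterwards. -/
theorem advance_of_eq (hτ : time (x :: y :: R) = τ) (ha : time (y :: R) = a)
    {P : TreeNode (M.S i)} (hP : M.IsNode i D P) (h : treeHead time P = x :: y :: R) :
    ∃ n, P.length = (x :: y :: R).length + n ∧ time P = ((τ + n : ℕ) : ℕ∞) ∧
      advance time (x :: y :: R) P = ((a + 1 + n : ℕ) : ℕ∞) := by
  obtain ⟨-, -, h3, h4⟩ := treeHead_spec (time := time) hP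
  rw [h] at h3 h4
  obtain ⟨n, hn⟩ := Nat.exists_eq_add_of_le h3.length_le
  refine ⟨n, hn, ?_⟩
  have ht : time P = ((τ + n : ℕ) : ℕ∞) := by
    rw [hτ, hn] at h4
    have hfin : time P ≠ ⊤ := by
      intro hc
      rw [hc, top_add] at h4
      exact absurd h4.symm (by exact_mod_cast ENat.natCast_ne_top _)
    lift time P to ℕ using hfin with b
    have : b + (x :: y :: R).length = τ + ((x :: y :: R).length + n) := by exact_mod_cast h4
    congr 1
    omega
  refine ⟨ht, ?_⟩
  rw [advance, if_pos h, ht, hτ, List.tail_cons, ha]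
  norm_cast
  congr 1
  omega

/-- A component is shifted rigidly until it touches the parent of its head. The arc into the head
becomes contiguous, arcs inside stay so, gaps behind the component only widen, and no other arc is
affected. -/
theorem advance_contig_iff (hI : GapInv M i depth D time) (hτ : time (x :: y :: R) = τ)
    (ha : time (y :: R) = a) (hhead : treeHead time (x :: y :: R) = x :: y :: R)
    (hv : M.IsNode i D (x :: y :: R))
    {x' y' : M.S i × ℕ∞} {R' : TreeNode (M.S i)} (hP : M.IsNode i D (x' :: y' :: R')) :
    advance time (x :: y :: R) (y' :: R') + 1 ≤ advance time (x :: y :: R) (x' :: y' :: R') ∧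
    (advance time (x :: y :: R) (x' :: y' :: R') = advance time (x :: y :: R) (y' :: R') + 1 ↔
      time (x' :: y' :: R') = time (y' :: R') + 1 ∨ x' :: y' :: R' = x :: y :: R) := by
  have hQ := hP.of_cons.1
  -- There is a genuine gap above a head; without it the gaps behind the component would not grow.
  have hatau : a + 1 < τ := by
    have h1 := hI.incr x y R hv
    have h2 := treeHead_eq_self_iff.1 hhead
    rw [hτ, ha] at h1 h2
    have h3 : a + 1 ≤ τ := by exact_mod_cast h1
    have h4 : τ ≠ a + 1 := by exact_mod_cast h2
    omega
  have hinc := hI.incr x' y' R' hP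
  have hQle : advance time (x :: y :: R) (y' :: R') ≤ time (y' :: R') := by
    by_cases h2 : treeHead time (y' :: R') = x :: y :: R
    · obtain ⟨n, -, h3, h4⟩ := advance_of_eq hτ ha hQ h2
      rw [h3, h4]
      exact_mod_cast (by omega : a + 1 + n ≤ τ + n)
    · rw [advance_of_ne h2]
  by_cases h1 : treeHead time (x' :: y' :: R') = x :: y :: R
  · by_cases he : x' :: y' :: R' = x :: y :: R
    · obtain ⟨e1, e2, e3⟩ : x' = x ∧ y' = y ∧ R' = R := by simpa using he
      subst e1 e2 e3
      have hne : treeHead time (y' :: R') ≠ x' :: y' :: R' := by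
        intro hc
        have := (treeHead_spec (time := time) hQ).2.2.1.length_le
        rw [hc] at this
        simp at this
      obtain ⟨n, hn, h3, h4⟩ := advance_of_eq hτ ha hP h1
      have hn0 : n = 0 := by simpa using hn
      subst hn0
      rw [advance_of_ne hne, h4, ha]
      simp
    · have hc : time (x' :: y' :: R') = time (y' :: R') + 1 := by
        by_contra hc
        rw [treeHead_eq_self_iff.2 hc] at h1
        exact he h1
      have h2 : treeHead time (y' :: R') = x :: y :: R := by
        rw [← h1, treeHead, if_pos hc]
      obtain ⟨n, hn, h3, h4⟩ := advance_of_eq hτ ha hP h1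
      obtain ⟨m, hm, h5, h6⟩ := advance_of_eq hτ ha hQ h2
      have hmn : n = m + 1 := by
        simp only [List.length_cons] at hn hm
        omega
      have e : ((a + 1 + n : ℕ) : ℕ∞) = ((a + 1 + m : ℕ) : ℕ∞) + 1 := by
        rw [hmn]; push_cast; ring
      rw [h4, h6, e]
      exact ⟨le_rfl, by simp [hc]⟩
  · have hne : x' :: y' :: R' ≠ x :: y :: R := by
      intro hc
      rw [hc] at h1
      exact h1 hhead
    rw [advance_of_ne h1]
    refine ⟨(add_le_add_left hQle 1).trans hinc, ?_⟩
    by_cases h2 : treeHead time (y' :: R') = x :: y :: R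
    · have hnc : time (x' :: y' :: R') ≠ time (y' :: R') + 1 := by
        intro hc
        apply h1
        rw [treeHead, if_pos hc, h2]
      obtain ⟨m, hm, h5, h6⟩ := advance_of_eq hτ ha hQ h2
      simp only [hnc, hne, or_self, iff_false]
      intro hc
      rw [hc, h5, h6] at hinc
      have : τ + m + 1 ≤ a + 1 + m + 1 := by exact_mod_cast hinc
      omega
    · rw [advance_of_ne h2]
      simp [hne]

/-- An advance removes exactly one head and creates none. Termination of a round and the persistence
of what was achieved at later times both rest on this. -/
theorem treeHead_advance_iff (hI : GapInv M i depth D time) (hτ : time (x :: y :: R) = τ)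
    (ha : time (y :: R) = a) (hhead : treeHead time (x :: y :: R) = x :: y :: R)
    (hv : M.IsNode i D (x :: y :: R)) {P : TreeNode (M.S i)} (hP : M.IsNode i D P) :
    treeHead (advance time (x :: y :: R)) P = P ↔ treeHead time P = P ∧ P ≠ x :: y :: R := by
  cases hP with
  | root => simp [StratDag.treeRoot, treeHead]
  | child u t P v h1 h2 h3 =>
    have := (advance_contig_iff hI hτ ha hhead hv (.child u t P v h1 h2 h3)).2
    rw [treeHead_eq_self_iff, treeHead_eq_self_iff, ne_eq, this, not_or]

/-- The point is `moved`: the smallness condition at the head passes down its component. For `head`,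
note that a node which is still a head does not belong to the component that was shifted. -/
theorem GapInv.advance (hdepth : ∀ u v, 0 < M.p i u v → depth v = depth u + 1)
    (hroot : depth (M.root i) = 0) (hI : GapInv M i depth D time) (hτ : time (x :: y :: R) = τ)
    (ha : time (y :: R) = a) (hhead : treeHead time (x :: y :: R) = x :: y :: R)
    (hv : M.IsNode i D (x :: y :: R)) (hsmall : τ < 2 * treeDepth depth (x :: y :: R)) :
    GapInv M i depth D (advance time (x :: y :: R)) := by
  have hatau : a + 1 ≤ τ := by
    have h1 := hI.incr x y R hv
    rw [hτ, ha] at h1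
    exact_mod_cast h1
  refine ⟨fun P hP => ?_, fun P hP h => ?_, fun x' y' R' hP => ?_, fun P hP => ?_,
    fun P hP h => ?_⟩
  · refine le_trans ?_ (hI.le P hP)
    by_cases h2 : treeHead time P = x :: y :: R
    · obtain ⟨n, -, h3, h4⟩ := advance_of_eq hτ ha hP h2
      rw [h3, h4]
      exact_mod_cast (by omega : a + 1 + n ≤ τ + n)
    · rw [advance_of_ne h2]
  · by_cases h2 : treeHead time P = x :: y :: R
    · obtain ⟨n, -, h3, h4⟩ := advance_of_eq hτ ha hP h2
      rw [h4] at h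
      exact absurd h (ENat.natCast_ne_top _)
    · rw [advance_of_ne h2] at h
      exact hI.top P hP h
  · exact (advance_contig_iff hI hτ ha hhead hv hP).1
  · by_cases h2 : treeHead time P = x :: y :: R
    · right
      rcases hI.moved P hP with h5 | h5
      · obtain ⟨n, hn, h3, h4⟩ := advance_of_eq hτ ha hP h2
        rw [← h5, h3]
        -- Depth and time both grow by `n` below the head, so `τ < 2 * depth` at the head gives `τ +
        -- n < 2 * (depth + n)`.
        have e1 := hP.depth_add_one hdepth hroot
        have e2 := hv.depth_add_one hdepth hroot
        exact_mod_cast (by omega : τ + n < 2 * treeDepth depth P)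
      · exact h5
    · rw [advance_of_ne h2]
      exact hI.moved P hP
  · obtain ⟨h1, h2⟩ := (treeHead_advance_iff hI hτ ha hhead hv hP).1 h
    rw [advance_of_ne (by rwa [h1])]
    exact hI.head P hP h1

end Advance

theorem SmallGap.exists_cons (hroot : depth (M.root i) = 0)
    {time : TreeNode (M.S i) → ℕ∞} (hI : GapInv M i depth D time) {τ : ℕ}
    {v : TreeNode (M.S i)} (h : SmallGap depth (M.IsNode i D) τ time v) :
    ∃ (x y : M.S i × ℕ∞) (R : TreeNode (M.S i)) (a : ℕ), v = x :: y :: R ∧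
      time (x :: y :: R) = τ ∧ time (y :: R) = a ∧ treeHead time (x :: y :: R) = x :: y :: R ∧
      M.IsNode i D (x :: y :: R) ∧ τ < 2 * treeDepth depth (x :: y :: R) := by
  obtain ⟨⟨P, hP, rfl⟩, h2, h3⟩ := h
  obtain ⟨hv, hh, -, -⟩ := treeHead_spec (time := time) hP
  generalize treeHead time P = v at *
  cases hv with
  | root => simp [StratDag.treeRoot, treeDepth, hroot] at h3
  | child u t P v h4 h5 h6 =>
    have hv := IsTreeNode.child (p := M.p i) (root := M.root i) u t P v h4 h5 h6
    have hfin : time ((u, t) :: P) ≠ ⊤ := fun hc => h5 (hI.top _ h4 hc)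
    obtain ⟨a, ha⟩ := ENat.ne_top_iff_exists.1 hfin
    exact ⟨_, _, P, a, rfl, h2, ha.symm, hh, hv, h3⟩

/-- After the rounds down to `τ`, all heads at the times from `τ` on have small depth. -/
def BigHeads (M : MAB) (i : Fin M.n) (depth : M.S i → ℕ) (D : StratDag (M.S i)) (τ : ℕ)
    (time : TreeNode (M.S i) → ℕ∞) : Prop :=
  ∀ P, M.IsNode i D P → treeHead time P = P → (τ : ℕ∞) ≤ treeTime P → treeTime P ≠ ⊤ →
    ((2 * treeDepth depth P : ℕ) : ℕ∞) ≤ treeTime P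

/-- Heads are never created and keep their original times, so a round does not spoil what the
earlier rounds achieved at later times; and it ends only when no violating head at time `τ` is left.
-/
theorem GapRound.spec (hdepth : ∀ u v, 0 < M.p i u v → depth v = depth u + 1)
    (hroot : depth (M.root i) = 0) {τ : ℕ} {time time' : TreeNode (M.S i) → ℕ∞}
    (h : GapRound depth (M.IsNode i D) (D.treeRoot (M.root i)) τ time time')
    (hI : GapInv M i depth D time) (hB : BigHeads M i depth D (τ + 1) time) :
    GapInv M i depth D time' ∧ BigHeads M i depth D τ time' := by
  induction h with
  | done time h =>
    refine ⟨hI, fun P hP hh hτ hfin => ?_⟩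
    rcases hτ.eq_or_lt with h1 | h1
    · have := h P
      by_contra hc
      refine this ⟨⟨P, hP, hh⟩, by rw [hI.head P hP hh, h1], ?_⟩
      rw [← h1, not_le] at hc
      exact_mod_cast hc
    · exact hB P hP hh (by push_cast; exact Order.add_one_le_of_lt h1) hfin
  | step time time' v h1 _ _ ih =>
    obtain ⟨x, y, R, a, rfl, hτ, ha, hhead, hv, hs⟩ := h1.exists_cons hroot hI
    refine ih (hI.advance hdepth hroot hτ ha hhead hv hs) fun P hP hh => ?_
    exact hB P hP ((treeHead_advance_iff hI hτ ha hhead hv hP).1 hh).1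

/-- Every advance lowers the number of heads, so any maximal sequence of advances is finite. -/
theorem exists_gapRound (hD : M.IsStratDag B i D)
    (hdepth : ∀ u v, 0 < M.p i u v → depth v = depth u + 1)
    (hroot : depth (M.root i) = 0) {τ : ℕ} (n : ℕ) {time : TreeNode (M.S i) → ℕ∞}
    (hI : GapInv M i depth D time)
    (hn : {P | M.IsNode i D P ∧ treeHead time P = P}.ncard ≤ n) :
    ∃ time', GapRound depth (M.IsNode i D) (D.treeRoot (M.root i)) τ time time' := by
  induction n generalizing time with
  | zero =>
    refine ⟨time, .done _ fun v hv => ?_⟩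
    obtain ⟨x, y, R, a, rfl, hτ, ha, hhead, hv, hs⟩ := hv.exists_cons hroot hI
    have hfin : {P | M.IsNode i D P ∧ treeHead time P = P}.Finite :=
      (finite_isNode hD).subset fun P hP => hP.1
    have := (Set.ncard_eq_zero hfin).1 (Nat.le_zero.1 hn)
    have hmem : x :: y :: R ∈ {P | M.IsNode i D P ∧ treeHead time P = P} := ⟨hv, hhead⟩
    rw [this] at hmem
    exact hmem
  | succ n ih =>
    by_cases hex : ∃ v, SmallGap depth (M.IsNode i D) τ time v
    · obtain ⟨v, hsg⟩ := hex
      obtain ⟨x, y, R, a, rfl, hτ, ha, hhead, hv, hs⟩ := hsg.exists_cons hroot hI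
      obtain ⟨time', h⟩ := ih (hI.advance hdepth hroot hτ ha hhead hv hs) (by
        have hfin : {P | M.IsNode i D P ∧ treeHead time P = P}.Finite :=
          (finite_isNode hD).subset fun P hP => hP.1
        have : {P | M.IsNode i D P ∧ treeHead (advance time (x :: y :: R)) P = P} ⊂
            {P | M.IsNode i D P ∧ treeHead time P = P} := by
          have hsub : {P | M.IsNode i D P ∧ treeHead (advance time (x :: y :: R)) P = P} ⊆
              {P | M.IsNode i D P ∧ treeHead time P = P} := fun P hP => ⟨hP.1,
            ((treeHead_advance_iff hI hτ ha hhead hv hP.1).1 hP.2).1⟩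
          refine (Set.ssubset_iff_of_subset hsub).2
            ⟨x :: y :: R, ⟨hv, hhead⟩, fun hc => ?_⟩
          exact ((treeHead_advance_iff hI hτ ha hhead hv hv).1 hc.2).2 rfl
        have := Set.ncard_lt_ncard this hfin
        omega)
      exact ⟨time', .step _ _ _ hsg (by simp [StratDag.treeRoot]) h⟩
    · exact ⟨time, .done _ fun v hv => hex ⟨v, hv⟩⟩

/-- The result of gap filling: every component starts at a time of at least twice its depth. -/
structure Filled (M : MAB) (i : Fin M.n) (depth : M.S i → ℕ) (D : StratDag (M.S i))
    (time : TreeNode (M.S i) → ℕ∞) : Prop extends GapInv M i depth D time where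
  two_mul_le : ∀ P, M.IsNode i D P → treeHead time P = P →
    ((2 * treeDepth depth P : ℕ) : ℕ∞) ≤ treeTime P

theorem GapRounds.spec (hdepth : ∀ u v, 0 < M.p i u v → depth v = depth u + 1)
    (hroot : depth (M.root i) = 0) {τ : ℕ} {time time' : TreeNode (M.S i) → ℕ∞}
    (h : GapRounds depth (M.IsNode i D) (D.treeRoot (M.root i)) τ time time')
    (hI : GapInv M i depth D time) (hB : BigHeads M i depth D (τ + 1) time) :
    GapInv M i depth D time' ∧ BigHeads M i depth D 1 time' := by
  induction τ generalizing time with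
  | zero => cases h; exact ⟨hI, hB⟩
  | succ τ ih =>
    obtain ⟨mid, h1, h2⟩ := h
    obtain ⟨h3, h4⟩ := h1.spec hdepth hroot hI hB
    exact ih h2 h3 h4

theorem exists_gapRounds (hD : M.IsStratDag B i D)
    (hdepth : ∀ u v, 0 < M.p i u v → depth v = depth u + 1)
    (hroot : depth (M.root i) = 0) (τ : ℕ) {time : TreeNode (M.S i) → ℕ∞}
    (hI : GapInv M i depth D time) (hB : BigHeads M i depth D (τ + 1) time) :
    ∃ time', GapRounds depth (M.IsNode i D) (D.treeRoot (M.root i)) τ time time' := by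
  induction τ generalizing time with
  | zero => exact ⟨time, rfl⟩
  | succ τ ih =>
    obtain ⟨mid, h1⟩ := exists_gapRound hD hdepth hroot (τ := τ + 1) _ hI le_rfl
    obtain ⟨h3, h4⟩ := h1.spec hdepth hroot hI hB
    obtain ⟨time', h⟩ := ih h3 h4
    exact ⟨time', mid, h1, h⟩

theorem BigHeads.init (hD : M.IsStratDag B i D) : BigHeads M i depth D (B + 1) treeTime := by
  intro P hP _ h1 h2
  have h3 := (hP.time_le hD).resolve_left h2
  have := h1.trans h3
  have : B + 1 ≤ B := by exact_mod_cast this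
  omega

theorem exists_gapFill (hD : M.IsStratDag B i D)
    (hdepth : ∀ u v, 0 < M.p i u v → depth v = depth u + 1)
    (hroot : depth (M.root i) = 0) : ∃ time', M.GapFill B i depth D time' :=
  exists_gapRounds hD hdepth hroot B (GapInv.init hD) (BigHeads.init hD)

theorem MAB.GapFill.filled (hD : M.IsStratDag B i D)
    (hdepth : ∀ u v, 0 < M.p i u v → depth v = depth u + 1)
    (hroot : depth (M.root i) = 0) {time' : TreeNode (M.S i) → ℕ∞}
    (h : M.GapFill B i depth D time') : Filled M i depth D time' := by
  obtain ⟨h1, h2⟩ := GapRounds.spec hdepth hroot h (GapInv.init hD) (BigHeads.init hD)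
  refine ⟨h1, fun P hP hh => ?_⟩
  by_cases hfin : treeTime P = ⊤
  · simp [hfin]
  · refine h2 P hP hh (le_trans ?_ (hP.length_le_time hD)) hfin
    have := List.length_pos_iff.2 hP.ne_nil
    exact_mod_cast this

end Gap

/-! ### Implicit gap filling -/

section Implicit

variable {M : MAB} {B : ℕ} {i : Fin M.n} {D : StratDag (M.S i)}

theorem Filled.eq_top_iff {depth : M.S i → ℕ} {time : TreeNode (M.S i) → ℕ∞}
    (h : Filled M i depth D time) {P : TreeNode (M.S i)} (hP : M.IsNode i D P) :
    time P = ⊤ ↔ treeTime P = ⊤ := by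
  refine ⟨h.top P hP, fun ht => ?_⟩
  rcases h.moved P hP with h1 | h1
  · rw [h1, ht]
  · rw [ht] at h1
    exact absurd h1 (by simp)

/-- The condition of the inner loop can be read off the times before gap filling. -/
theorem Filled.contig_iff {depth : M.S i → ℕ} {time : TreeNode (M.S i) → ℕ∞}
    (h : Filled M i depth D time) {x y : M.S i × ℕ∞} {R : TreeNode (M.S i)}
    (hP : M.IsNode i D (x :: y :: R)) :
    (time (x :: y :: R) ≠ ⊤ ∧ time (x :: y :: R) = time (y :: R) + 1) ↔
      (treeTime (x :: y :: R) ≠ ⊤ ∧ (treeTime (x :: y :: R) = time (y :: R) + 1 ∨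
        treeTime (x :: y :: R) < ((2 * treeDepth depth (x :: y :: R) : ℕ) : ℕ∞))) := by
  rw [ne_eq, h.eq_top_iff hP]
  -- Left to right, a node keeps its time or was moved, and then its original time is below twice
  -- its depth. Right to left, the original time squeezes the new one between `incr` and `le`, or
  -- the node violates the condition on heads and hence is not one.
  refine and_congr_right fun hfin => ⟨fun hc => ?_, ?_⟩
  · rcases h.moved _ hP with h1 | h1
    · exact Or.inl (h1 ▸ hc)
    · exact Or.inr h1
  · rintro (h1 | h1)
    · exact le_antisymm (h1 ▸ h.le _ hP) (h.incr _ _ _ hP)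
    · by_contra hc
      exact absurd (h.two_mul_le _ hP (treeHead_eq_self_iff.2 hc)) (not_le.2 h1)

variable {depth : ∀ i, M.S i → ℕ} {Ds : ∀ i, List (StratDag (M.S i))}

theorem treeStart_none {σ : Choice M Ds} {i : Fin M.n} (h : σ i = none) :
    treeStart M Ds σ i = none := by simp [treeStart, h]

theorem treeStart_some {σ : Choice M Ds} {i : Fin M.n} {j : Fin (Ds i).length}
    (h : σ i = some j) : treeStart M Ds σ i = some (j, ((Ds i).get j).treeRoot (M.root i)) := by
  simp [treeStart, h]

theorem dagStart_none {σ : Choice M Ds} {i : Fin M.n} (h : σ i = none) :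
    dagStart M Ds σ i = none := by simp [dagStart, h]

theorem dagStart_some {σ : Choice M Ds} {i : Fin M.n} {j : Fin (Ds i).length}
    (h : σ i = some j) :
    dagStart M Ds σ i = some (j, M.root i, (((Ds i).get j).rootTime : ℕ∞)) := by
  simp [dagStart, h]

/-- The first plays of the algorithm on the trees have the same law with implicit gap filling. -/
theorem implicitFillExpect_eq {time' : ∀ i, Fin (Ds i).length → TreeNode (M.S i) → ℕ∞}
    (hfill : ∀ i j, Filled M i (depth i) ((Ds i).get j) (time' i j)) (σ : Choice M Ds)
    (F : List (Σ i, M.S i) → ℝ) (k : ℕ) :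
    implicitFillExpect M depth Ds σ F k = algDAGExpect M Ds time' σ F k := by
  symm
  refine Scheduler.expect_eq_of_match (Q₁ := algDAG M Ds time') (Q₂ := implicitFill M depth Ds)
    -- A waiting arm stands at a head, whose time is unchanged, so both schedulers select alike. In
    -- the focus the gap-filled time equals the counter, whereas the original time may be larger.
    (Ru := fun i u P₁ P₂ => P₁ = P₂ ∧ M.IsNode i ((Ds i).get P₁.1) P₁.2 ∧
      (∃ t R, P₁.2 = (u, t) :: R) ∧ time' i P₁.1 P₁.2 = treeTime P₁.2)
    (Rf := fun i u τ P₁ P₂ => P₁ = P₂ ∧ M.IsNode i ((Ds i).get P₁.1) P₁.2 ∧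
      (∃ t R, P₁.2 = (u, t) :: R) ∧ time' i P₁.1 P₁.2 = τ ∧ τ ≠ ⊤) ?_ ?_ ?_ F k ?_ []
  · rintro i u P _ ⟨rfl, -, -, h⟩
    exact h
  · rintro i u P _ ⟨rfl, h1, h2, h3⟩ h4
    exact ⟨rfl, h1, h2, rfl, h4⟩
  · rintro i u τ ⟨j, P⟩ _ v ⟨rfl, h1, ⟨t, R, h2⟩, h3, h4⟩ hp
    dsimp only at h1 h2 h3
    subst h2
    have htop := (hfill i j).eq_top_iff h1
    have ht : t ≠ ⊤ := by
      intro hc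
      exact h4 (h3 ▸ htop.2 hc)
    have hN : M.IsNode i ((Ds i).get j) ((v, ((Ds i).get j).step u t v) :: (u, t) :: R) :=
      .child u t R v h1 ht hp
    have hiff := (hfill i j).contig_iff hN
    rw [h3] at hiff
    refine ⟨?_, fun hc => ⟨rfl, hN, ⟨_, _, rfl⟩, ?_, ?_⟩, fun hc => ⟨rfl, hN, ⟨_, _, rfl⟩, ?_⟩⟩
    · simp only [algDAG, implicitFill, StratDag.child, decide_eq_decide]
      exact hiff
    · simp only [algDAG, StratDag.child, decide_eq_true_eq] at hc
      exact hc.2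
    · simp only [algDAG, StratDag.child, decide_eq_true_eq] at hc
      exact hc.2 ▸ hc.1
    · simp only [algDAG, StratDag.child, decide_eq_false_iff_not] at hc
      refine (hfill i j).head _ hN (treeHead_eq_self_iff.2 fun he => hc ?_)
      rw [h3] at he
      refine ⟨?_, he⟩
      rw [he]
      simpa using h4
  · intro i
    rcases hσ : σ i with _ | j
    · exact Or.inl ⟨treeStart_none hσ, treeStart_none hσ⟩
    · refine Or.inr ⟨M.root i, (j, ((Ds i).get j).treeRoot (M.root i)), _, treeStart_some hσ,
        treeStart_some hσ, rfl, rfl, .root, ⟨_, _, rfl⟩, ?_⟩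
      exact (hfill i j).head _ .root rfl

/-- The trees need not be built. -/
theorem implicitPlayExpect_eq (σ : Choice M Ds) (F : List (Σ i, M.S i) → ℝ) (k : ℕ) :
    implicitPlayExpect M depth Ds σ F k = implicitFillExpect M depth Ds σ F k := by
  symm
  refine Scheduler.expect_eq_of_match (Q₁ := implicitFill M depth Ds)
    (Q₂ := implicitPlay M depth Ds)
    (Ru := fun i _ P₁ P₂ => ∃ R, P₁ = (P₂.1, P₂.2 :: R))
    (Rf := fun i _ _ P₁ P₂ => ∃ R, P₁ = (P₂.1, P₂.2 :: R)) ?_ ?_ ?_ F k ?_ []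
  · rintro i u _ P ⟨R, rfl⟩
    rfl
  · rintro i u _ P ⟨R, rfl⟩ -
    exact ⟨R, rfl⟩
  · rintro i u τ _ P v ⟨R, rfl⟩ -
    exact ⟨rfl, fun _ => ⟨_, rfl⟩, fun _ => ⟨_, rfl⟩⟩
  · intro i
    rcases hσ : σ i with _ | j
    · exact Or.inl ⟨treeStart_none hσ, dagStart_none hσ⟩
    · exact Or.inr ⟨M.root i, (j, ((Ds i).get j).treeRoot (M.root i)),
        (j, M.root i, (((Ds i).get j).rootTime : ℕ∞)), treeStart_some hσ,
        dagStart_some hσ, rfl, [], rfl⟩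

/-! ### The running time -/

theorem MAB.n_le_size (M : MAB) : M.n ≤ M.size := by
  have : ∑ _i : Fin M.n, 1 ≤ M.size :=
    Finset.sum_le_sum fun i _ => Fintype.card_pos_iff.2 ⟨M.root i⟩
  simpa using this

theorem MAB.card_le_size (M : MAB) (i : Fin M.n) : Fintype.card (M.S i) ≤ M.size :=
  Finset.single_le_sum (f := fun i => Fintype.card (M.S i)) (fun _ _ => Nat.zero_le _)
    (Finset.mem_univ i)

/-- At most `n * (B + 1) ≤ 2 * N ^ 2` plays are made, at most `24 * N ^ 2` steps each. With the
sampling and the first selection this is at most `(48 + 2 + 19) * N ^ 8`. -/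
theorem implicitPlayCost_le (hDs : ∀ i j, M.IsForwardDag B i ((Ds i).get j)) {N : ℕ}
    (hB : B ≤ N) (hn : M.n ≤ N) (hN : 1 ≤ N) (hlen : ∀ i, (Ds i).length ≤ N ^ 2)
    (σ : Choice M Ds) (k : ℕ) : implicitPlayCost M depth Ds σ k ≤ 69 * N ^ 8 := by
  have p2 : N ^ 2 ≤ N ^ 8 := Nat.pow_le_pow_right hN (by norm_num)
  have p3 : N ^ 3 ≤ N ^ 8 := Nat.pow_le_pow_right hN (by norm_num)
  have p4 : N ^ 4 ≤ N ^ 8 := Nat.pow_le_pow_right hN (by norm_num)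
  have p0 : 1 ≤ N ^ 2 := Nat.one_le_pow _ _ hN
  have hsched : (M.n + 1) * (M.n * 3 + 2) ≤ 10 * N ^ 2 :=
    calc _ ≤ (2 * N) * (5 * N) := Nat.mul_le_mul (by omega) (by omega)
      _ = _ := by ring
  let Q := implicitPlay M depth Ds
  have hval : (launch M Ds Q (dagStart M Ds σ)).val = (Q.settle ⟨dagStart M Ds σ, none⟩).val := rfl
  have h1 : (launch M Ds Q (dagStart M Ds σ)).cost ≤ 2 * N ^ 3 + 19 * N ^ 2 := by
    have h2 := Q.cost_settle_le ⟨dagStart M Ds σ, none⟩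
    have h3 := Timed.cost_forM_le (fun i => tick ((Ds i).length + 1)) (2 * N ^ 2)
      (List.finRange M.n) fun i _ => by
        rw [Timed.cost_tick]
        have := hlen i
        omega
    rw [List.length_finRange] at h3
    have h4 : M.n * (2 * N ^ 2) ≤ 2 * N ^ 3 :=
      calc _ ≤ N * (2 * N ^ 2) := Nat.mul_le_mul_right _ hn
        _ = _ := by ring
    have h5 : (launch M Ds Q (dagStart M Ds σ)).cost = ((List.finRange M.n).forM fun i =>
      tick ((Ds i).length + 1)).cost + (Q.settle ⟨dagStart M Ds σ, none⟩).cost := rfl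
    rw [h5]
    calc _ ≤ 2 * N ^ 3 + (9 + (M.n + 1) * (M.n * 3 + 2)) := Nat.add_le_add (h3.trans h4) h2
      _ ≤ _ := by omega
  -- The number of times from the current one to `B`. Every move goes strictly forward in time, so
  -- it decreases.
  let pot : ∀ i, Q.Node i → ℕ := fun i x => if x.2.2 = ⊤ then 0 else B + 1 - x.2.2.toNat
  have hstart : ∀ i P, dagStart M Ds σ i = some P → P.2.2 = ⊤ ∨ P.2.2 ≤ (B : ℕ∞) := by
    intro i P hP
    simp only [dagStart, Option.map_eq_some_iff] at hP
    obtain ⟨j, -, rfl⟩ := hP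
    right
    exact Nat.cast_le.2 (Finset.mem_Icc.1 (hDs i j).rootTime_mem).2
  have hdrop : ∃ c, (Q.settle ⟨dagStart M Ds σ, none⟩).val = c ∧
      Scheduler.DropTop (Q := Q) (dagStart M Ds σ) c.curr ∧ Scheduler.Selected c := by
    rcases Scheduler.settle_spec (Q := Q) ⟨dagStart M Ds σ, none⟩ with ⟨b, P, h, -⟩ | ⟨-, h⟩
    · cases h
    · exact ⟨_, rfl, h⟩
  obtain ⟨c, hc, hd, hsel⟩ := hdrop
  have h5 : Q.agent.worstCost k c M.start ≤ Scheduler.totalPot pot c.curr * (24 * N ^ 2) := by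
    refine Scheduler.worstCost_le
      (fun i (x : Fin (Ds i).length × M.S i × ℕ∞) => x.2.2 = ⊤ ∨ x.2.2 ≤ (B : ℕ∞)) pot ?_ ?_ _
      (fun c i o => (Nat.add_le_add_right (Q.cost_update_le c i o) 1).trans (by omega)) k c
      M.start ?_ ?_
    · rintro i ⟨j, u, t⟩ v hg hfin
      have hfin : t ≠ ⊤ := hfin
      obtain ⟨t, rfl⟩ := ENat.ne_top_iff_exists.1 hfin
      have ht : t ≤ B := by
        rcases hg with h | h
        · exact absurd h hfin
        · have h' : (t : ℕ∞) ≤ (B : ℕ∞) := h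
          exact_mod_cast h'
      have e : (Q.child i (j, u, (t : ℕ∞)) v) = (j, v, ((Ds i).get j).next u t v) := by
        simp only [Q, implicitPlay, StratDag.step_natCast]
      rw [e]
      have h6 := (hDs i j).next_gt' u v t
      have h7 := (hDs i j).next_le u v t
      refine ⟨h7, ?_⟩
      simp only [pot, ENat.natCast_ne_top, if_false, ENat.toNat_natCast]
      split_ifs with h8
      · omega
      · obtain ⟨t', ht'⟩ := ENat.ne_top_iff_exists.1 h8
        rw [← ht'] at h6 ⊢
        have : t + 1 ≤ t' := by exact_mod_cast h6
        rw [ENat.toNat_natCast]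
        omega
    · intro i P τ h
      simp only [Q, implicitPlay, decide_eq_true_eq] at h
      exact h.1
    · intro i P hP
      rcases hd i with h | ⟨h, -⟩
      · exact hstart i P (h ▸ hP)
      · rw [h] at hP
        cases hP
    · intro b hb
      simp only [Scheduler.Selected, hb] at hsel
      obtain ⟨P, h6, h7⟩ := hsel.2.1
      exact ⟨P, h6, h7 ▸ hsel.1⟩
  have h6 : Scheduler.totalPot pot c.curr ≤ 2 * N ^ 2 := by
    refine (Finset.sum_le_mul_of_le _ _ (B + 1) fun i _ => ?_).trans ?_
    · cases c.curr i with
      | none => simp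
      | some x =>
        simp only [Option.elim_some, pot]
        split_ifs <;> omega
    · rw [Finset.card_univ, Fintype.card_fin]
      calc _ ≤ N * (2 * N) := Nat.mul_le_mul hn (by omega)
        _ = _ := by ring
  have h7 : Q.agent.worstCost k c M.start ≤ 48 * N ^ 4 := h5.trans <|
    calc _ ≤ (2 * N ^ 2) * (24 * N ^ 2) := Nat.mul_le_mul_right _ h6
      _ = _ := by ring
  unfold implicitPlayCost
  change (launch M Ds Q (dagStart M Ds σ)).cost +
    Q.agent.worstCost k (launch M Ds Q (dagStart M Ds σ)).val M.start ≤ _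
  rw [hval, hc]
  omega

theorem total_cost_le {L : MAB} {depth : ∀ i, L.S i → ℕ} (hL : L.IsLayered depth) {z w}
    (h : L.IsFeasible B z w) {Ds : ∀ i, List (StratDag (L.S i))}
    (hDs : ∀ i, Ds i = (stratDags L B i (depth i) (z i)).val) (σ : Choice L Ds) (k : ℕ) :
    ∑ i, (stratDags L B i (depth i) (z i)).cost + implicitPlayCost L depth Ds σ k ≤
      102 * (B + L.size + 1) ^ 8 := by
  have hn := L.n_le_size
  have hS := L.card_le_size
  have hcost := fun i => cost_stratDags_le (M := L) (B := B) (i := i) (depth := depth i)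
    (N := B + L.size + 1) (by omega) (by have := hS i; omega) (by omega) (z i)
  have h1 : ∑ i, (stratDags L B i (depth i) (z i)).cost ≤ 33 * (B + L.size + 1) ^ 8 := by
    refine (Finset.sum_le_mul_of_le _ _ _ fun i _ => (hcost i).1).trans ?_
    rw [Finset.card_univ, Fintype.card_fin]
    calc _ ≤ (B + L.size + 1) * (33 * (B + L.size + 1) ^ 7) :=
          Nat.mul_le_mul_right _ (by omega)
      _ = _ := by ring
  have h2 := implicitPlayCost_le (M := L) (B := B) (depth := depth) (Ds := Ds)
    (fun i j => (stratDags_spec hL h i).1 _ (hDs i ▸ List.get_mem _ _))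
    (N := B + L.size + 1) (by omega) (by omega) (by omega)
    (fun i => by rw [hDs i]; exact (hcost i).2) σ k
  omega

end Implicit

/-! ### Sums over subtrees -/

section SubtreeSum

variable {M : MAB} {B : ℕ} {i : Fin M.n} {D : StratDag (M.S i)}

/-- The expectation of the sum of `g` over the first `m` tree nodes of finite time that are visited
from a given tree node on. -/
noncomputable def treeVal (D : StratDag (M.S i)) (g : TreeNode (M.S i) → ℝ) :
    ℕ → TreeNode (M.S i) → ℝ
  | 0, _ => 0
  | _ + 1, [] => 0
  | m + 1, (u, t) :: R => if t = ⊤ then 0 else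
      g ((u, t) :: R) + ∑ v, M.p i u v * treeVal D g m (D.child ((u, t) :: R) v)

/-- The expectation of the sum of `g` over all tree nodes of finite time that are visited from a
given tree node on. -/
noncomputable def subtreeSum (B : ℕ) (D : StratDag (M.S i)) (g : TreeNode (M.S i) → ℝ)
    (P : TreeNode (M.S i)) : ℝ := treeVal D g (B + 1) P

theorem MAB.IsForwardDag.add_one_le_step' (hD : M.IsForwardDag B i D) (u v : M.S i) (t : ℕ∞) :
    t + 1 ≤ D.step u t v := by
  induction t using ENat.recTopCoe with
  | top => simp [StratDag.step]
  | coe t => rw [D.step_natCast]; exact hD.next_gt' u v t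

theorem treeVal_top (g : TreeNode (M.S i) → ℝ) (m : ℕ) (u : M.S i) (R : TreeNode (M.S i)) :
    treeVal D g m ((u, ⊤) :: R) = 0 := by
  cases m <;> simp [treeVal]

/-- Times grow by at least one per step and are `⊤` beyond `B`, so once `t + m > B` a further level
of the tree adds nothing. Therefore the sum over `B + 1` levels satisfies the recursion of the full
sum. -/
theorem treeVal_succ_eq (hD : M.IsForwardDag B i D) (g : TreeNode (M.S i) → ℝ) (m : ℕ)
    (u : M.S i) (t : ℕ∞) (R : TreeNode (M.S i)) (ht : t = ⊤ ∨ t ≤ B) (hm : (B : ℕ∞) < t + m) :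
    treeVal D g (m + 1) ((u, t) :: R) = treeVal D g m ((u, t) :: R) := by
  induction m generalizing u t R with
  | zero =>
    rcases ht with rfl | ht
    · simp [treeVal_top]
    · exact absurd hm (by simpa using ht)
  | succ m ih =>
    by_cases hfin : t = ⊤
    · subst hfin
      simp [treeVal_top]
    · rw [treeVal, treeVal, if_neg hfin, if_neg hfin]
      congr 1
      refine Finset.sum_congr rfl fun v _ => ?_
      congr 1
      refine ih _ _ _ (hD.step_le u v t) (hm.trans_le ?_)
      rw [Nat.cast_succ, add_comm (m : ℕ∞), ← add_assoc]
      exact add_le_add_left (hD.add_one_le_step' u v t) _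

theorem subtreeSum_top (g : TreeNode (M.S i) → ℝ) (u : M.S i) (R : TreeNode (M.S i)) :
    subtreeSum B D g ((u, ⊤) :: R) = 0 := treeVal_top g _ u R

theorem subtreeSum_cons (hD : M.IsForwardDag B i D) (g : TreeNode (M.S i) → ℝ) (u : M.S i)
    {t : ℕ∞} (R : TreeNode (M.S i)) (hfin : t ≠ ⊤) (ht : t ≤ B) :
    subtreeSum B D g ((u, t) :: R) =
      g ((u, t) :: R) + ∑ v, M.p i u v * subtreeSum B D g (D.child ((u, t) :: R) v) := by
  unfold subtreeSum
  rw [← treeVal_succ_eq hD g _ u t R (Or.inr ht), treeVal, if_neg hfin]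
  have : (B : ℕ∞) < ((B + 1 : ℕ) : ℕ∞) := by exact_mod_cast Nat.lt_succ_self B
  exact this.trans_le le_add_self

theorem IsTreeNode.subtreeSum_eq (hD : M.IsForwardDag B i D) (g : TreeNode (M.S i) → ℝ)
    {u : M.S i} {t : ℕ∞} {R : TreeNode (M.S i)} (h : M.IsNode i D ((u, t) :: R)) (hfin : t ≠ ⊤) :
    subtreeSum B D g ((u, t) :: R) =
      g ((u, t) :: R) + ∑ v, M.p i u v * subtreeSum B D g (D.child ((u, t) :: R) v) :=
  subtreeSum_cons hD g u R hfin ((h.time_le hD.toIsStratDag).resolve_left hfin)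

/-- Induction from the leaves of the blown-up tree to its root. -/
theorem IsTreeNode.backward_induction (hD : M.IsStratDag B i D)
    {C : TreeNode (M.S i) → Prop}
    (htop : ∀ u R, M.IsNode i D ((u, ⊤) :: R) → C ((u, ⊤) :: R))
    (hfin : ∀ u t R, M.IsNode i D ((u, t) :: R) → t ≠ ⊤ →
      (∀ v, 0 < M.p i u v → M.IsNode i D (D.child ((u, t) :: R) v) ∧
        C (D.child ((u, t) :: R) v)) → C ((u, t) :: R))
    {P : TreeNode (M.S i)} (h : M.IsNode i D P) : C P := by
  obtain ⟨m, hm⟩ : ∃ m, m + P.length = B + 1 := ⟨B + 1 - P.length, by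
    have := h.length_le hD
    omega⟩
  induction m generalizing P with
  | zero =>
    rcases P with _ | ⟨⟨u, t⟩, R⟩
    · exact absurd rfl h.ne_nil
    · have h1 := h.length_le_time hD
      rcases h.time_le hD with h2 | h2
      · obtain rfl : t = ⊤ := h2
        exact htop u R h
      · have h3 : ((((u, t) :: R).length : ℕ) : ℕ∞) ≤ B := h1.trans h2
        have : ((u, t) :: R).length ≤ B := by exact_mod_cast h3
        omega
  | succ m ih =>
    rcases P with _ | ⟨⟨u, t⟩, R⟩
    · exact absurd rfl h.ne_nil
    · by_cases ht : t = ⊤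
      · subst ht
        exact htop u R h
      · refine hfin u t R h ht fun v hv => ?_
        have h1 : M.IsNode i D (D.child ((u, t) :: R) v) := .child u t R v h ht hv
        refine ⟨h1, ih h1 ?_⟩
        simp only [StratDag.child, List.length_cons] at hm ⊢
        omega

theorem StratDag.suffix_child (D : StratDag (M.S i)) (P : TreeNode (M.S i)) (v : M.S i) :
    P <:+ D.child P v := by
  rcases P with _ | ⟨⟨u, t⟩, R⟩
  · exact List.suffix_rfl
  · exact List.suffix_cons _ _

theorem subtreeSum_le_subtreeSum (hD : M.IsForwardDag B i D) {g g' : TreeNode (M.S i) → ℝ}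
    {P : TreeNode (M.S i)} (hP : M.IsNode i D P)
    (h : ∀ Q, M.IsNode i D Q → P <:+ Q → treeTime Q ≠ ⊤ → g Q ≤ g' Q) :
    subtreeSum B D g P ≤ subtreeSum B D g' P := by
  refine IsTreeNode.backward_induction hD.toIsStratDag (C := fun P =>
    (∀ Q, M.IsNode i D Q → P <:+ Q → treeTime Q ≠ ⊤ → g Q ≤ g' Q) →
      subtreeSum B D g P ≤ subtreeSum B D g' P) ?_ ?_ hP h
  · intro u R _ _
    rw [subtreeSum_top, subtreeSum_top]
  · intro u t R hP hfin ih h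
    rw [hP.subtreeSum_eq hD _ hfin, hP.subtreeSum_eq hD _ hfin]
    refine add_le_add (h _ hP List.suffix_rfl hfin) (Finset.sum_le_sum fun v _ => ?_)
    rcases (M.p_nonneg i u v).eq_or_lt with h0 | h0
    · simp [← h0]
    · exact mul_le_mul_of_nonneg_left ((ih v h0).2 fun Q hQ hs =>
        h Q hQ ((D.suffix_child _ v).trans hs)) h0.le

theorem subtreeSum_congr (hD : M.IsForwardDag B i D) {g g' : TreeNode (M.S i) → ℝ}
    {P : TreeNode (M.S i)} (hP : M.IsNode i D P)
    (h : ∀ Q, M.IsNode i D Q → P <:+ Q → treeTime Q ≠ ⊤ → g Q = g' Q) :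
    subtreeSum B D g P = subtreeSum B D g' P :=
  le_antisymm (subtreeSum_le_subtreeSum hD hP fun Q h1 h2 h3 => (h Q h1 h2 h3).le)
    (subtreeSum_le_subtreeSum hD hP fun Q h1 h2 h3 => (h Q h1 h2 h3).ge)

theorem subtreeSum_zero (P : TreeNode (M.S i)) : subtreeSum B D (fun _ => 0) P = 0 := by
  unfold subtreeSum
  generalize B + 1 = m
  induction m generalizing P with
  | zero => rfl
  | succ m ih =>
    rcases P with _ | ⟨⟨u, t⟩, R⟩
    · rfl
    · simp [treeVal, ih]

theorem subtreeSum_add (g g' : TreeNode (M.S i) → ℝ) (P : TreeNode (M.S i)) :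
    subtreeSum B D (fun Q => g Q + g' Q) P = subtreeSum B D g P + subtreeSum B D g' P := by
  unfold subtreeSum
  generalize B + 1 = m
  induction m generalizing P with
  | zero => simp [treeVal]
  | succ m ih =>
    rcases P with _ | ⟨⟨u, t⟩, R⟩
    · simp [treeVal]
    · simp only [treeVal, ih, mul_add, Finset.sum_add_distrib]
      split_ifs
      · simp
      · ring

theorem subtreeSum_const_mul (a : ℝ) (g : TreeNode (M.S i) → ℝ) (P : TreeNode (M.S i)) :
    subtreeSum B D (fun Q => a * g Q) P = a * subtreeSum B D g P := by
  unfold subtreeSum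
  generalize B + 1 = m
  induction m generalizing P with
  | zero => simp [treeVal]
  | succ m ih =>
    rcases P with _ | ⟨⟨u, t⟩, R⟩
    · simp [treeVal]
    · simp only [treeVal, ih, mul_add, Finset.mul_sum, mul_ite, mul_zero]
      split_ifs
      · rfl
      · congr 1
        exact Finset.sum_congr rfl fun v _ => by ring

theorem subtreeSum_sum {ι : Type*} (I : Finset ι) (g : ι → TreeNode (M.S i) → ℝ)
    (P : TreeNode (M.S i)) :
    subtreeSum B D (fun Q => ∑ x ∈ I, g x Q) P = ∑ x ∈ I, subtreeSum B D (g x) P := by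
  classical
  induction I using Finset.induction_on with
  | empty => simp [subtreeSum_zero]
  | insert x I hx ih =>
    simp only [Finset.sum_insert hx]
    rw [subtreeSum_add, ih]

theorem subtreeSum_nonneg (hD : M.IsForwardDag B i D) {g : TreeNode (M.S i) → ℝ}
    {P : TreeNode (M.S i)} (hP : M.IsNode i D P) (h : ∀ Q, 0 ≤ g Q) :
    0 ≤ subtreeSum B D g P := by
  rw [← subtreeSum_zero (B := B) (D := D) P]
  exact subtreeSum_le_subtreeSum hD hP fun Q _ _ _ => h Q

theorem subtreeSum_eq_zero (hD : M.IsForwardDag B i D) {g : TreeNode (M.S i) → ℝ}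
    {P : TreeNode (M.S i)} (hP : M.IsNode i D P)
    (h : ∀ Q, M.IsNode i D Q → P <:+ Q → treeTime Q ≠ ⊤ → g Q = 0) :
    subtreeSum B D g P = 0 := by
  rw [← subtreeSum_zero (B := B) (D := D) P]
  exact subtreeSum_congr hD hP h

/-- A function of the last node of a path. -/
def onLast (b : M.S i → ℕ → ℝ) : TreeNode (M.S i) → ℝ
  | [] => 0
  | (u, t) :: _ => b u t.toNat

/-- Weights that see only the last node ignore the earlier path, so that the sum over a subtree
becomes a function of a node of the dag. -/
theorem subtreeSum_onLast_cons (b : M.S i → ℕ → ℝ) (x : M.S i × ℕ∞) (R R' : TreeNode (M.S i)) :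
    subtreeSum B D (onLast b) (x :: R) = subtreeSum B D (onLast b) (x :: R') := by
  unfold subtreeSum
  generalize B + 1 = m
  induction m generalizing x R R' with
  | zero => rfl
  | succ m ih =>
    obtain ⟨u, t⟩ := x
    simp only [treeVal, onLast, StratDag.child]
    simp only [ih _ _ []]

/-- The expected total over the tree is the total over the dag. -/
theorem prob_mul_subtreeSum_root (hD : M.IsForwardDag B i D)
    (hroot : ∀ u, M.p i u (M.root i) = 0) (b : M.S i → ℕ → ℝ) :
    D.prob (M.root i) D.rootTime * subtreeSum B D (onLast b) (D.treeRoot (M.root i)) =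
      ∑ u, ∑ t ∈ Icc 1 B, b u t * D.prob u t := by
  classical
  -- The expected total from a node of the dag on; summation by parts of `φ` against the flow
  -- `D.prob` gives the claim.
  set φ : M.S i → ℕ∞ → ℝ := fun u t => subtreeSum B D (onLast b) [(u, t)] with hφ
  have hφtop : ∀ u, φ u ⊤ = 0 := fun u => subtreeSum_top _ u []
  have hstep : ∀ u, ∀ t ∈ Icc 1 B,
      φ u t = b u t + ∑ v, M.p i u v * φ v (D.next u t v) := by
    intro u t ht
    have htB : (t : ℕ∞) ≤ B := by exact_mod_cast (Finset.mem_Icc.1 ht).2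
    simp only [hφ]
    rw [subtreeSum_cons hD (onLast b) u [] (ENat.natCast_ne_top t) htB]
    simp only [StratDag.child, onLast, ENat.toNat_natCast, StratDag.step_natCast]
    congr 1
    refine Finset.sum_congr rfl fun v _ => ?_
    rw [subtreeSum_onLast_cons b _ _ []]
  -- After exchanging the sums, `prob_eq` collects the inflow of every node; the root receives none.
  have hflow : ∑ u, ∑ t ∈ Icc 1 B, D.prob u t * ∑ v, M.p i u v * φ v (D.next u t v) =
      ∑ v ∈ univ.erase (M.root i), ∑ t ∈ Icc 1 B, φ v t * D.prob v t := by
    have h1 : ∀ u, ∀ t ∈ Icc 1 B, ∀ v, φ v (D.next u t v) =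
        ∑ t' ∈ Icc 1 B, if D.next u t v = t' then φ v t' else 0 := by
      intro u t ht v
      rcases hD.next_le u v t with h2 | h2
      · rw [h2, hφtop]
        simp
      · have hne : D.next u t v ≠ ⊤ := ne_top_of_le_ne_top (ENat.natCast_ne_top B) h2
        obtain ⟨t', ht'⟩ := ENat.ne_top_iff_exists.1 hne
        have h3 := hD.next_gt' u v t
        rw [← ht'] at h2 h3 ⊢
        have h4 : t' ≤ B := by exact_mod_cast h2
        have h5 : t + 1 ≤ t' := by exact_mod_cast h3
        simp [h4, show 1 ≤ t' by omega]
    calc _ = ∑ u, ∑ t ∈ Icc 1 B, ∑ v, ∑ t' ∈ Icc 1 B,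
          φ v t' * (if D.next u t v = t' then D.prob u t * M.p i u v else 0) := by
          refine Finset.sum_congr rfl fun u _ => Finset.sum_congr rfl fun t ht => ?_
          rw [Finset.mul_sum]
          refine Finset.sum_congr rfl fun v _ => ?_
          rw [h1 u t ht v, Finset.mul_sum, Finset.mul_sum]
          refine Finset.sum_congr rfl fun t' _ => ?_
          split_ifs
          · ring
          · ring
      _ = ∑ v, ∑ t' ∈ Icc 1 B, φ v t' *
          ∑ u, ∑ t ∈ Icc 1 B, (if D.next u t v = t' then D.prob u t * M.p i u v else 0) := by
          simp only [Finset.mul_sum]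
          calc _ = ∑ u, ∑ v, ∑ t ∈ Icc 1 B, ∑ t' ∈ Icc 1 B,
                φ v t' * (if D.next u t v = t' then D.prob u t * M.p i u v else 0) :=
                Finset.sum_congr rfl fun u _ => Finset.sum_comm
            _ = ∑ v, ∑ u, ∑ t ∈ Icc 1 B, ∑ t' ∈ Icc 1 B,
                φ v t' * (if D.next u t v = t' then D.prob u t * M.p i u v else 0) :=
                Finset.sum_comm
            _ = ∑ v, ∑ u, ∑ t' ∈ Icc 1 B, ∑ t ∈ Icc 1 B,
                φ v t' * (if D.next u t v = t' then D.prob u t * M.p i u v else 0) :=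
                Finset.sum_congr rfl fun v _ => Finset.sum_congr rfl fun u _ => Finset.sum_comm
            _ = _ := Finset.sum_congr rfl fun v _ => Finset.sum_comm
      _ = _ := by
          rw [← Finset.add_sum_erase _ _ (Finset.mem_univ (M.root i))]
          have h2 : ∑ t' ∈ Icc 1 B, φ (M.root i) t' * ∑ u, ∑ t ∈ Icc 1 B,
              (if D.next u t (M.root i) = t' then D.prob u t * M.p i u (M.root i) else 0) = 0 := by
            simp [hroot]
          rw [h2, zero_add]
          refine Finset.sum_congr rfl fun v hv => Finset.sum_congr rfl fun t ht => ?_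
          rw [hD.prob_eq v (Finset.ne_of_mem_erase hv) t ht]
  -- By the recursion for `φ`, its total against the flow exceeds the total of `b` by the quantity
  -- in `hflow`. What is left after cancellation is the root at its only time.
  have hall : ∑ u, ∑ t ∈ Icc 1 B, b u t * D.prob u t =
      ∑ u, ∑ t ∈ Icc 1 B, φ u t * D.prob u t -
        ∑ u, ∑ t ∈ Icc 1 B, D.prob u t * ∑ v, M.p i u v * φ v (D.next u t v) := by
    rw [← Finset.sum_sub_distrib]
    refine Finset.sum_congr rfl fun u _ => ?_
    rw [← Finset.sum_sub_distrib]
    refine Finset.sum_congr rfl fun t ht => ?_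
    rw [hstep u t ht]
    ring
  rw [hall, hflow, ← Finset.add_sum_erase _ _ (Finset.mem_univ (M.root i)), add_sub_cancel_right,
    Finset.sum_eq_single_of_mem _ hD.rootTime_mem
      (fun t ht hne => by rw [hD.prob_root t ht hne, mul_zero])]
  simp only [hφ, StratDag.treeRoot]
  ring

end SubtreeSum

/-! ### The mass of a time after gap filling -/

section Mass

variable {M : MAB} {B : ℕ} {i : Fin M.n} {depth : M.S i → ℕ} {D : StratDag (M.S i)}
  {time : TreeNode (M.S i) → ℕ∞}

theorem IsTreeNode.of_suffix {P Q : TreeNode (M.S i)} (hP : M.IsNode i D P) (hQ : Q ≠ [])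
    (hs : Q <:+ P) : M.IsNode i D Q := by
  induction hP with
  | root =>
    rcases List.suffix_cons_iff.1 hs with rfl | h
    · exact .root
    · exact absurd (List.suffix_nil.1 h) hQ
  | child u t R v h1 h2 h3 ih =>
    rcases List.suffix_cons_iff.1 hs with rfl | h
    · exact .child u t R v h1 h2 h3
    · exact ih h

/-- Times increase by at least one along every arc. -/
theorem GapInv.time_add_length_le (hI : GapInv M i depth D time) {P Q : TreeNode (M.S i)}
    (hP : M.IsNode i D P) (hQ : Q ≠ []) (hs : Q <:+ P) :
    time Q + P.length ≤ time P + Q.length := by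
  induction hP with
  | root =>
    rcases List.suffix_cons_iff.1 hs with rfl | h
    · exact le_rfl
    · exact absurd (List.suffix_nil.1 h) hQ
  | child u t R v h1 h2 h3 ih =>
    rcases List.suffix_cons_iff.1 hs with rfl | h
    · exact le_rfl
    · have h4 := hI.incr _ _ _ (.child u t R v h1 h2 h3)
      calc time Q + (((v, D.step u t v) :: (u, t) :: R).length : ℕ∞)
          = time Q + (((u, t) :: R).length : ℕ∞) + 1 := by
            rw [List.length_cons, Nat.cast_succ, add_assoc]
        _ ≤ time ((u, t) :: R) + Q.length + 1 := add_le_add_left (ih h) 1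
        _ = time ((u, t) :: R) + 1 + Q.length := add_right_comm _ _ _
        _ ≤ _ := add_le_add_left h4 _

theorem GapInv.time_mono (hI : GapInv M i depth D time) {P Q : TreeNode (M.S i)}
    (hP : M.IsNode i D P) (hQ : Q ≠ []) (hs : Q <:+ P) : time Q ≤ time P := by
  have h1 := hI.time_add_length_le hP hQ hs
  have h2 : (Q.length : ℕ∞) ≤ P.length := by exact_mod_cast hs.length_le
  have h3 : time Q + Q.length ≤ time P + Q.length := (add_le_add_right h2 _).trans h1
  exact (ENat.add_le_add_iff_right (ENat.natCast_ne_top _)).1 h3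

theorem GapInv.ne_top (hI : GapInv M i depth D time) {P : TreeNode (M.S i)}
    (hP : M.IsNode i D P) (h : treeTime P ≠ ⊤) : time P ≠ ⊤ :=
  fun hc => h (hI.top P hP hc)

/-- The nodes at one time are visited at most once. -/
theorem GapInv.subtreeSum_le (hD : M.IsForwardDag B i D) (hI : GapInv M i depth D time) (t : ℕ∞)
    {ρ : ℝ} (hρ : 0 ≤ ρ) {g : TreeNode (M.S i) → ℝ} {P : TreeNode (M.S i)} (hP : M.IsNode i D P)
    (hg : ∀ Q, M.IsNode i D Q → P <:+ Q → g Q ≤ if time Q = t then ρ else 0) :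
    subtreeSum B D g P ≤ ρ := by
  refine IsTreeNode.backward_induction hD.toIsStratDag (C := fun P =>
    (∀ Q, M.IsNode i D Q → P <:+ Q → g Q ≤ if time Q = t then ρ else 0) →
      subtreeSum B D g P ≤ ρ) ?_ ?_ hP hg
  · intro u R _ _
    rwa [subtreeSum_top]
  · intro u s R hP hfin ih hg
    rw [hP.subtreeSum_eq hD _ hfin]
    have h0 := hg _ hP List.suffix_rfl
    split_ifs at h0 with ht
    -- Below a node at time `t` all times are larger, so nothing more is collected there.
    · suffices h : ∑ v, M.p i u v * subtreeSum B D g (D.child ((u, s) :: R) v) ≤ 0 by linarith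
      refine Finset.sum_nonpos fun v _ => ?_
      rcases (M.p_nonneg i u v).eq_or_lt with hp | hp
      · simp [← hp]
      · refine mul_nonpos_of_nonneg_of_nonpos hp.le ?_
        have hc := (ih v hp).1
        rw [← subtreeSum_zero (B := B) (D := D) (D.child ((u, s) :: R) v)]
        refine subtreeSum_le_subtreeSum hD hc fun Q hQ hs hQfin => ?_
        have h1 := hg Q hQ ((D.suffix_child _ v).trans hs)
        rwa [if_neg] at h1
        intro he
        have h2 := (hI.incr _ _ _ hc).trans (hI.time_mono hQ hc.ne_nil hs)
        rw [ht, he] at h2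
        have : t ≠ ⊤ := ht ▸ hI.ne_top hP hfin
        exact absurd h2 (not_le.2 (ENat.lt_add_one_iff this |>.2 le_rfl))
    · calc _ ≤ 0 + ∑ v, M.p i u v * ρ := by
            refine add_le_add h0 (Finset.sum_le_sum fun v _ => ?_)
            rcases (M.p_nonneg i u v).eq_or_lt with hp | hp
            · simp [← hp]
            · exact mul_le_mul_of_nonneg_left ((ih v hp).2 fun Q hQ hs =>
                hg Q hQ ((D.suffix_child _ v).trans hs)) hp.le
        _ ≤ ρ := by
            rw [zero_add, ← Finset.sum_mul]
            exact mul_le_of_le_one_left hρ (M.sum_p_le_one u)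

open Classical in
/-- Whether a play at the time `t` is due to gap filling. -/
noncomputable def movedTo (time : TreeNode (M.S i) → ℕ∞) (t : ℕ) (P : TreeNode (M.S i)) : ℝ :=
  if time P = t ∧ treeTime P ≠ t then 1 else 0

/-- A path to a node that was moved to the time `t` has about `t / 2` nodes with times less than
`2 * t` before gap filling. -/
theorem GapInv.subtreeSum_movedTo_le (hD : M.IsForwardDag B i D)
    (hdepth : ∀ u v, 0 < M.p i u v → depth v = depth u + 1) (hroot : depth (M.root i) = 0)
    (hI : GapInv M i depth D time) (t : ℕ) {P : TreeNode (M.S i)} (hP : M.IsNode i D P) :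
    (t / 2 : ℝ) * subtreeSum B D (movedTo time t) P ≤
      (P.length - 1 : ℝ) * subtreeSum B D (movedTo time t) P +
        subtreeSum B D (onLast fun _ t' => if t' < 2 * t then 1 else 0) P := by
  classical
  have hI0 : GapInv M i depth D treeTime := GapInv.init hD.toIsStratDag
  have hmoved0 : ∀ Q, 0 ≤ movedTo time t Q := fun Q => by unfold movedTo; split_ifs <;> norm_num
  have hsmall0 : ∀ Q : TreeNode (M.S i),
      0 ≤ onLast (fun _ t' => if t' < 2 * t then (1 : ℝ) else 0) Q := by
    intro Q
    rcases Q with _ | ⟨⟨u, s⟩, R⟩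
    · exact le_rfl
    · simp only [onLast]
      split_ifs <;> norm_num
  -- A moved node has its original time between `t` and twice its depth, and its depth is less than
  -- its new time `t`. So `t / 2 < depth < t`, and the original time is below `2 * t`.
  have hlow : ∀ Q, M.IsNode i D Q → time Q = t → treeTime Q ≠ t →
      (t : ℕ∞) < treeTime Q ∧ treeTime Q < ((2 * (Q.length - 1) : ℕ) : ℕ∞) ∧ Q.length ≤ t := by
    intro Q hQ h1 h2
    refine ⟨lt_of_le_of_ne (h1 ▸ hI.le Q hQ) (Ne.symm h2), ?_, ?_⟩
    · have h3 := (hI.moved Q hQ).resolve_left (fun h => h2 (h ▸ h1))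
      have h4 := hQ.depth_add_one hdepth hroot
      rwa [← h4, Nat.add_sub_cancel]
    · have h3 : D.treeRoot (M.root i) <:+ Q := by
        clear h1 h2
        induction hQ with
        | root => exact List.suffix_rfl
        | child u t R v h1 h2 h3 ih => exact ih.trans (List.suffix_cons _ _)
      have h4 := hI.time_add_length_le hQ IsTreeNode.root.ne_nil h3
      have h5 : (1 : ℕ∞) ≤ time (D.treeRoot (M.root i)) := by
        rw [hI.head _ .root rfl]
        simpa [StratDag.treeRoot] using IsTreeNode.root.length_le_time hD.toIsStratDag
      rw [h1] at h4
      have h6 : (1 : ℕ∞) + Q.length ≤ t + 1 := (add_le_add_left h5 _).trans h4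
      have : 1 + Q.length ≤ t + 1 := by exact_mod_cast h6
      omega
  -- The term with `P.length - 1` credits the ancestors of `P`, which all count as early if a moved
  -- node lies below. It vanishes at the root.
  refine IsTreeNode.backward_induction hD.toIsStratDag (C := fun P =>
    (t / 2 : ℝ) * subtreeSum B D (movedTo time t) P ≤
      (P.length - 1 : ℝ) * subtreeSum B D (movedTo time t) P +
        subtreeSum B D (onLast fun _ t' => if t' < 2 * t then 1 else 0) P) ?_ ?_ hP
  · intro u R _
    simp [subtreeSum_top]
  · intro u s R hP hfin ih
    have hle1 : subtreeSum B D (movedTo time t) ((u, s) :: R) ≤ 1 :=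
      hI.subtreeSum_le hD t zero_le_one hP fun Q _ _ => by
        unfold movedTo
        split_ifs with h1 h2
        · exact le_rfl
        · exact absurd h1.1 h2
        · exact zero_le_one
        · exact le_rfl
    have hnn := subtreeSum_nonneg hD hP hmoved0
    have hnn' := subtreeSum_nonneg hD hP hsmall0
    -- At a moved node the credit alone is enough: its depth exceeds `t / 2`.
    by_cases hA : time ((u, s) :: R) = t ∧ treeTime ((u, s) :: R) ≠ t
    · obtain ⟨h1, h2, -⟩ := hlow _ hP hA.1 hA.2
      have h3 : (t : ℕ∞) < ((2 * (((u, s) :: R).length - 1) : ℕ) : ℕ∞) := h1.trans h2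
      have h4 : t < 2 * (((u, s) :: R).length - 1) := by exact_mod_cast h3
      have h5 : (t : ℝ) ≤ 2 * ((((u, s) :: R).length : ℝ) - 1) := by
        rw [List.length_cons, Nat.add_sub_cancel] at h4
        rw [List.length_cons, Nat.cast_succ, add_sub_cancel_right]
        exact_mod_cast h4.le
      nlinarith
    · have h1 : movedTo time t ((u, s) :: R) = 0 := if_neg hA
      -- If `P` is not early, then no moved node lies below it; otherwise `P` counts one, and at
      -- most one moved node is visited below. This pays for increasing the length by one in the
      -- children.
      have h2 : subtreeSum B D (movedTo time t) ((u, s) :: R) ≤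
          onLast (fun _ t' => if t' < 2 * t then 1 else 0) ((u, s) :: R) := by
        obtain ⟨s, rfl⟩ := ENat.ne_top_iff_exists.1 hfin
        change _ ≤ if (s : ℕ∞).toNat < 2 * t then (1 : ℝ) else 0
        by_cases hs : (s : ℕ∞).toNat < 2 * t
        · rwa [if_pos hs]
        · rw [if_neg hs]
          refine (subtreeSum_eq_zero hD hP fun Q hQ hsuf _ => ?_).le
          refine if_neg fun hc => ?_
          obtain ⟨-, h3, h4⟩ := hlow Q hQ hc.1 hc.2
          have h5 : (s : ℕ∞) < ((2 * (Q.length - 1) : ℕ) : ℕ∞) :=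
            (hI0.time_mono hQ hP.ne_nil hsuf).trans_lt h3
          have h6 : s < 2 * (Q.length - 1) := by exact_mod_cast h5
          rw [ENat.toNat_natCast] at hs
          omega
      have h3 : ∑ v, M.p i u v * ((t / 2 : ℝ) *
            subtreeSum B D (movedTo time t) (D.child ((u, s) :: R) v)) ≤
          ∑ v, M.p i u v * ((((u, s) :: R).length : ℝ) *
              subtreeSum B D (movedTo time t) (D.child ((u, s) :: R) v) +
            subtreeSum B D (onLast fun _ t' => if t' < 2 * t then 1 else 0)
              (D.child ((u, s) :: R) v)) := by
        refine Finset.sum_le_sum fun v _ => ?_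
        rcases (M.p_nonneg i u v).eq_or_lt with hp | hp
        · simp [← hp]
        · refine mul_le_mul_of_nonneg_left ?_ hp.le
          have := (ih v hp).2
          rwa [StratDag.child, List.length_cons, Nat.cast_succ, add_sub_cancel_right] at this
      have h4 := hP.subtreeSum_eq hD (movedTo time t) hfin
      have h5 := hP.subtreeSum_eq hD (onLast fun _ t' => if t' < 2 * t then 1 else 0) hfin
      rw [h1, zero_add] at h4
      simp only [mul_add, Finset.sum_add_distrib, mul_left_comm _ (t / 2 : ℝ),
        mul_left_comm _ (((u, s) :: R).length : ℝ), ← Finset.mul_sum] at h3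
      rw [← h4] at h3
      linarith

/-- The probability of a play at the time `t` after gap filling. -/
theorem GapInv.subtreeSum_level_le (hD : M.IsForwardDag B i D)
    (hdepth : ∀ u v, 0 < M.p i u v → depth v = depth u + 1) (hroot : depth (M.root i) = 0)
    (hI : GapInv M i depth D time) {t : ℕ} (ht : 1 ≤ t) :
    subtreeSum B D (fun P => if time P = t then 1 else 0) (D.treeRoot (M.root i)) ≤
      subtreeSum B D (onLast fun _ t' => if t' = t then 1 else 0) (D.treeRoot (M.root i)) +
        2 / t * subtreeSum B D (onLast fun _ t' => if t' < 2 * t then 1 else 0)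
          (D.treeRoot (M.root i)) := by
  have h1 := hI.subtreeSum_movedTo_le hD hdepth hroot t .root
  have h2 : subtreeSum B D (fun P => if time P = t then 1 else 0) (D.treeRoot (M.root i)) ≤
      subtreeSum B D (onLast fun _ t' => if t' = t then 1 else 0) (D.treeRoot (M.root i)) +
        subtreeSum B D (movedTo time t) (D.treeRoot (M.root i)) := by
    rw [← subtreeSum_add]
    refine subtreeSum_le_subtreeSum hD .root fun Q hQ _ hfin => ?_
    rcases Q with _ | ⟨⟨u, s⟩, R⟩
    · exact absurd rfl hQ.ne_nil
    · obtain ⟨s, rfl⟩ := ENat.ne_top_iff_exists.1 hfin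
      simp only [onLast, movedTo, treeTime, ENat.toNat_natCast, Nat.cast_inj, ne_eq]
      by_cases hb : s = t
      · subst hb
        by_cases ha : time ((u, (s : ℕ∞)) :: R) = s <;> simp [ha]
      · by_cases ha : time ((u, (s : ℕ∞)) :: R) = t <;> simp [ha, hb]
  refine h2.trans (add_le_add_right ?_ _)
  have ht' : (0 : ℝ) < t := by exact_mod_cast ht
  simp only [StratDag.treeRoot, List.length_singleton, Nat.cast_one, sub_self, zero_mul,
    zero_add] at h1
  rw [div_mul_eq_mul_div, le_div_iff₀ ht']
  simp only [StratDag.treeRoot]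
  linarith

end Mass

/-! ### The mass of one time over all arms -/

section TotalMass

variable {L : MAB} {B : ℕ} {z w : ∀ i, L.S i → ℕ → ℝ} {Ds : ∀ i, List (StratDag (L.S i))}

theorem sum_prob_mul_subtreeSum (hDs : ∀ i j, L.IsForwardDag B i ((Ds i).get j))
    (hz : ∀ i u, ∀ t ∈ Icc 1 B, ((Ds i).map fun D => D.prob u t).sum = z i u t)
    (hroot : ∀ i u, L.p i u (L.root i) = 0) (b : ∀ i, L.S i → ℕ → ℝ) :
    ∑ i, ∑ j, ((Ds i).get j).prob (L.root i) ((Ds i).get j).rootTime *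
        subtreeSum B ((Ds i).get j) (onLast (b i)) (((Ds i).get j).treeRoot (L.root i)) =
      ∑ i, ∑ u, ∑ t ∈ Icc 1 B, b i u t * z i u t := by
  refine Finset.sum_congr rfl fun i _ => ?_
  rw [Finset.sum_congr rfl fun j _ => prob_mul_subtreeSum_root (hDs i j) (hroot i) (b i),
    Finset.sum_comm]
  refine Finset.sum_congr rfl fun u _ => ?_
  rw [Finset.sum_comm]
  refine Finset.sum_congr rfl fun t ht => ?_
  rw [← Finset.mul_sum, ← hz i u t ht, ← Fin.sum_univ_fun_getElem]
  rfl

theorem prob_root_nonneg (hDs : ∀ i j, L.IsForwardDag B i ((Ds i).get j)) (i : Fin L.n)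
    (j : Fin (Ds i).length) : 0 ≤ ((Ds i).get j).prob (L.root i) ((Ds i).get j).rootTime :=
  (hDs i j).prob_nonneg _ _ (hDs i j).rootTime_mem

/-- `5 = 1 + 4`: the linear program has mass at most `1` at time `t` and at most `2 * t` before time
`2 * t`, and the latter enters with the factor `2 / t` through `GapInv.subtreeSum_level_le`. -/
theorem sum_prob_mul_subtreeSum_level_le {depth : ∀ i, L.S i → ℕ} (hL : L.IsLayered depth)
    (h : L.IsFeasible B z w) (hDs : ∀ i j, L.IsForwardDag B i ((Ds i).get j))
    (hz : ∀ i u, ∀ t ∈ Icc 1 B, ((Ds i).map fun D => D.prob u t).sum = z i u t)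
    {time' : ∀ i, Fin (Ds i).length → TreeNode (L.S i) → ℕ∞}
    (hfill : ∀ i j, GapInv L i (depth i) ((Ds i).get j) (time' i j)) {t : ℕ} (ht : t ∈ Icc 1 B) :
    ∑ i, ∑ j, ((Ds i).get j).prob (L.root i) ((Ds i).get j).rootTime *
      subtreeSum B ((Ds i).get j) (fun P => if time' i j P = t then 1 else 0)
        (((Ds i).get j).treeRoot (L.root i)) ≤ 5 := by
  have hroot : ∀ i u, L.p i u (L.root i) = 0 := fun i u => hL.root_no_arc i u
  have ht1 := (Finset.mem_Icc.1 ht).1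
  have ht' : (0 : ℝ) < t := by exact_mod_cast ht1
  have hcap : ∀ I : Finset ℕ, I ⊆ Icc 1 B →
      ∑ i, ∑ u, ∑ t' ∈ Icc 1 B, (if t' ∈ I then 1 else 0) * z i u t' ≤ (I.card : ℝ) := by
    intro I hI
    calc _ = ∑ i, ∑ u, ∑ t' ∈ I, z i u t' := by
          refine Finset.sum_congr rfl fun i _ => Finset.sum_congr rfl fun u _ => ?_
          simp only [ite_mul, one_mul, zero_mul]
          rw [← Finset.sum_filter]
          congr 1
          ext t'
          simp only [Finset.mem_filter, and_iff_right_iff_imp]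
          exact fun h => hI h
      _ = ∑ t' ∈ I, ∑ i, ∑ u, z i u t' := by
          rw [Finset.sum_comm]
          refine Finset.sum_congr rfl fun i _ => Finset.sum_comm
      _ ≤ ∑ t' ∈ I, 1 := Finset.sum_le_sum fun t' ht' => h.cap t' (hI ht')
      _ = I.card := by simp
  calc _ ≤ ∑ i, ∑ j, ((Ds i).get j).prob (L.root i) ((Ds i).get j).rootTime *
        (subtreeSum B ((Ds i).get j) (onLast fun _ t' => if t' = t then 1 else 0)
            (((Ds i).get j).treeRoot (L.root i)) +
          2 / t * subtreeSum B ((Ds i).get j) (onLast fun _ t' => if t' < 2 * t then 1 else 0)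
            (((Ds i).get j).treeRoot (L.root i))) :=
        Finset.sum_le_sum fun i _ => Finset.sum_le_sum fun j _ => mul_le_mul_of_nonneg_left
          ((hfill i j).subtreeSum_level_le (hDs i j) (hL.depth_succ i) (hL.depth_root i) ht1)
          (prob_root_nonneg hDs i j)
    _ = ∑ i, ∑ u, ∑ t' ∈ Icc 1 B, (if t' = t then 1 else 0) * z i u t' +
        2 / t * ∑ i, ∑ u, ∑ t' ∈ Icc 1 B, (if t' < 2 * t then 1 else 0) * z i u t' := by
        rw [← sum_prob_mul_subtreeSum hDs hz hroot, ← sum_prob_mul_subtreeSum hDs hz hroot]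
        simp only [mul_add, Finset.sum_add_distrib, Finset.mul_sum]
        congr 1
        refine Finset.sum_congr rfl fun i _ => Finset.sum_congr rfl fun j _ => ?_
        ring
    _ ≤ 1 + 2 / t * (2 * t) := by
        refine add_le_add ?_ (mul_le_mul_of_nonneg_left ?_ (by positivity))
        · have := hcap {t} (by simpa using ht)
          simpa using this
        · have := hcap ((Icc 1 B).filter (· < 2 * t)) (Finset.filter_subset _ _)
          refine le_trans (le_of_eq ?_) (this.trans ?_)
          · refine Finset.sum_congr rfl fun i _ => Finset.sum_congr rfl fun u _ =>
              Finset.sum_congr rfl fun t' ht' => ?_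
            simp only [Finset.mem_filter, ht', true_and]
          · have : ((Icc 1 B).filter (· < 2 * t)).card ≤ (range (2 * t)).card :=
              Finset.card_le_card fun t' ht' => Finset.mem_range.2 (Finset.mem_filter.1 ht').2
            rw [Finset.card_range] at this
            exact_mod_cast this
    _ = 5 := by
        field_simp
        norm_num

end TotalMass

/-! ### The reward of the algorithm -/

section Core

variable {M : MAB} {B : ℕ} {depth : ∀ i, M.S i → ℕ} {Ds : ∀ i, List (StratDag (M.S i))}
  {time' : ∀ i, Fin (Ds i).length → TreeNode (M.S i) → ℕ∞}

/-- The sum over the subtree below the current node of an arm. -/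
noncomputable def currSum (B : ℕ) (Ds : ∀ i, List (StratDag (M.S i))) (i : Fin M.n)
    (g : Fin (Ds i).length → TreeNode (M.S i) → ℝ) :
    Option (Fin (Ds i).length × TreeNode (M.S i)) → ℝ
  | none => 0
  | some x => subtreeSum B ((Ds i).get x.1) (g x.1) x.2

theorem currSum_nonneg (hDs : ∀ i j, M.IsForwardDag B i ((Ds i).get j)) {i : Fin M.n}
    {g : Fin (Ds i).length → TreeNode (M.S i) → ℝ} (hg : ∀ j Q, 0 ≤ g j Q)
    {o : Option (Fin (Ds i).length × TreeNode (M.S i))}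
    (ho : ∀ x, o = some x → M.IsNode i ((Ds i).get x.1) x.2) : 0 ≤ currSum B Ds i g o := by
  rcases o with _ | x
  · exact le_rfl
  · exact subtreeSum_nonneg (hDs i x.1) (ho x rfl) (hg x.1)

/-- The node of an arm after a play at the tree node `P` of the `j`-th tree. -/
def treeMove (Ds : ∀ i, List (StratDag (M.S i))) {i : Fin M.n} (j : Fin (Ds i).length)
    (P : TreeNode (M.S i)) : Option (M.S i) → Option (Fin (Ds i).length × TreeNode (M.S i))
  | some v => some (j, ((Ds i).get j).child P v)
  | none => none

/-- The sum over the subtree is preserved in expectation. -/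
theorem currSum_some (hDs : ∀ i j, M.IsForwardDag B i ((Ds i).get j)) {i : Fin M.n}
    (g : Fin (Ds i).length → TreeNode (M.S i) → ℝ) {j : Fin (Ds i).length} {u : M.S i} {t : ℕ∞}
    {R : TreeNode (M.S i)} (h : M.IsNode i ((Ds i).get j) ((u, t) :: R)) (ht : t ≠ ⊤) :
    currSum B Ds i g (some (j, (u, t) :: R)) = g j ((u, t) :: R) +
      ∑ o, M.outcome i u o *
        currSum B Ds i g (treeMove Ds j ((u, t) :: R) o) := by
  rw [Fintype.sum_option]
  simp only [treeMove, currSum, mul_zero, zero_add]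
  exact h.subtreeSum_eq (hDs i j) (g j) ht

/-- The active arms are at tree nodes in their current states. -/
def NodesAt (Ds : ∀ i, List (StratDag (M.S i)))
    (curr : ∀ i, Option (Fin (Ds i).length × TreeNode (M.S i))) (s : ∀ i, Option (M.S i)) : Prop :=
  ∀ i x, curr i = some x → M.IsNode i ((Ds i).get x.1) x.2 ∧
    ∃ u t R, x.2 = (u, t) :: R ∧ s i = some u

/-- The invariant of the scheduling loop on the trees. -/
structure Running (time' : ∀ i, Fin (Ds i).length → TreeNode (M.S i) → ℕ∞)
    (c : (algDAG M Ds time').Config) (s : ∀ i, Option (M.S i)) : Prop where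
  nodesAt : NodesAt Ds c.curr s
  focus_none : c.focus = none → ∀ i, c.curr i = none
  focus_some : ∀ i τ, c.focus = some (i, τ) →
    ∃ x, c.curr i = some x ∧ time' i x.1 x.2 = τ ∧ τ ≠ ⊤

theorem NodesAt.drop {curr : ∀ i, Option (Fin (Ds i).length × TreeNode (M.S i))}
    {curr' : ∀ i, Option (Fin (Ds i).length × TreeNode (M.S i))} {s : ∀ i, Option (M.S i)}
    (h : NodesAt Ds curr s)
    (hd : Scheduler.DropTop (Q := algDAG M Ds time') curr curr') : NodesAt Ds curr' s := by
  intro i x hx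
  rcases hd i with h1 | ⟨h1, -⟩
  · exact h i x (h1 ▸ hx)
  · rw [h1] at hx
    cases hx

theorem Scheduler.Selected.running {c : (algDAG M Ds time').Config} {s : ∀ i, Option (M.S i)}
    (h : Scheduler.Selected c) (hN : NodesAt Ds c.curr s) : Running time' c s := by
  refine ⟨hN, fun hf => ?_, fun i τ hf => ?_⟩
  · simp only [Scheduler.Selected, hf] at h
    exact h
  · simp only [Scheduler.Selected, hf] at h
    obtain ⟨h1, ⟨x, h2, h3⟩, -⟩ := h
    exact ⟨x, h2, h3, h1⟩

/-- A node dropped at time `⊤` had the time `⊤` already before gap filling, so its subtree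
contributes nothing. Hence expectations change only through plays. -/
theorem currSum_drop (hfill : ∀ i j, GapInv M i (depth i) ((Ds i).get j) (time' i j))
    {curr : ∀ i, Option (Fin (Ds i).length × TreeNode (M.S i))}
    {curr' : ∀ i, Option (Fin (Ds i).length × TreeNode (M.S i))} {s : ∀ i, Option (M.S i)}
    (h : NodesAt Ds curr s)
    (hd : Scheduler.DropTop (Q := algDAG M Ds time') curr curr') (i : Fin M.n)
    (g : Fin (Ds i).length → TreeNode (M.S i) → ℝ) :
    currSum B Ds i g (curr' i) = currSum B Ds i g (curr i) := by
  rcases hd i with h1 | ⟨h1, ⟨j, P⟩, h2, h3⟩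
  · rw [h1]
  · obtain ⟨hN, u, t, R, h4, -⟩ := h i _ h2
    dsimp only at hN h4
    subst h4
    have h5 : t = ⊤ := (hfill i j).top _ hN h3
    subst h5
    rw [h1, h2]
    exact (subtreeSum_top _ u R).symm

/-- What the scheduling loop does after a play of arm `i`. -/
theorem Running.settle (hfill : ∀ i j, GapInv M i (depth i) ((Ds i).get j) (time' i j))
    {curr : ∀ i, Option (Fin (Ds i).length × TreeNode (M.S i))} {s : ∀ i, Option (M.S i)}
    (h : NodesAt Ds curr s) (f : Option (Fin M.n × ℕ∞)) :
    Running time' ((algDAG M Ds time').settle ⟨curr, f⟩).val s ∧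
    (∀ i g, currSum B Ds i g (((algDAG M Ds time').settle ⟨curr, f⟩).val.curr i) =
      currSum B Ds i g (curr i)) ∧
    (∀ i x, ((algDAG M Ds time').settle ⟨curr, f⟩).val.curr i = some x → curr i = some x) ∧
    (∀ i x, curr i = some x → time' i x.1 x.2 ≠ ⊤ →
      ((algDAG M Ds time').settle ⟨curr, f⟩).val.curr i = some x ∧
      ∀ b, ((algDAG M Ds time').settle ⟨curr, f⟩).val.focus = some b →
        f = some b ∨ b.2 ≤ time' i x.1 x.2) ∧
    (∀ b x, f = some b → curr b.1 = some x → time' b.1 x.1 x.2 ≠ ⊤ → time' b.1 x.1 x.2 = b.2 →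
      ((algDAG M Ds time').settle ⟨curr, f⟩).val.focus = some b) := by
  rcases Scheduler.settle_spec (Q := algDAG M Ds time') ⟨curr, f⟩ with
    ⟨b, P, h1, h2, h3, h4⟩ | ⟨h1, h2, h3⟩
  · rw [h4]
    dsimp only at h1 h2
    have h5 : time' b.1 P.1 P.2 ≠ ⊤ ∧ time' b.1 P.1 P.2 = b.2 := of_decide_eq_true h3
    refine ⟨⟨h, fun hf => ?_, fun i τ hf => ?_⟩, fun _ _ => rfl, fun _ _ hx => hx,
      fun i x hx _ => ⟨hx, fun b' hb' => Or.inl hb'⟩, fun b' x hb' _ _ _ => hb'⟩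
    · exact absurd (h1.symm.trans hf) (by simp)
    · have h6 : b = (i, τ) := Option.some.inj (h1.symm.trans hf)
      subst h6
      exact ⟨P, h2, h5.2, fun hc => h5.1 (h5.2.trans hc)⟩
  · refine ⟨h3.running (h.drop h2), fun i g => currSum_drop hfill h h2 i g,
      fun i x hx => ?_,
      fun i x hx hfin => ?_, fun b x hf hx hfin ht => ?_⟩
    · rcases h2 i with h4 | ⟨h4, -⟩
      · exact h4.symm.trans hx
      · exact absurd (h4.symm.trans hx) (by simp)
    · have h5 : ((algDAG M Ds time').settle ⟨curr, f⟩).val.curr i = some x := by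
        rcases h2 i with h4 | ⟨-, P, h4, h5⟩
        · exact h4.trans hx
        · cases hx.symm.trans h4
          exact absurd h5 hfin
      refine ⟨h5, fun b hb => Or.inr ?_⟩
      simp only [Scheduler.Selected, hb] at h3
      exact h3.2.2 i x h5
    · have h4 : decide (time' b.1 x.1 x.2 ≠ ⊤ ∧ time' b.1 x.1 x.2 = b.2) = false := h1 b x hf hx
      exact absurd ⟨hfin, ht⟩ (of_decide_eq_false h4)

/-- The cost of a play of another arm at the time `τ`, when a component starting at the time `T`
waits to be played. -/
noncomputable def delayCost (T : ℕ) (τ : ℕ∞) : ℝ :=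
  if τ = T then 1 else if τ < T then 2 / T else 0

theorem delayCost_nonneg (T : ℕ) (τ : ℕ∞) : 0 ≤ delayCost T τ := by
  unfold delayCost
  split_ifs <;> positivity

open Classical in
/-- The indicator of a tree node, scaled by `ρ`. -/
noncomputable def nodeIndicator {i : Fin M.n} (j₀ : Fin (Ds i).length) (P₀ : TreeNode (M.S i))
    (ρ : ℝ) (j : Fin (Ds i).length) (P : TreeNode (M.S i)) : ℝ :=
  if j = j₀ ∧ P = P₀ then ρ else 0

theorem nodeIndicator_nonneg {i : Fin M.n} (j₀ : Fin (Ds i).length) (P₀ : TreeNode (M.S i))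
    {ρ : ℝ} (hρ : 0 ≤ ρ) (j : Fin (Ds i).length) (P : TreeNode (M.S i)) :
    0 ≤ nodeIndicator j₀ P₀ ρ j P := by
  unfold nodeIndicator
  split_ifs
  · exact hρ
  · exact le_rfl

theorem exists_suffix_of_currSum_ne_zero (hDs : ∀ i j, M.IsForwardDag B i ((Ds i).get j))
    {i : Fin M.n} {j₀ : Fin (Ds i).length} {P₀ : TreeNode (M.S i)} {ρ : ℝ}
    {o : Option (Fin (Ds i).length × TreeNode (M.S i))}
    (ho : ∀ x, o = some x → M.IsNode i ((Ds i).get x.1) x.2)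
    (h : currSum B Ds i (nodeIndicator j₀ P₀ ρ) o ≠ 0) :
    ∃ Q, o = some (j₀, Q) ∧ Q <:+ P₀ := by
  rcases o with _ | ⟨j, Q⟩
  · exact absurd rfl h
  · by_contra hc
    refine h (subtreeSum_eq_zero (hDs i j) (ho _ rfl) fun Q' _ hs _ => if_neg ?_)
    rintro ⟨rfl, rfl⟩
    exact hc ⟨Q, rfl, hs⟩

theorem NodesAt.update {curr : ∀ i, Option (Fin (Ds i).length × TreeNode (M.S i))}
    {s : ∀ i, Option (M.S i)} (h : NodesAt Ds curr s) {i : Fin M.n} {j : Fin (Ds i).length}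
    {u : M.S i} {t : ℕ∞} {R : TreeNode (M.S i)} (hN : M.IsNode i ((Ds i).get j) ((u, t) :: R))
    (ht : t ≠ ⊤) {o : Option (M.S i)} (ho : M.outcome i u o ≠ 0) :
    NodesAt Ds (Function.update curr i
      (treeMove Ds j ((u, t) :: R) o)) (Function.update s i o) := by
  intro i' x hx
  by_cases hi : i' = i
  · subst hi
    rw [Function.update_self] at hx ⊢
    rcases o with _ | v
    · cases hx
    · cases hx
      exact ⟨.child u t R v hN ht (lt_of_le_of_ne (M.p_nonneg i' u v) (Ne.symm ho)),
        v, _, _, rfl, rfl⟩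
  · rw [Function.update_of_ne hi] at hx ⊢
    exact h i' x hx

/-- The component with the head `v` will be played in time: either it is not yet reached, after
`n` plays of which the ones of other arms have the total cost `C`, or it is being played. -/
def InTime (c : (algDAG M Ds time').Config) (i₀ : Fin M.n) (T : ℕ) (v Q : TreeNode (M.S i₀))
    (tQ : ℕ∞) (n : ℕ) (C : ℝ) : Prop :=
  (Q.length ≤ v.length ∧ (n : ℝ) = Q.length - 1 + C * T / 2 ∧
    ∀ b, c.focus = some b → b.1 ≠ i₀ → b.2 ≤ T) ∨
  (v.length ≤ Q.length ∧ (∃ τ, c.focus = some (i₀, τ)) ∧ ((n + 1 : ℕ) : ℕ∞) ≤ tQ)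

/-- A lower bound on the probability of playing the tree node `P₀` in time. -/
theorem currSum_mul_le_total (hDs : ∀ i j, M.IsForwardDag B i ((Ds i).get j))
    (hdepth : ∀ i u v, 0 < M.p i u v → depth i v = depth i u + 1)
    (hroot : ∀ i, depth i (M.root i) = 0)
    (hfill : ∀ i j, Filled M i (depth i) ((Ds i).get j) (time' i j))
    {i₀ : Fin M.n} {j₀ : Fin (Ds i₀).length} {P₀ v : TreeNode (M.S i₀)}
    (hP₀ : M.IsNode i₀ ((Ds i₀).get j₀) P₀) (hfin : treeTime P₀ ≠ ⊤)
    (hv : treeHead (time' i₀ j₀) P₀ = v) {T : ℕ} (hT : time' i₀ j₀ v = T) {ρ : ℝ} (hρ : 0 ≤ ρ)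
    {w : ∀ i, (algDAG M Ds time').Config → M.S i → ℝ} (hw0 : ∀ i c u, 0 ≤ w i c u)
    (hw : ∀ (c : (algDAG M Ds time').Config) u t R, c.curr i₀ = some (j₀, P₀) →
      P₀ = (u, t) :: R → ρ ≤ w i₀ c u)
    (k n : ℕ) (c : (algDAG M Ds time').Config) (s : ∀ i, Option (M.S i)) (C : ℝ)
    (hrun : Running time' c s) (hC : 0 ≤ C) (hnk : n + k = B)
    (hgood : ∀ Q, c.curr i₀ = some (j₀, Q) → Q <:+ P₀ → C < 1 →
      InTime c i₀ T v Q (time' i₀ j₀ Q) n C) :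
    currSum B Ds i₀ (nodeIndicator j₀ P₀ ρ) (c.curr i₀) * (1 - C - ∑ i ∈ univ.erase i₀,
      currSum B Ds i (fun j P => delayCost T (time' i j P)) (c.curr i)) ≤
      (algDAG M Ds time').agent.total w k c s := by
  have hI := (hfill i₀ j₀).toGapInv
  obtain ⟨hvN, hvh, hvs, hvt⟩ := treeHead_spec (time := time' i₀ j₀) hP₀
  rw [hv] at hvN hvh hvs hvt
  have hvT : treeTime v = T := by rw [← hI.head v hvN hvh, hT]
  have hTB : T ≤ B := by
    have := (hvN.time_le (hDs i₀ j₀).toIsStratDag).resolve_left (by rw [hvT]; simp)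
    rw [hvT] at this
    exact_mod_cast this
  have hv1 : 1 ≤ v.length := List.length_pos_iff.2 hvN.ne_nil
  -- This is where gap filling enters: reaching the head takes at most `T / 2` plays of its own arm.
  have hvlen : 2 * (v.length - 1) ≤ T := by
    have h1 := (hfill i₀ j₀).two_mul_le v hvN hvh
    rw [hvT] at h1
    have h2 : 2 * treeDepth (depth i₀) v ≤ T := by exact_mod_cast h1
    have h3 := hvN.depth_add_one (hdepth i₀) (hroot i₀)
    omega
  have hT1 : 1 ≤ T := by
    have h1 := hvN.length_le_time (hDs i₀ j₀).toIsStratDag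
    rw [hvT] at h1
    have h2 : v.length ≤ T := by exact_mod_cast h1
    omega
  have hT1' : (1 : ℝ) ≤ T := by exact_mod_cast hT1
  have hvlen' : 2 * ((v.length : ℝ) - 1) ≤ T := by
    have : ((2 * (v.length - 1) : ℕ) : ℝ) ≤ T := by exact_mod_cast hvlen
    rwa [Nat.cast_mul, Nat.cast_sub hv1, Nat.cast_one, Nat.cast_two] at this
  have hPfin : time' i₀ j₀ P₀ ≠ ⊤ := hI.ne_top hP₀ hfin
  have hPB : time' i₀ j₀ P₀ ≤ B :=
    (hI.le P₀ hP₀).trans ((hP₀.time_le (hDs i₀ j₀).toIsStratDag).resolve_left hfin)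
  -- Up to the head the arm waits at times at most `T`, so no other arm is selected at a later time.
  have hbefore : ∀ Q, Q ≠ [] → Q <:+ P₀ → Q.length ≤ v.length → time' i₀ j₀ Q ≤ T := by
    intro Q hQ hs hlen
    rw [← hT]
    exact hI.time_mono hvN hQ (List.suffix_of_suffix_length_le hs hvs hlen)
  -- From the head to `P₀` the time grows by exactly the number of steps in total and by at least
  -- one per step, hence by one at each step.
  have hnext : ∀ x Q, x :: Q <:+ P₀ → v.length ≤ Q.length →
      time' i₀ j₀ (x :: Q) = time' i₀ j₀ Q + 1 := by
    intro x Q hs hlen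
    have hQ : Q <:+ P₀ := (List.suffix_cons x Q).trans hs
    have hQne : Q ≠ [] := by
      rintro rfl
      exact hvN.ne_nil (List.length_eq_zero_iff.1 (Nat.le_zero.1 hlen))
    have hNx := hP₀.of_suffix (List.cons_ne_nil x Q) hs
    have hNQ := hP₀.of_suffix hQne hQ
    have h1 := hI.time_add_length_le hNQ hvN.ne_nil (List.suffix_of_suffix_length_le hvs hQ hlen)
    have h2 := hI.time_add_length_le hNx hQne (List.suffix_cons x Q)
    have h3 := hI.time_add_length_le hP₀ (List.cons_ne_nil x Q) hs
    rw [hT] at hvt h1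
    obtain ⟨a, ha⟩ := ENat.ne_top_iff_exists.1 hPfin
    obtain ⟨b, hb⟩ := ENat.ne_top_iff_exists.1
      (ne_top_of_le_ne_top hPfin (hI.time_mono hP₀ hQne hQ))
    obtain ⟨e, he⟩ := ENat.ne_top_iff_exists.1
      (ne_top_of_le_ne_top hPfin (hI.time_mono hP₀ (List.cons_ne_nil x Q) hs))
    rw [← ha] at hvt h3
    rw [← hb] at h1 h2 ⊢
    rw [← he] at h2 h3 ⊢
    have h4 : a + v.length = T + P₀.length := by exact_mod_cast hvt
    have h5 : T + Q.length ≤ b + v.length := by exact_mod_cast h1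
    have h6 : b + (x :: Q).length ≤ e + Q.length := by exact_mod_cast h2
    have h7 : e + P₀.length ≤ a + (x :: Q).length := by exact_mod_cast h3
    rw [List.length_cons] at h6 h7
    exact_mod_cast (by omega : e = b + 1)
  have hδ0 : ∀ o : Option (Fin (Ds i₀).length × TreeNode (M.S i₀)),
      (∀ x, o = some x → M.IsNode i₀ ((Ds i₀).get x.1) x.2) →
      0 ≤ currSum B Ds i₀ (nodeIndicator j₀ P₀ ρ) o := fun o ho =>
    currSum_nonneg hDs (nodeIndicator_nonneg j₀ P₀ hρ) ho
  have hd0 : ∀ i, ∀ o : Option (Fin (Ds i).length × TreeNode (M.S i)),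
      (∀ x, o = some x → M.IsNode i ((Ds i).get x.1) x.2) →
      0 ≤ currSum B Ds i (fun j P => delayCost T (time' i j P)) o := fun i o ho =>
    currSum_nonneg hDs (fun _ _ => delayCost_nonneg _ _) ho
  -- If the left-hand side is positive, then `P₀` is still reachable and in time, and a play is
  -- about to be made with some of the `B` plays left: of arm `i₀` above the head, of arm `i₀`
  -- inside the component, or of another arm while `i₀` waits.
  have key : ∀ (n : ℕ) (c : (algDAG M Ds time').Config) (s : ∀ i, Option (M.S i)) (C : ℝ),
      Running time' c s → 0 ≤ C →
      (∀ Q, c.curr i₀ = some (j₀, Q) → Q <:+ P₀ → C < 1 →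
        InTime c i₀ T v Q (time' i₀ j₀ Q) n C) →
      0 < currSum B Ds i₀ (nodeIndicator j₀ P₀ ρ) (c.curr i₀) * (1 - C - ∑ i ∈ univ.erase i₀,
        currSum B Ds i (fun j P => delayCost T (time' i j P)) (c.curr i)) →
      0 < 1 - C - ∑ i ∈ univ.erase i₀,
        currSum B Ds i (fun j P => delayCost T (time' i j P)) (c.curr i) ∧
      n + 1 ≤ B ∧ ∃ Q, c.curr i₀ = some (j₀, Q) ∧ Q <:+ P₀ ∧ Q ≠ [] ∧
        ∃ i τ, c.focus = some (i, τ) ∧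
        ((i = i₀ ∧ Q.length < v.length ∧ (n : ℝ) = Q.length - 1 + C * T / 2) ∨
        (i = i₀ ∧ v.length ≤ Q.length ∧ ((n + 1 : ℕ) : ℕ∞) ≤ time' i₀ j₀ Q) ∨
        (i ≠ i₀ ∧ τ ≤ T ∧ Q.length ≤ v.length ∧ (n : ℝ) = Q.length - 1 + C * T / 2)) := by
    intro n c s C hrun hC hgood hpos
    have hnodes : ∀ i x, c.curr i = some x → M.IsNode i ((Ds i).get x.1) x.2 := fun i x hx =>
      (hrun.nodesAt i x hx).1
    have hV := hδ0 (c.curr i₀) (hnodes i₀)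
    have hfac := pos_of_mul_pos_right hpos hV
    have hsum : 0 ≤ ∑ i ∈ univ.erase i₀,
        currSum B Ds i (fun j P => delayCost T (time' i j P)) (c.curr i) :=
      Finset.sum_nonneg fun i _ => hd0 i _ (hnodes i)
    obtain ⟨Q, hQ, hQs⟩ := exists_suffix_of_currSum_ne_zero hDs (hnodes i₀)
      (left_ne_zero_of_mul hpos.ne')
    have hC1 : C < 1 := by linarith
    have hQne := (hnodes i₀ _ hQ).ne_nil
    have hCT : C * T < T := by nlinarith
    obtain ⟨i, τ, hf⟩ : ∃ i τ, c.focus = some (i, τ) := by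
      rcases hf : c.focus with _ | ⟨i, τ⟩
      · exact absurd ((hrun.focus_none hf i₀).symm.trans hQ) (by simp)
      · exact ⟨i, τ, rfl⟩
    -- Fewer than `T` plays were made: at most `T / 2` by the arm itself, and `C * T / 2 < T / 2` by
    -- others.
    have hearly : Q.length ≤ v.length → (n : ℝ) = Q.length - 1 + C * T / 2 → n + 1 ≤ T := by
      intro h1 h2
      have h3 : (Q.length : ℝ) ≤ v.length := by exact_mod_cast h1
      have : (n : ℝ) < T := by linarith
      exact_mod_cast this
    refine ⟨hfac, ?_, Q, hQ, hQs, hQne, i, τ, hf, ?_⟩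
    · rcases hgood Q hQ hQs hC1 with ⟨h1, h2, -⟩ | ⟨-, -, h2⟩
      · exact (hearly h1 h2).trans hTB
      · exact_mod_cast (h2.trans (hI.time_mono hP₀ hQne hQs)).trans hPB
    · rcases hgood Q hQ hQs hC1 with ⟨h1, h2, h3⟩ | ⟨h1, ⟨τ', h2⟩, h3⟩
      · by_cases hi : i = i₀
        · rcases h1.lt_or_eq with h4 | h4
          · exact Or.inl ⟨hi, h4, h2⟩
          · refine Or.inr (Or.inl ⟨hi, h4.ge, ?_⟩)
            have h5 : v = Q := (List.suffix_of_suffix_length_le hvs hQs h4.ge).eq_of_length h4.symm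
            rw [← h5, hT]
            exact_mod_cast hearly h1 h2
        · exact Or.inr (Or.inr ⟨hi, h3 _ hf hi, h1, h2⟩)
      · rw [hf] at h2
        cases h2
        exact Or.inr (Or.inl ⟨rfl, h1, h3⟩)
  -- The left-hand side is to be dominated by the present reward plus its expected value after the
  -- play.
  induction k generalizing n c s C with
  | zero =>
    refine not_lt.1 fun hpos => ?_
    have := (key n c s C hrun hC hgood hpos).2.1
    omega
  | succ k ih =>
    by_cases hpos : 0 < currSum B Ds i₀ (nodeIndicator j₀ P₀ ρ) (c.curr i₀) *
      (1 - C - ∑ i ∈ univ.erase i₀,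
        currSum B Ds i (fun j P => delayCost T (time' i j P)) (c.curr i))
    swap
    · exact (not_lt.1 hpos).trans (Agent.total_nonneg hw0 _ _ _)
    obtain ⟨hfac, hnB, Q, hQ, hQs, hQne, i, τ, hf, hcase⟩ := key n c s C hrun hC hgood hpos
    obtain ⟨⟨j, P⟩, hcurr, htime, hτ⟩ := hrun.focus_some i τ hf
    obtain ⟨hN, u, t, R, hP, hs⟩ := hrun.nodesAt i _ hcurr
    dsimp only at htime hN hP
    subst hP
    have ht : t ≠ ⊤ := fun hc => hτ (htime ▸ ((hfill i j).eq_top_iff hN).2 hc)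
    have hch : (algDAG M Ds time').agent.choose c = some i := by
      simp only [Scheduler.agent, hf, Option.map_some]
    have hnodes : ∀ i x, c.curr i = some x → M.IsNode i ((Ds i).get x.1) x.2 := fun i x hx =>
      (hrun.nodesAt i x hx).1
    refine le_trans ?_ (Agent.total_play (A := (algDAG M Ds time').agent) (w := w) hch hs k).ge
    obtain ⟨curr, hcurreq⟩ : ∃ curr : ∀ i, Option (Fin (Ds i).length × TreeNode (M.S i)),
      curr = c.curr := ⟨c.curr, rfl⟩
    have hset := fun o (ho : M.outcome i u o ≠ 0) =>
      Running.settle (B := B) (fun i j => (hfill i j).toGapInv)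
        (NodesAt.update (hcurreq ▸ hrun.nodesAt) hN ht ho) (some (i, τ + 1))
    have hval : ∀ o, ((algDAG M Ds time').agent.update c i o).val =
        ((algDAG M Ds time').settle ⟨Function.update curr i
          (treeMove Ds j ((u, t) :: R) o), some (i, τ + 1)⟩).val := by
      intro o
      rw [Scheduler.val_update hf hcurr o, hcurreq]
      cases o <;> rfl
    have hstep : ∀ o, M.outcome i u o ≠ 0 → ∀ C', 0 ≤ C' →
        (∀ Q', Function.update curr i (treeMove Ds j ((u, t) :: R) o) i₀ = some (j₀, Q') →
          Q' <:+ P₀ → C' < 1 → InTime ((algDAG M Ds time').settle ⟨Function.update curr i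
            (treeMove Ds j ((u, t) :: R) o), some (i, τ + 1)⟩).val i₀ T v Q'
            (time' i₀ j₀ Q') (n + 1) C') →
        currSum B Ds i₀ (nodeIndicator j₀ P₀ ρ)
            (Function.update curr i (treeMove Ds j ((u, t) :: R) o) i₀) *
          (1 - C' - ∑ i' ∈ univ.erase i₀, currSum B Ds i' (fun j P => delayCost T (time' i' j P))
            (Function.update curr i (treeMove Ds j ((u, t) :: R) o) i')) ≤
        (algDAG M Ds time').agent.total w k ((algDAG M Ds time').agent.update c i o).val
          (Function.update s i o) := by
      intro o ho C' hC' hgood'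
      obtain ⟨h1, h2, h3, -, -⟩ := hset o ho
      have := ih (n + 1) _ _ C' h1 hC' (by omega) fun Q' hQ' => hgood' Q' (h3 _ _ hQ')
      rw [hval]
      refine le_trans (le_of_eq ?_) this
      rw [h2]
      congr 2
      exact Finset.sum_congr rfl fun i' _ => (h2 i' _).symm
    have htot0 : ∀ o, 0 ≤ M.outcome i u o * (algDAG M Ds time').agent.total w k
        ((algDAG M Ds time').agent.update c i o).val (Function.update s i o) := fun o =>
      mul_nonneg (M.outcome_nonneg _ _) (Agent.total_nonneg hw0 _ _ _)
    have hsum : 0 ≤ ∑ i ∈ univ.erase i₀,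
        currSum B Ds i (fun j P => delayCost T (time' i j P)) (c.curr i) :=
      Finset.sum_nonneg fun i _ => hd0 i _ (hnodes i)
    have hV := hδ0 (c.curr i₀) (hnodes i₀)
    rw [← hcurreq] at hfac hQ hcurr hsum hV ⊢
    replace hcurr : curr i = some (j, (u, t) :: R) := hcurr
    replace hQ : curr i₀ = some (j₀, Q) := hQ
    by_cases hi : i = i₀
    · subst i
      obtain ⟨hj, hPQ⟩ : j = j₀ ∧ Q = (u, t) :: R := by
        have := Option.some.inj (hcurr.symm.trans hQ)
        exact ⟨congrArg Prod.fst this, (congrArg Prod.snd this).symm⟩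
      subst j Q
      -- At `P₀` itself the reward `ρ` is collected, and the left-hand side is at most `ρ` because
      -- the node is visited at most once.
      by_cases hPQ : (u, t) :: R = P₀
      · have h1 : currSum B Ds i₀ (nodeIndicator j₀ P₀ ρ) (curr i₀) ≤ ρ := by
          rw [hcurr]
          refine hI.subtreeSum_le (hDs i₀ j₀) (time' i₀ j₀ P₀) hρ hN fun Q' _ _ => ?_
          unfold nodeIndicator
          split_ifs with h2 h3 h3
          · exact le_rfl
          · exact absurd (congrArg _ h2.2) h3
          · exact hρ
          · exact le_rfl
        have h2 : ρ ≤ w i₀ c u := hw c u t R (by rw [← hcurreq, hcurr, hPQ]) hPQ.symm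
        calc _ ≤ ρ * 1 := mul_le_mul h1 (by linarith) hfac.le hρ
          _ ≤ w i₀ c u := by rwa [mul_one]
          _ ≤ _ := le_add_of_nonneg_right (Finset.sum_nonneg fun o _ => htot0 o)
      -- At another node of arm `i₀`, the first factor is preserved in expectation and the second
      -- one does not change.
      · have h1 := currSum_some hDs (nodeIndicator j₀ P₀ ρ) hN ht
        rw [show nodeIndicator j₀ P₀ ρ j₀ ((u, t) :: R) = 0 from if_neg fun h => hPQ h.2,
          zero_add] at h1
        rw [hcurr, h1, Finset.sum_mul]
        refine (Finset.sum_le_sum fun o _ => ?_).trans (le_add_of_nonneg_left (hw0 _ _ _))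
        by_cases ho : M.outcome i₀ u o = 0
        · simp [ho]
        rw [mul_assoc]
        refine mul_le_mul_of_nonneg_left ?_ (M.outcome_nonneg _ _)
        have h2 := hstep o ho C hC fun Q' hQ' hs' hC1 => ?_
        · rw [Function.update_self] at h2
          refine le_trans (le_of_eq ?_) h2
          congr 2
          exact Finset.sum_congr rfl fun i' hi' => by
            rw [Function.update_of_ne (Finset.ne_of_mem_erase hi')]
        · obtain ⟨-, -, -, h3, h4⟩ := hset o ho
          have hmove := hQ'
          rw [Function.update_self] at hmove
          rcases o with _ | v'
          · cases hmove
          obtain rfl : (v', ((Ds i₀).get j₀).step u t v') :: (u, t) :: R = Q' :=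
            congrArg Prod.snd (Option.some.inj hmove)
          rcases hcase with ⟨-, hlen, hn⟩ | ⟨-, hlen, hn⟩ | ⟨hc, -⟩
          · have h5 := hbefore _ (List.cons_ne_nil _ _) hs' (by rw [List.length_cons]; omega)
            refine Or.inl ⟨by rw [List.length_cons]; omega, ?_, fun b hb hb' => ?_⟩
            · rw [List.length_cons]
              push_cast
              rw [hn]
              ring
            · rcases (h3 i₀ _ hQ' (ne_top_of_le_ne_top (ENat.natCast_ne_top T) h5)).2 b hb with
                h6 | h6
              · cases h6
                exact absurd rfl hb'
              · exact h6.trans h5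
          -- Inside the component the inner loop goes on, so `i₀` keeps the focus, and its time and
          -- the number of plays both grow by one.
          · have h5 := hnext _ _ hs' hlen
            refine Or.inr ⟨hlen.trans (List.suffix_cons _ _).length_le, ⟨τ + 1, ?_⟩, ?_⟩
            · refine h4 (i₀, τ + 1) _ rfl hQ' ?_ ?_
              · rw [h5, htime]
                simpa using hτ
              · rw [h5, htime]
            · rw [h5, Nat.cast_succ]
              exact add_le_add_left hn 1
          · exact absurd rfl hc
    -- A play of another arm leaves the first factor alone. In the second factor, its charge moves
    -- from the expected future part to `C`.
    · obtain ⟨hτT, hlen, hn⟩ : τ ≤ T ∧ Q.length ≤ v.length ∧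
          (n : ℝ) = Q.length - 1 + C * T / 2 := by
        rcases hcase with ⟨h, -⟩ | ⟨h, -⟩ | ⟨-, h⟩
        · exact absurd h hi
        · exact absurd h hi
        · exact h
      have hmem : i ∈ univ.erase i₀ := Finset.mem_erase.2 ⟨hi, Finset.mem_univ i⟩
      have h1 := currSum_some hDs (fun j P => delayCost T (time' i j P)) hN ht
      rw [htime] at h1
      have hrest : 0 ≤ ∑ i' ∈ (univ.erase i₀).erase i,
          currSum B Ds i' (fun j P => delayCost T (time' i' j P)) (curr i') :=
        Finset.sum_nonneg fun i' _ => hd0 i' _ (hcurreq ▸ hnodes i')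
      rw [← Finset.add_sum_erase _ _ hmem, hcurr, h1] at hfac ⊢
      have hmove0 : 0 ≤ ∑ o, M.outcome i u o * currSum B Ds i
          (fun j P => delayCost T (time' i j P)) (treeMove Ds j ((u, t) :: R) o) := by
        refine Finset.sum_nonneg fun o _ => ?_
        by_cases ho : M.outcome i u o = 0
        · simp [ho]
        · refine mul_nonneg (M.outcome_nonneg _ _) (hd0 i _ fun x hx => ?_)
          exact (NodesAt.update (hcurreq ▸ hrun.nodesAt) hN ht ho i x
            (by rw [Function.update_self, hx])).1
      -- A play at time `T` would be charged `1` and make the second factor non-positive.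
      have hlt : τ < T := by
        refine lt_of_le_of_ne hτT fun he => ?_
        rw [show delayCost T τ = 1 from if_pos he] at hfac
        linarith
      have hcost : delayCost T τ = 2 / T := by
        rw [delayCost, if_neg hlt.ne, if_pos hlt]
      rw [hcost]
      -- The outcome probabilities sum to one, so the terms independent of the outcome can be moved
      -- under the sum.
      have h2 : ∀ V r : ℝ, V * (1 - C - (2 / T + ∑ o, M.outcome i u o * currSum B Ds i
            (fun j P => delayCost T (time' i j P)) (treeMove Ds j ((u, t) :: R) o) + r)) =
          ∑ o, M.outcome i u o * (V * (1 - (C + 2 / T) - (currSum B Ds i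
            (fun j P => delayCost T (time' i j P)) (treeMove Ds j ((u, t) :: R) o) + r))) := by
        intro V r
        calc _ = V * (1 - (C + 2 / T) - r) * ∑ o, M.outcome i u o -
              V * ∑ o, M.outcome i u o * currSum B Ds i
                (fun j P => delayCost T (time' i j P)) (treeMove Ds j ((u, t) :: R) o) := by
              rw [M.sum_outcome]
              ring
          _ = _ := by
              rw [Finset.mul_sum, Finset.mul_sum, ← Finset.sum_sub_distrib]
              exact Finset.sum_congr rfl fun o _ => by ring
      rw [h2]
      refine (Finset.sum_le_sum fun o _ => ?_).trans (le_add_of_nonneg_left (hw0 _ _ _))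
      by_cases ho : M.outcome i u o = 0
      · simp [ho]
      refine mul_le_mul_of_nonneg_left ?_ (M.outcome_nonneg _ _)
      have h3 := hstep o ho (C + 2 / T) (by positivity) fun Q' hQ' hs' _ => ?_
      · rw [Function.update_of_ne (Ne.symm hi), ← Finset.add_sum_erase _ _ hmem,
          Function.update_self] at h3
        refine le_trans (le_of_eq ?_) h3
        congr 3
        exact Finset.sum_congr rfl fun i' hi' => by
          rw [Function.update_of_ne (Finset.ne_of_mem_erase hi')]
      · obtain ⟨-, -, -, h4, -⟩ := hset o ho
        have hQ'' := hQ'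
        rw [Function.update_of_ne (Ne.symm hi)] at hQ''
        obtain rfl : Q = Q' := congrArg Prod.snd (Option.some.inj (hQ.symm.trans hQ''))
        have h5 := hbefore Q hQne hQs hlen
        -- The count stays exact: one more play is an additional charge of `2 / T`, multiplied by `T
        -- / 2`.
        refine Or.inl ⟨hlen, ?_, fun b hb _ => ?_⟩
        · push_cast
          rw [hn]
          field_simp
          ring
        · rcases (h4 i₀ _ hQ' (ne_top_of_le_ne_top (ENat.natCast_ne_top T) h5)).2 b hb with
            h6 | h6
          · cases h6
            exact Order.add_one_le_of_lt hlt
          · exact h6.trans h5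

end Core

/-! ### The random choice of the dags -/

section Pick

variable {M : MAB} {Ds : ∀ i, List (StratDag (M.S i))}

theorem sum_pick (i : Fin M.n) : ∑ o, pick M Ds i o = 1 := by
  rw [Fintype.sum_option]
  simp [pick]

/-- Independence of the arms. The one-arm and two-arm versions below put the constant `1` in the
other coordinates. -/
theorem sum_prod_pick_mul (f : ∀ i, Option (Fin (Ds i).length) → ℝ) :
    ∑ σ : Choice M Ds, (∏ i, pick M Ds i (σ i)) * ∏ i, f i (σ i) =
      ∏ i, ∑ o, pick M Ds i o * f i o := by
  rw [Finset.prod_univ_sum, Fintype.piFinset_univ]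
  exact Finset.sum_congr rfl fun σ _ => Finset.prod_mul_distrib.symm

theorem sum_prod_pick_mul_apply (i₀ : Fin M.n) (f : Option (Fin (Ds i₀).length) → ℝ) :
    ∑ σ : Choice M Ds, (∏ i, pick M Ds i (σ i)) * f (σ i₀) = ∑ o, pick M Ds i₀ o * f o := by
  have h := sum_prod_pick_mul (M := M) (Ds := Ds) (Function.update (fun _ _ => 1) i₀ f)
  rw [Fintype.prod_eq_single i₀ (fun i hi => by
    simp only [Function.update_of_ne hi, mul_one, sum_pick]),
    Function.update_self] at h
  rw [← h]
  refine Finset.sum_congr rfl fun σ _ => ?_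
  congr 1
  rw [Fintype.prod_eq_single i₀ (fun i hi => by rw [Function.update_of_ne hi]),
    Function.update_self]

theorem sum_prod_pick_mul_apply_mul_apply {i₀ i₁ : Fin M.n} (hne : i₁ ≠ i₀)
    (f : Option (Fin (Ds i₀).length) → ℝ) (g : Option (Fin (Ds i₁).length) → ℝ) :
    ∑ σ : Choice M Ds, (∏ i, pick M Ds i (σ i)) * (f (σ i₀) * g (σ i₁)) =
      (∑ o, pick M Ds i₀ o * f o) * ∑ o, pick M Ds i₁ o * g o := by
  have h := sum_prod_pick_mul (M := M) (Ds := Ds)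
    (Function.update (Function.update (fun _ _ => 1) i₀ f) i₁ g)
  rw [Fintype.prod_eq_mul i₀ i₁ hne.symm
    (fun i hi => by
      simp only [Function.update_of_ne hi.1, Function.update_of_ne hi.2, mul_one, sum_pick]),
    Function.update_self, Function.update_of_ne hne.symm, Function.update_self] at h
  rw [← h]
  refine Finset.sum_congr rfl fun σ _ => ?_
  congr 1
  rw [Fintype.prod_eq_mul i₀ i₁ hne.symm
    (fun i hi => by rw [Function.update_of_ne hi.2, Function.update_of_ne hi.1]),
    Function.update_self, Function.update_of_ne hne.symm, Function.update_self]

variable {B : ℕ} {z w : ∀ i, M.S i → ℕ → ℝ}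

/-- The root probabilities of the dags of an arm add up to the mass of the root in `z`, which is at
most the single unit entered at time `1`. So the arm is ignored with probability at least `23 / 24`.
-/
theorem pick_nonneg (h : M.IsFeasible B z w) (hDs : ∀ i j, M.IsForwardDag B i ((Ds i).get j))
    (hz : ∀ i u, ∀ t ∈ Icc 1 B, ((Ds i).map fun D => D.prob u t).sum = z i u t)
    (i : Fin M.n) (o : Option (Fin (Ds i).length)) : 0 ≤ pick M Ds i o := by
  rcases o with _ | j
  · have h1 : ∑ j, ((Ds i).get j).prob (M.root i) ((Ds i).get j).rootTime ≤ 1 := by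
      calc _ = ∑ j, ∑ t ∈ Icc 1 B, ((Ds i).get j).prob (M.root i) t :=
            Finset.sum_congr rfl fun j _ => (Finset.sum_eq_single_of_mem _ (hDs i j).rootTime_mem
              fun t ht hne => (hDs i j).prob_root t ht hne).symm
        _ = ∑ t ∈ Icc 1 B, z i (M.root i) t := by
            rw [Finset.sum_comm]
            refine Finset.sum_congr rfl fun t ht => ?_
            rw [← hz i _ t ht, ← Fin.sum_univ_fun_getElem]
            rfl
        _ ≤ 1 := by
            rcases Nat.eq_zero_or_pos B with rfl | hB
            · simp
            · refine (h.enter B (Finset.mem_Icc.2 ⟨hB, le_rfl⟩) i (M.root i)).trans (le_of_eq ?_)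
              rw [Finset.sum_eq_single_of_mem 1 (Finset.mem_Icc.2 ⟨le_rfl, hB⟩), h.root_first]
              intro t ht hne
              have := Finset.mem_Icc.1 ht
              exact h.root_later t (Finset.mem_Icc.2 ⟨by omega, this.2⟩) i
    simp only [pick]
    rw [← Finset.sum_div]
    linarith
  · exact div_nonneg (prob_root_nonneg hDs i j) (by norm_num)

end Pick

/-! ### The reward bound -/

section Reward

variable {L : MAB} {depth : ∀ i, L.S i → ℕ} {B : ℕ} {z w : ∀ i, L.S i → ℕ → ℝ}
  {Ds : ∀ i, List (StratDag (L.S i))}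
  {time' : ∀ i, Fin (Ds i).length → TreeNode (L.S i) → ℕ∞}

/-- The expected cost of the plays of all arms before a component starting at the time `T`. -/
theorem sum_prob_mul_delayCost_le (hL : L.IsLayered depth) (h : L.IsFeasible B z w)
    (hDs : ∀ i j, L.IsForwardDag B i ((Ds i).get j))
    (hz : ∀ i u, ∀ t ∈ Icc 1 B, ((Ds i).map fun D => D.prob u t).sum = z i u t)
    (hfill : ∀ i j, GapInv L i (depth i) ((Ds i).get j) (time' i j)) {T : ℕ} (hT : T ∈ Icc 1 B) :
    ∑ i, ∑ j, ((Ds i).get j).prob (L.root i) ((Ds i).get j).rootTime *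
      subtreeSum B ((Ds i).get j) (fun P => delayCost T (time' i j P))
        (((Ds i).get j).treeRoot (L.root i)) ≤ 15 := by
  classical
  obtain ⟨hT1, hTB⟩ := Finset.mem_Icc.1 hT
  have hT0 : (0 : ℝ) < T := by exact_mod_cast hT1
  have hmass : ∀ t ∈ Icc 1 T, ∑ i, ∑ j, ((Ds i).get j).prob (L.root i) ((Ds i).get j).rootTime *
      subtreeSum B ((Ds i).get j) (fun P => if time' i j P = t then 1 else 0)
        (((Ds i).get j).treeRoot (L.root i)) ≤ 5 := fun t ht =>
    sum_prob_mul_subtreeSum_level_le hL h hDs hz hfill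
      (Finset.mem_Icc.2 ⟨(Finset.mem_Icc.1 ht).1, (Finset.mem_Icc.1 ht).2.trans hTB⟩)
  -- Pointwise, the charge is at most the indicator of the time `T` plus `2 / T` times the
  -- indicators of the times in `[1, T]`; each of these levels has mass at most `5`.
  have hle : ∀ i j, subtreeSum B ((Ds i).get j) (fun P => delayCost T (time' i j P))
      (((Ds i).get j).treeRoot (L.root i)) ≤
      subtreeSum B ((Ds i).get j) (fun P => if time' i j P = T then 1 else 0)
        (((Ds i).get j).treeRoot (L.root i)) +
      2 / T * ∑ t ∈ Icc 1 T, subtreeSum B ((Ds i).get j)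
        (fun P => if time' i j P = t then 1 else 0) (((Ds i).get j).treeRoot (L.root i)) := by
    intro i j
    rw [← subtreeSum_sum, ← subtreeSum_const_mul, ← subtreeSum_add]
    refine subtreeSum_le_subtreeSum (hDs i j) .root fun Q hQ hs hfin => ?_
    obtain ⟨a, ha⟩ := ENat.ne_top_iff_exists.1 ((hfill i j).ne_top hQ hfin)
    have h1 : 1 ≤ a := by
      have h2 := (hfill i j).time_mono hQ IsTreeNode.root.ne_nil hs
      rw [(hfill i j).head _ .root rfl, ← ha] at h2
      have h3 := (Finset.mem_Icc.1 (hDs i j).rootTime_mem).1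
      have h4 : ((Ds i).get j).rootTime ≤ a := Nat.cast_le.1 h2
      omega
    rw [← ha, delayCost]
    have hsum : 0 ≤ ∑ t ∈ Icc 1 T, if (a : ℕ∞) = (t : ℕ∞) then (1 : ℝ) else 0 :=
      Finset.sum_nonneg fun t _ => by split_ifs <;> norm_num
    by_cases h2 : (a : ℕ∞) = T
    · rw [if_pos h2, if_pos h2]
      have : 0 ≤ 2 / (T : ℝ) := by positivity
      nlinarith [mul_nonneg this hsum]
    · rw [if_neg h2, if_neg h2, zero_add]
      split_ifs with h3
      · have h4 : a < T := by exact_mod_cast h3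
        rw [Finset.sum_eq_single_of_mem a (Finset.mem_Icc.2 ⟨h1, h4.le⟩)
          (fun t _ ht => if_neg fun hc => ht (by exact_mod_cast hc.symm)), if_pos rfl, mul_one]
      · exact mul_nonneg (by positivity) hsum
  calc _ ≤ ∑ i, ∑ j, ((Ds i).get j).prob (L.root i) ((Ds i).get j).rootTime *
        (subtreeSum B ((Ds i).get j) (fun P => if time' i j P = T then 1 else 0)
          (((Ds i).get j).treeRoot (L.root i)) +
        2 / T * ∑ t ∈ Icc 1 T, subtreeSum B ((Ds i).get j)
          (fun P => if time' i j P = t then 1 else 0) (((Ds i).get j).treeRoot (L.root i))) :=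
        Finset.sum_le_sum fun i _ => Finset.sum_le_sum fun j _ =>
          mul_le_mul_of_nonneg_left (hle i j) (prob_root_nonneg hDs i j)
    _ = (∑ i, ∑ j, ((Ds i).get j).prob (L.root i) ((Ds i).get j).rootTime *
          subtreeSum B ((Ds i).get j) (fun P => if time' i j P = T then 1 else 0)
            (((Ds i).get j).treeRoot (L.root i))) +
        2 / T * ∑ t ∈ Icc 1 T, ∑ i, ∑ j, ((Ds i).get j).prob (L.root i) ((Ds i).get j).rootTime *
          subtreeSum B ((Ds i).get j) (fun P => if time' i j P = t then 1 else 0)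
            (((Ds i).get j).treeRoot (L.root i)) := by
        simp only [mul_add, Finset.sum_add_distrib]
        congr 1
        rw [Finset.sum_comm, Finset.mul_sum]
        refine Finset.sum_congr rfl fun i _ => ?_
        rw [Finset.sum_comm, Finset.mul_sum]
        refine Finset.sum_congr rfl fun j _ => ?_
        rw [← Finset.mul_sum]
        ring
    -- The level `T` contributes `5`, and the `T` levels of weight `2 / T` contribute `10`.
    _ ≤ 5 + 2 / T * ∑ t ∈ Icc 1 T, 5 :=
        add_le_add (hmass T (Finset.mem_Icc.2 ⟨hT1, le_rfl⟩))
          (mul_le_mul_of_nonneg_left (Finset.sum_le_sum hmass) (by positivity))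
    _ = 15 := by
        rw [Finset.sum_const, Nat.card_Icc, Nat.add_sub_cancel, nsmul_eq_mul]
        field_simp
        norm_num

/-- The expected reward is at least the sum of the expectations of parts of the reward. -/
theorem Agent.sum_total_le_expect {A : Agent L} {ι : Type} [Fintype ι] {κ : ι → Type}
    [∀ x, Fintype (κ x)] {α : ι → Type} (N : ∀ x, κ x → Finset (α x))
    (W : ∀ x, κ x → α x → ∀ i, A.State → L.S i → ℝ)
    (hW : ∀ i c u, ∑ x, ∑ y, ∑ P ∈ N x y, W x y P i c u ≤ L.r i u) (k : ℕ) (c : A.State)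
    (s : ∀ i, Option (L.S i)) :
    ∑ x, ∑ y, ∑ P ∈ N x y, A.total (W x y P) k c s ≤ A.expect L.reward k c s [] := by
  rw [Agent.expect_reward]
  simp only [← Agent.total_sum]
  refine (Agent.total_mono hW k c s).trans ?_
  simp [MAB.reward]

open Classical in
/-- The reward for playing the tree node `P₀` of the `j₀`-th tree of arm `i₀`. -/
noncomputable def nodeReward (time' : ∀ i, Fin (Ds i).length → TreeNode (L.S i) → ℕ∞)
    (i₀ : Fin L.n) (j₀ : Fin (Ds i₀).length) (P₀ : TreeNode (L.S i₀)) (i : Fin L.n)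
    (c : (algDAG L Ds time').Config) (u : L.S i) : ℝ :=
  if i = i₀ ∧ c.curr i₀ = some (j₀, P₀) then L.r i u else 0

theorem nodeReward_nonneg (i₀ : Fin L.n) (j₀ : Fin (Ds i₀).length) (P₀ : TreeNode (L.S i₀))
    (i : Fin L.n) (c : (algDAG L Ds time').Config) (u : L.S i) :
    0 ≤ nodeReward time' i₀ j₀ P₀ i c u := by
  unfold nodeReward
  split_ifs
  · exact L.r_nonneg i u
  · exact le_rfl

theorem nodeReward_eq_zero {i₀ : Fin L.n} {j₀ : Fin (Ds i₀).length} {P₀ : TreeNode (L.S i₀)}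
    {i : Fin L.n} {c : (algDAG L Ds time').Config} {u : L.S i}
    (h : ¬ (i = i₀ ∧ c.curr i₀ = some (j₀, P₀))) : nodeReward time' i₀ j₀ P₀ i c u = 0 := if_neg h

/-- An arm is at one tree node at a time, so at most one of the node rewards is paid for a play.
This allows every tree node to be bounded separately. -/
theorem sum_nodeReward_le (N : ∀ i, Fin (Ds i).length → Finset (TreeNode (L.S i)))
    (i : Fin L.n) (c : (algDAG L Ds time').Config) (u : L.S i) :
    ∑ i₀, ∑ j₀, ∑ P₀ ∈ N i₀ j₀, nodeReward time' i₀ j₀ P₀ i c u ≤ L.r i u := by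
  classical
  rw [Fintype.sum_eq_single i fun i₀ hi => Finset.sum_eq_zero fun j₀ _ =>
    Finset.sum_eq_zero fun P₀ _ => nodeReward_eq_zero fun hc => hi hc.1.symm]
  rcases hc : c.curr i with _ | ⟨j, P⟩
  · refine le_trans (le_of_eq ?_) (L.r_nonneg i u)
    exact Finset.sum_eq_zero fun j₀ _ => Finset.sum_eq_zero fun P₀ _ => nodeReward_eq_zero fun h => by
      have := hc.symm.trans h.2
      cases this
  · rw [Fintype.sum_eq_single j fun j₀ hj => Finset.sum_eq_zero fun P₀ _ => nodeReward_eq_zero fun h => by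
      have := hc.symm.trans h.2
      cases this
      exact hj rfl]
    calc _ = ∑ P₀ ∈ N i j, if P = P₀ then L.r i u else 0 := by
          refine Finset.sum_congr rfl fun P₀ _ => ?_
          unfold nodeReward
          congr 1
          refine propext ⟨fun h => ?_, fun h => ⟨rfl, hc.trans (by rw [h]; rfl)⟩⟩
          have := hc.symm.trans h.2
          cases this
          rfl
      _ ≤ _ := by
          rw [Finset.sum_ite_eq]
          split_ifs
          · exact le_rfl
          · exact L.r_nonneg i u

theorem nodesAt_treeStart (σ : Choice L Ds) : NodesAt Ds (treeStart L Ds σ) L.start := by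
  intro i x hx
  simp only [treeStart, Option.map_eq_some_iff] at hx
  obtain ⟨j, -, rfl⟩ := hx
  exact ⟨.root, _, _, _, rfl, rfl⟩

/-- A lower bound on the probability of playing a tree node, for a given choice of the dags. -/
theorem currSum_treeStart_mul_le (hL : L.IsLayered depth)
    (hDs : ∀ i j, L.IsForwardDag B i ((Ds i).get j))
    (hfill : ∀ i j, Filled L i (depth i) ((Ds i).get j) (time' i j))
    {i₀ : Fin L.n} {j₀ : Fin (Ds i₀).length} {P₀ : TreeNode (L.S i₀)}
    (hP₀ : L.IsNode i₀ ((Ds i₀).get j₀) P₀) (hfin : treeTime P₀ ≠ ⊤) {T : ℕ}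
    (hT : time' i₀ j₀ (treeHead (time' i₀ j₀) P₀) = T) (σ : Choice L Ds) :
    currSum B Ds i₀ (nodeIndicator j₀ P₀ (onLast (fun u _ => L.r i₀ u) P₀))
        (treeStart L Ds σ i₀) *
      (1 - ∑ i ∈ univ.erase i₀, currSum B Ds i (fun j P => delayCost T (time' i j P))
        (treeStart L Ds σ i)) ≤
      (algDAG L Ds time').agent.total (nodeReward time' i₀ j₀ P₀) B
        (launch L Ds (algDAG L Ds time') (treeStart L Ds σ)).val L.start := by
  obtain ⟨h1, h2, h3, h4, -⟩ := Running.settle (B := B) (fun i j => (hfill i j).toGapInv)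
    (nodesAt_treeStart σ) none
  obtain ⟨hvN, -, hvs, -⟩ := treeHead_spec (time := time' i₀ j₀) hP₀
  have hρ : 0 ≤ onLast (fun u _ => L.r i₀ u) P₀ := by
    rcases P₀ with _ | ⟨⟨u, t⟩, R⟩
    · exact le_rfl
    · exact L.r_nonneg i₀ u
  have := currSum_mul_le_total hDs hL.depth_succ hL.depth_root hfill hP₀ hfin rfl hT hρ
    (nodeReward_nonneg (time' := time') i₀ j₀ P₀) ?_ B 0 _ L.start 0 h1 le_rfl (zero_add B) ?_
  · refine le_trans (le_of_eq ?_) this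
    rw [h2, sub_zero]
    congr 2
    exact Finset.sum_congr rfl fun i _ => (h2 i _).symm
  · rintro c u t R hc rfl
    exact (if_pos ⟨rfl, hc⟩).ge
  · intro Q hQ hs _
    have hQ' := h3 i₀ _ hQ
    have hlen : Q.length = 1 := by
      obtain ⟨j, -, hj⟩ := Option.map_eq_some_iff.1 hQ'
      cases hj
      rfl
    have hv1 : 1 ≤ (treeHead (time' i₀ j₀) P₀).length := List.length_pos_iff.2 hvN.ne_nil
    have hQT : time' i₀ j₀ Q ≤ T := by
      rw [← hT]
      refine (hfill i₀ j₀).toGapInv.time_mono hvN ?_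
        (List.suffix_of_suffix_length_le hs hvs (hlen ▸ hv1))
      rintro rfl
      simp at hlen
    refine Or.inl ⟨hlen ▸ hv1, by rw [hlen]; simp, fun b hb _ => ?_⟩
    rcases (h4 i₀ _ hQ' (ne_top_of_le_ne_top (ENat.natCast_ne_top T) hQT)).2 b hb with h6 | h6
    · cases h6
    · exact h6.trans hQT

open Classical in
/-- The expected reward that is earned at one tree node. -/
theorem prob_mul_le_sum_pick (hL : L.IsLayered depth) (h : L.IsFeasible B z w)
    (hDs : ∀ i j, L.IsForwardDag B i ((Ds i).get j))
    (hz : ∀ i u, ∀ t ∈ Icc 1 B, ((Ds i).map fun D => D.prob u t).sum = z i u t)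
    (hfill : ∀ i j, Filled L i (depth i) ((Ds i).get j) (time' i j))
    {i₀ : Fin L.n} {j₀ : Fin (Ds i₀).length} {P₀ : TreeNode (L.S i₀)}
    (hP₀ : L.IsNode i₀ ((Ds i₀).get j₀) P₀) (hfin : treeTime P₀ ≠ ⊤) :
    1 / 64 * (((Ds i₀).get j₀).prob (L.root i₀) ((Ds i₀).get j₀).rootTime *
      subtreeSum B ((Ds i₀).get j₀)
        (nodeIndicator j₀ P₀ (onLast (fun u _ => L.r i₀ u) P₀) j₀)
        (((Ds i₀).get j₀).treeRoot (L.root i₀))) ≤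
      ∑ σ : Choice L Ds, (∏ i, pick L Ds i (σ i)) *
        (algDAG L Ds time').agent.total (nodeReward time' i₀ j₀ P₀) B
          (launch L Ds (algDAG L Ds time') (treeStart L Ds σ)).val L.start := by
  have hI := (hfill i₀ j₀).toGapInv
  obtain ⟨hvN, hvh, hvs, -⟩ := treeHead_spec (time := time' i₀ j₀) hP₀
  obtain ⟨T, hT⟩ := ENat.ne_top_iff_exists.1 (ne_top_of_le_ne_top (hI.ne_top hP₀ hfin)
    (hI.time_mono hP₀ hvN.ne_nil hvs))
  have hTmem : T ∈ Icc 1 B := by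
    have h1 := hI.head _ hvN hvh
    rw [← hT] at h1
    have h2 := hvN.length_le_time (hDs i₀ j₀).toIsStratDag
    have h3 := (hvN.time_le (hDs i₀ j₀).toIsStratDag).resolve_left (by rw [← h1]; simp)
    rw [← h1] at h2 h3
    have h4 := List.length_pos_iff.2 hvN.ne_nil
    have h5 : (treeHead (time' i₀ j₀) P₀).length ≤ T := by exact_mod_cast h2
    exact Finset.mem_Icc.2 ⟨by omega, by exact_mod_cast h3⟩
  have hpick := pick_nonneg h hDs hz
  have hρ : 0 ≤ onLast (fun u _ => L.r i₀ u) P₀ := by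
    rcases P₀ with _ | ⟨⟨u, t⟩, R⟩
    · exact le_rfl
    · exact L.r_nonneg i₀ u
  set f : Option (Fin (Ds i₀).length) → ℝ := fun o =>
    currSum B Ds i₀ (nodeIndicator j₀ P₀ (onLast (fun u _ => L.r i₀ u) P₀))
      (o.map fun j => (j, ((Ds i₀).get j).treeRoot (L.root i₀))) with hf
  set g : ∀ i, Option (Fin (Ds i).length) → ℝ := fun i o =>
    currSum B Ds i (fun j P => delayCost T (time' i j P))
      (o.map fun j => (j, ((Ds i).get j).treeRoot (L.root i))) with hg
  have hroot : ∀ i (o : Option (Fin (Ds i).length)) x,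
      (o.map fun j => (j, ((Ds i).get j).treeRoot (L.root i))) = some x →
      L.IsNode i ((Ds i).get x.1) x.2 := by
    intro i o x hx
    obtain ⟨j, -, rfl⟩ := Option.map_eq_some_iff.1 hx
    exact .root
  have hf0 : ∀ o, 0 ≤ f o := fun o =>
    currSum_nonneg hDs (nodeIndicator_nonneg j₀ P₀ hρ) (hroot i₀ o)
  have hg0 : ∀ i o, 0 ≤ g i o := fun i o =>
    currSum_nonneg hDs (fun _ _ => delayCost_nonneg _ _) (hroot i o)
  -- The bound `15` on the charge, reduced by the factor `1 / 24` of the choice probabilities.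
  have hmeang : ∑ i ∈ univ.erase i₀, ∑ o, pick L Ds i o * g i o ≤ 15 / 24 := by
    calc _ ≤ ∑ i, ∑ o, pick L Ds i o * g i o :=
          Finset.sum_le_sum_of_subset_of_nonneg (Finset.erase_subset _ _) fun i _ _ =>
            Finset.sum_nonneg fun o _ => mul_nonneg (hpick i o) (hg0 i o)
      _ = (∑ i, ∑ j, ((Ds i).get j).prob (L.root i) ((Ds i).get j).rootTime *
            subtreeSum B ((Ds i).get j) (fun P => delayCost T (time' i j P))
              (((Ds i).get j).treeRoot (L.root i))) / 24 := by
          rw [Finset.sum_div]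
          refine Finset.sum_congr rfl fun i _ => ?_
          rw [Fintype.sum_option, Finset.sum_div]
          simp only [hg, Option.map_none, Option.map_some, currSum, mul_zero, zero_add, pick]
          exact Finset.sum_congr rfl fun j _ => by ring
      _ ≤ _ := div_le_div_of_nonneg_right
          (sum_prob_mul_delayCost_le hL h hDs hz (fun i j => (hfill i j).toGapInv) hTmem)
          (by norm_num)
  have hmeanf : ((Ds i₀).get j₀).prob (L.root i₀) ((Ds i₀).get j₀).rootTime / 24 *
      subtreeSum B ((Ds i₀).get j₀) (nodeIndicator j₀ P₀ (onLast (fun u _ => L.r i₀ u) P₀) j₀)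
        (((Ds i₀).get j₀).treeRoot (L.root i₀)) ≤ ∑ o, pick L Ds i₀ o * f o :=
    Finset.single_le_sum (f := fun o => pick L Ds i₀ o * f o)
      (fun o _ => mul_nonneg (hpick i₀ o) (hf0 o)) (Finset.mem_univ (some j₀))
  have hmean0 : 0 ≤ ∑ o, pick L Ds i₀ o * f o :=
    Finset.sum_nonneg fun o _ => mul_nonneg (hpick i₀ o) (hf0 o)
  -- `1 / 64 = 1 / 24 * (9 / 24)`: the tree is chosen, and `9 / 24 = 1 - 15 / 24` remains after the
  -- charge.
  calc _ = ((Ds i₀).get j₀).prob (L.root i₀) ((Ds i₀).get j₀).rootTime / 24 *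
        subtreeSum B ((Ds i₀).get j₀)
          (nodeIndicator j₀ P₀ (onLast (fun u _ => L.r i₀ u) P₀) j₀)
          (((Ds i₀).get j₀).treeRoot (L.root i₀)) * (9 / 24) := by ring
    _ ≤ (∑ o, pick L Ds i₀ o * f o) *
        (1 - ∑ i ∈ univ.erase i₀, ∑ o, pick L Ds i o * g i o) :=
        mul_le_mul hmeanf (by linarith) (by norm_num) hmean0
    -- The charge is a sum over the other arms, so independence of `i₀` from one other arm at a time
    -- is enough.
    _ = ∑ σ : Choice L Ds, (∏ i, pick L Ds i (σ i)) *
        (f (σ i₀) * (1 - ∑ i ∈ univ.erase i₀, g i (σ i))) := by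
        simp only [mul_sub, mul_one, Finset.sum_sub_distrib, Finset.mul_sum (univ.erase i₀)]
        rw [sum_prod_pick_mul_apply, Finset.sum_comm]
        congr 1
        refine Finset.sum_congr rfl fun i hi => ?_
        exact (sum_prod_pick_mul_apply_mul_apply (Finset.ne_of_mem_erase hi) f (g i)).symm
    _ ≤ _ := Finset.sum_le_sum fun σ _ => mul_le_mul_of_nonneg_left
        (currSum_treeStart_mul_le hL hDs hfill hP₀ hfin hT.symm σ)
        (Finset.prod_nonneg fun i _ => hpick i (σ i))

/-- The tree nodes at which a play may be made. -/
noncomputable def playedNodes (hDs : ∀ i j, L.IsForwardDag B i ((Ds i).get j)) (i : Fin L.n)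
    (j : Fin (Ds i).length) : Finset (TreeNode (L.S i)) :=
  ((finite_isNode (hDs i j).toIsStratDag).subset
    (t := {P | L.IsNode i ((Ds i).get j) P ∧ treeTime P ≠ ⊤}) fun _ hP => hP.1).toFinset

theorem mem_playedNodes (hDs : ∀ i j, L.IsForwardDag B i ((Ds i).get j)) {i : Fin L.n}
    {j : Fin (Ds i).length} {P : TreeNode (L.S i)} :
    P ∈ playedNodes hDs i j ↔ L.IsNode i ((Ds i).get j) P ∧ treeTime P ≠ ⊤ := by
  simp [playedNodes]

theorem sum_subtreeSum_nodeIndicator (hDs : ∀ i j, L.IsForwardDag B i ((Ds i).get j))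
    (i : Fin L.n) (j : Fin (Ds i).length) :
    ∑ P₀ ∈ playedNodes hDs i j, subtreeSum B ((Ds i).get j)
      (nodeIndicator j P₀ (onLast (fun u _ => L.r i u) P₀) j)
        (((Ds i).get j).treeRoot (L.root i)) =
      subtreeSum B ((Ds i).get j) (onLast fun u _ => L.r i u)
        (((Ds i).get j).treeRoot (L.root i)) := by
  rw [← subtreeSum_sum]
  refine subtreeSum_congr (hDs i j) .root fun Q hQ _ hfin => ?_
  refine (Finset.sum_eq_single_of_mem Q ((mem_playedNodes hDs).2 ⟨hQ, hfin⟩)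
    fun P₀ _ hne => ?_).trans (if_pos ⟨rfl, rfl⟩)
  exact if_neg fun hc => hne hc.2.symm

/-- The objective is linear in `z`, so it splits over the dags and then over the tree nodes, each
weighted with its probability of being visited. These are the shares that are compared with the
earnings node by node. -/
theorem value_eq_sum_playedNodes (hL : L.IsLayered depth)
    (hDs : ∀ i j, L.IsForwardDag B i ((Ds i).get j))
    (hz : ∀ i u, ∀ t ∈ Icc 1 B, ((Ds i).map fun D => D.prob u t).sum = z i u t) :
    L.value B z = ∑ i, ∑ j, ∑ P₀ ∈ playedNodes hDs i j,
      ((Ds i).get j).prob (L.root i) ((Ds i).get j).rootTime * subtreeSum B ((Ds i).get j)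
        (nodeIndicator j P₀ (onLast (fun u _ => L.r i u) P₀) j)
          (((Ds i).get j).treeRoot (L.root i)) := by
  simp only [← Finset.mul_sum, sum_subtreeSum_nodeIndicator]
  exact (sum_prob_mul_subtreeSum hDs hz (fun i u => hL.root_no_arc i u) fun i u _ =>
    L.r i u).symm

theorem sum_total_nodeReward_le (N : ∀ i, Fin (Ds i).length → Finset (TreeNode (L.S i)))
    (σ : Choice L Ds) (k : ℕ) :
    ∑ i, ∑ j, ∑ P₀ ∈ N i j, (algDAG L Ds time').agent.total (nodeReward time' i j P₀) k
      (launch L Ds (algDAG L Ds time') (treeStart L Ds σ)).val L.start ≤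
      algDAGExpect L Ds time' σ L.reward k :=
  Agent.sum_total_le_expect (A := (algDAG L Ds time').agent) N (nodeReward time')
    (sum_nodeReward_le N) k _ L.start

/-- The algorithm on the gap-filled trees earns a constant fraction of the value. -/
theorem value_le_algDAGReward (hL : L.IsLayered depth) (h : L.IsFeasible B z w)
    (hDs : ∀ i j, L.IsForwardDag B i ((Ds i).get j))
    (hz : ∀ i u, ∀ t ∈ Icc 1 B, ((Ds i).map fun D => D.prob u t).sum = z i u t)
    (hfill : ∀ i j, Filled L i (depth i) ((Ds i).get j) (time' i j)) :
    1 / 64 * L.value B z ≤ algDAGReward L Ds time' B := by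
  classical
  have h1 := fun i j P₀ (hP : P₀ ∈ playedNodes hDs i j) =>
    prob_mul_le_sum_pick hL h hDs hz hfill ((mem_playedNodes hDs).1 hP).1
      ((mem_playedNodes hDs).1 hP).2
  have h2 := Finset.sum_le_sum fun (i : Fin L.n) (_ : i ∈ univ) =>
    Finset.sum_le_sum fun (j : Fin (Ds i).length) (_ : j ∈ univ) =>
      Finset.sum_le_sum fun P₀ hP => h1 i j P₀ hP
  simp only [← Finset.mul_sum] at h2
  rw [value_eq_sum_playedNodes hL hDs hz]
  simp only [← Finset.mul_sum]
  refine h2.trans ?_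
  have h3 : ∀ F : ∀ i, Fin (Ds i).length → TreeNode (L.S i) → Choice L Ds → ℝ,
      ∑ i, ∑ j, ∑ P₀ ∈ playedNodes hDs i j, ∑ σ, F i j P₀ σ =
        ∑ σ, ∑ i, ∑ j, ∑ P₀ ∈ playedNodes hDs i j, F i j P₀ σ := by
    intro F
    rw [Finset.sum_comm]
    refine Finset.sum_congr rfl fun i _ => ?_
    rw [Finset.sum_comm]
    exact Finset.sum_congr rfl fun j _ => Finset.sum_comm
  rw [h3]
  simp only [← Finset.mul_sum]
  unfold algDAGReward
  refine le_trans (Finset.sum_le_sum (g := fun σ => (∏ i, pick L Ds i (σ i)) *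
    algDAGExpect L Ds time' σ L.reward B) fun σ _ => ?_) (le_of_eq ?_)
  · exact mul_le_mul_of_nonneg_left (sum_total_nodeReward_le (playedNodes hDs) σ B)
      (Finset.prod_nonneg fun i _ => pick_nonneg h hDs hz i (σ i))
  · congr!

end Reward

/-! ### Assembly of the theorem -/

theorem mainTheorem2 :
    (∃ c : ℝ, 0 < c ∧ ∃ q : Polynomial ℕ,
      ∀ (L : MAB) (depth : ∀ i, L.S i → ℕ), L.IsLayered depth → ∀ B : ℕ,
        (∃ z w, L.IsOptimal B z w) ∧
        ∀ z w, L.IsFeasible B z w →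
          ∀ Ds : ∀ i, List (StratDag (L.S i)),
            (∀ i, Ds i = (stratDags L B i (depth i) (z i)).val) →
            (∀ i, (∀ D ∈ Ds i, L.IsStratDag B i D) ∧
              (∀ u, ∀ t ∈ Finset.Icc 1 B, ((Ds i).map fun D => D.prob u t).sum = z i u t) ∧
              ∀ o, 0 ≤ pick L Ds i o) ∧
            (∃ time' : ∀ i, Fin (Ds i).length → TreeNode (L.S i) → ℕ∞,
              ∀ i j, L.GapFill B i (depth i) ((Ds i).get j) (time' i j)) ∧
            (∀ time' : ∀ i, Fin (Ds i).length → TreeNode (L.S i) → ℕ∞,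
              (∀ i j, L.GapFill B i (depth i) ((Ds i).get j) (time' i j)) →
              c * L.value B z ≤ algDAGReward L Ds time' B ∧
              ∀ (σ : Choice L Ds) (F : List (Σ i, L.S i) → ℝ) (k : ℕ),
                implicitFillExpect L depth Ds σ F k = algDAGExpect L Ds time' σ F k ∧
                implicitPlayExpect L depth Ds σ F k = algDAGExpect L Ds time' σ F k) ∧
            (∀ (σ : Choice L Ds) (k : ℕ),
              ∑ i, (stratDags L B i (depth i) (z i)).cost + implicitPlayCost L depth Ds σ k ≤
                q.eval (B + L.size))) ∧
    (∀ (M : MAB) (B : ℕ) (hB : 0 < B),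
      (M.layered B hB).IsLayered (fun _ x => (x.1.2 : ℕ)) ∧
      (∀ i : Fin M.n, Nat.card ((M.layered B hB).S i) ≤ B * Fintype.card (M.S i)) ∧
      (∀ (A : Agent (M.layered B hB)) (c₀ : A.State) (F : List (Σ i, M.S i) → ℝ),
        A.unlayer.expect F B (c₀, fun i => some ((M.layered B hB).root i)) M.start [] =
          A.expect (fun h => F (h.map fun x => ⟨x.1, x.2.1.1⟩)) B c₀ (M.layered B hB).start []) ∧
      (∀ (A : Agent M) (c₀ : A.State) (z w), (M.layered B hB).IsOptimal B z w →
        A.expect M.reward B c₀ M.start [] ≤ (M.layered B hB).value B z)) := by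
  -- The polynomial adds the `33` for the decomposition and the `69` for the plays, with `N = B +
  -- L.size + 1`; the extra one makes `N` positive.
  refine ⟨⟨1 / 64, by norm_num, Polynomial.C 102 * (Polynomial.X + 1) ^ 8,
    fun L depth hL B => ⟨L.exists_isOptimal B, fun z w h Ds hDs => ?_⟩⟩, fun M B hB =>
    ⟨M.isLayered_layered B hB, fun i => MAB.card_layerState_le i,
      fun A c₀ F => A.unlayer_expect c₀ F, fun A c₀ z w h => A.expect_reward_le_layered c₀ h⟩⟩
  have hforward : ∀ i, ∀ D ∈ Ds i, L.IsForwardDag B i D := fun i D hD =>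
    (stratDags_spec hL h i).1 D (hDs i ▸ hD)
  have hget : ∀ i j, L.IsForwardDag B i ((Ds i).get j) := fun i j =>
    hforward i _ (List.get_mem _ _)
  have hz : ∀ i u, ∀ t ∈ Finset.Icc 1 B, ((Ds i).map fun D => D.prob u t).sum = z i u t :=
    fun i u t ht => by rw [hDs i]; exact (stratDags_spec hL h i).2 u t ht
  refine ⟨fun i => ⟨fun D hD => (hforward i D hD).toIsStratDag, hz i, pick_nonneg h hget hz i⟩,
    ?_, fun time' htime => ?_, fun σ k => ?_⟩
  · choose time' htime using fun i j =>
      exists_gapFill (hget i j).toIsStratDag (hL.depth_succ i) (hL.depth_root i)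
    exact ⟨time', htime⟩
  · have hfill := fun i j =>
      (htime i j).filled (hget i j).toIsStratDag (hL.depth_succ i) (hL.depth_root i)
    refine ⟨value_le_algDAGReward hL h hget hz hfill, fun σ F k => ?_⟩
    have h1 := implicitFillExpect_eq hfill σ F k
    exact ⟨h1, (implicitPlayExpect_eq σ F k).trans h1⟩
  · simpa using total_cost_le hL h hDs σ k
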